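/- Let $K$ be a field and let $\Lambda=\bigoplus_{i\ge 0}\Lambda_i$ be a graded factor of a path algebra: $\Lambda=KQ/I$, where $Q$ is a finite quiver, $KQ$ is graded by the length of paths and $I$ is a homogeneous ideal contained in $\bigoplus_{k\ge 2}KQ_k$ (equivalently, $\Lambda$ is generated by $\Lambda_0\oplus\Lambda_1$, $\Lambda_0$ is a finite product of copies of $K$, and $\dim_K\Lambda_1<\infty$). Let $Gr_\Lambda$ be the category of $\mathbf Z$-graded right $\Lambda$-modules with degree-preserving morphisms, put $M[k]_i=M_{i+k}$, let $D(\Lambda)=\mathcal Hom_{\Lambda_0}(\Lambda,\Lambda_0)$ be the graded dual of $\Lambda$, and let $Soc^{gr}(M)=\{x\in M : x\Lambda_i=0 \text{ for all } i>0\}$ be the graded socle. A graded module is *almost injective* if it is a direct summand of a direct sum of modules $D(\Lambda)[k]$, $k\in\mathbf Z$; it is *cogenerated in degree* $d$ if every nonzero graded submodule is nonzero in degree $d$. Let $n\ge 2$ and $m\in\mathbf Z$. Let ${}_n\mathcal{LC}^*_\Lambda$ be the category of linear $n$-complexes of almost injective modules: its objects are the sequences $I^\cdot=(I^j,\,d^j:I^j\to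 I^{j+1})_{j\in\mathbf Z}$ in $Gr_\Lambda$ such that every composition of $n$ consecutive differentials is zero and each $I^j$ is almost injective and cogenerated in degree $-j$; its morphisms are the families of morphisms in $Gr_\Lambda$ commuting with the differentials. Put $\mathcal U=n\mathbf Z\cup(n\mathbf Z+1)$ and $\mathcal S=m+\mathcal U$, and let $\delta_m:\mathbf Z\to\mathbf Z$ be given by $\delta_m(2k)=m+kn$ and $\delta_m(2k+1)=m+kn+1$. Let $C(Gr_\Lambda)$ be the category of cochain complexes of graded $\Lambda$-modules, and let $H=H_m:{}_n\mathcal{LC}^*_\Lambda\to C(Gr_\Lambda)$ be the contraction functor: $H(I^\cdot)=\tilde I^\cdot$ with $\tilde I^k=I^{\delta_m(k)}$, $\tilde d^{2j}=d^{m+jn}$ and $\tilde d^{2j+1}=d^{m+(j+1)n-1}\circ\cdots\circ d^{m+jn+1}$. A complex is *$H$-liftable* if it lies in the essential image of $H$. Let $\mathcal T^*$ be the class of those $I^\cdot\in{}_n\mathcal{LC}^*_\Lambda$ with $I^j=0$ for all $j\in\mathcal S$. Let $\mathcal G^*(\mathcal S,\mathcal U)$ be ${}_n\mathcal{LC}^*_\Lambda$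 if $n=2$ and, if $n>2$, its full subcategory of those $I^\cdot$ for which $Hom_{Gr_\Lambda}(D(\Lambda)[j],Ker\,d^j)=0$ for all $j\notin\mathcal S$ and $Soc^{gr}(I^j)\subseteq Im\,d^{j-1}$ for all $j\not\equiv m\pmod n$. Then ${}_n\mathcal{LC}^*_\Lambda$ is an abelian category, $H$ is an exact additive functor, and the following hold. 1. $Ker(H)=\mathcal T^*$ (that is, $H(I^\cdot)=0$ if and only if $I^\cdot\in\mathcal T^*$), and $H$ induces a faithful functor ${}_n\mathcal{LC}^*_\Lambda/\mathcal T^*\to C(Gr_\Lambda)$ on the quotient category, the localization of ${}_n\mathcal{LC}^*_\Lambda$ at the morphisms whose kernel and cokernel lie in $\mathcal T^*$. 2. The composition $\mathcal G^*(\mathcal S,\mathcal U)\hookrightarrow{}_n\mathcal{LC}^*_\Lambda\xrightarrow{\,H\,}C(Gr_\Lambda)$ is faithful, and its essential image consists of those $H$-liftable complexes $(\tilde I^\cdot,\tilde d^\cdot)$ that satisfy condition (a), if $n=2$, or both conditions (a) and (b), if $n>2$: (a) $\tilde I^j$ is almost injective and cogenerated in degree $-\delta_m(j)$, for all $j\in\mathbf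 Z$; (b) $Soc^{gr}(\tilde I^{2j+1})\subseteq Im(\tilde d^{2j})$, for all $j\in\mathbf Z$. 3. If $\Lambda$ has relations of degree $\ge n$, that is, if $I$ is generated by homogeneous elements of degrees $\ge n$, then the composition in 2 is also full. -/

import Mathlib

open CategoryTheory

universe w u v₁ v₂

noncomputable section

/-! ### Path algebras of finite quivers -/

/-- The path algebra of a finite quiver `V` over `K`.  An element is a family of finite formal
`K`-linear combinations of paths from `a` to `b`, indexed by the pairs `(a, b)` of vertices; as `V`
is finite this is the vector space with basis the set of all paths. -/
@[ext]
structure PathAlgebra (K : Type w) [Field K] (V : Type v₁) [Quiver.{v₂} V] where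
  coeff : ∀ a b : V, Quiver.Path a b →₀ K

namespace PathAlgebra

section Linear

variable {K : Type w} [Field K] {V : Type v₁} [Quiver.{v₂} V]

theorem coeff_injective : Function.Injective (coeff : PathAlgebra K V → _) := fun _ _ h =>
  PathAlgebra.ext h

instance : Zero (PathAlgebra K V) := ⟨⟨0⟩⟩
instance : Add (PathAlgebra K V) := ⟨fun f g => ⟨f.coeff + g.coeff⟩⟩
instance : Neg (PathAlgebra K V) := ⟨fun f => ⟨-f.coeff⟩⟩
instance : Sub (PathAlgebra K V) := ⟨fun f g => ⟨f.coeff - g.coeff⟩⟩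
instance {S : Type*} [SMulZeroClass S K] : SMul S (PathAlgebra K V) :=
  ⟨fun r f => ⟨fun a b => r • f.coeff a b⟩⟩

instance : AddCommGroup (PathAlgebra K V) :=
  coeff_injective.addCommGroup coeff rfl (fun _ _ => rfl) (fun _ => rfl) (fun _ _ => rfl)
    (fun _ _ => rfl) (fun _ _ => rfl)

/-- `coeff` as an additive map. -/
def coeffHom : PathAlgebra K V →+ (∀ a b : V, Quiver.Path a b →₀ K) where
  toFun := coeff
  map_zero' := rfl
  map_add' _ _ := rfl

instance : Module K (PathAlgebra K V) :=
  coeff_injective.module K coeffHom (fun _ _ => rfl)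

@[simp] theorem coeff_zero (a b : V) : (0 : PathAlgebra K V).coeff a b = 0 := rfl
@[simp] theorem coeff_add (f g : PathAlgebra K V) (a b : V) :
    (f + g).coeff a b = f.coeff a b + g.coeff a b := rfl
@[simp] theorem coeff_smul (r : K) (f : PathAlgebra K V) (a b : V) :
    (r • f).coeff a b = r • f.coeff a b := rfl

/-- The bilinear extension of concatenation of paths. -/
def concat {a b c : V} :
    (Quiver.Path a b →₀ K) →ₗ[K] (Quiver.Path b c →₀ K) →ₗ[K] (Quiver.Path a c →₀ K) :=
  Finsupp.lsum K fun p => (LinearMap.lsmul K _).flip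
    (Finsupp.lmapDomain K K fun q : Quiver.Path b c => p.comp q)

@[simp] theorem concat_single {a b c : V} (p : Quiver.Path a b) (q : Quiver.Path b c) (r s : K) :
    concat (Finsupp.single p r) (Finsupp.single q s) = Finsupp.single (p.comp q) (r * s) := by
  simp [concat]

theorem concat_assoc {a b c d : V} (f : Quiver.Path a b →₀ K) (g : Quiver.Path b c →₀ K)
    (h : Quiver.Path c d →₀ K) : concat (concat f g) h = concat f (concat g h) := by
  induction f using Finsupp.induction_linear with
  | zero => simp
  | add f f' hf hf' => simp [hf, hf']
  | single p r =>
    induction g using Finsupp.induction_linear with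
    | zero => simp
    | add g g' hg hg' => simp [hg, hg']
    | single q s =>
      induction h using Finsupp.induction_linear with
      | zero => simp
      | add h h' hh hh' => rw [map_add, hh, hh', map_add, map_add]
      | single q' t =>
        rw [concat_single, concat_single, concat_single, concat_single, mul_assoc,
          Quiver.Path.comp_assoc]

theorem nil_concat {a b : V} (f : Quiver.Path a b →₀ K) :
    concat (Finsupp.single Quiver.Path.nil (1 : K)) f = f := by
  induction f using Finsupp.induction_linear with
  | zero => simp
  | add f g hf hg => simp [hf, hg]
  | single p r => simp

theorem concat_nil {a b : V} (f : Quiver.Path a b →₀ K) :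
    concat f (Finsupp.single Quiver.Path.nil (1 : K)) = f := by
  induction f using Finsupp.induction_linear with
  | zero => simp
  | add f g hf hg => simp [hf, hg]
  | single p r => simp

end Linear

variable {K : Type w} [Field K] {V : Type v₁} [Quiver.{v₂} V]

open Classical in
/-- The unit is the sum of the trivial paths. -/
instance : One (PathAlgebra K V) :=
  ⟨⟨fun a b => if h : a = b then h ▸ Finsupp.single Quiver.Path.nil 1 else 0⟩⟩

theorem coeff_one_self (a : V) :
    (1 : PathAlgebra K V).coeff a a = Finsupp.single Quiver.Path.nil 1 :=
  dif_pos rfl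

theorem coeff_one_of_ne {a b : V} (h : a ≠ b) : (1 : PathAlgebra K V).coeff a b = 0 :=
  dif_neg h

variable [Fintype V]

/-- The product is given by concatenation of paths. -/
instance : Mul (PathAlgebra K V) :=
  ⟨fun f g => ⟨fun a c => ∑ b, concat (f.coeff a b) (g.coeff b c)⟩⟩

theorem coeff_mul (f g : PathAlgebra K V) (a c : V) :
    (f * g).coeff a c = ∑ b, concat (f.coeff a b) (g.coeff b c) := rfl

private theorem one_mul_aux (f : PathAlgebra K V) : 1 * f = f := by
  ext1
  funext a c
  rw [coeff_mul, Finset.sum_eq_single a, coeff_one_self, nil_concat]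
  · intro b _ hb
    rw [coeff_one_of_ne hb.symm, map_zero, LinearMap.zero_apply]
  · simp

private theorem mul_one_aux (f : PathAlgebra K V) : f * 1 = f := by
  ext1
  funext a c
  rw [coeff_mul, Finset.sum_eq_single c, coeff_one_self, concat_nil]
  · intro b _ hb
    rw [coeff_one_of_ne hb, map_zero]
  · simp

private theorem mul_assoc_aux (f g h : PathAlgebra K V) : f * g * h = f * (g * h) := by
  ext1
  funext a d
  simp only [coeff_mul, map_sum, LinearMap.sum_apply, concat_assoc]
  exact Finset.sum_comm

instance : Ring (PathAlgebra K V) where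
  __ := (inferInstance : AddCommGroup (PathAlgebra K V))
  left_distrib f g h := by
    ext1; funext a c; simp [coeff_mul, Finset.sum_add_distrib]
  right_distrib f g h := by
    ext1; funext a c; simp [coeff_mul, Finset.sum_add_distrib]
  zero_mul f := by ext1; funext a c; simp [coeff_mul]
  mul_zero f := by ext1; funext a c; simp [coeff_mul]
  mul_assoc := mul_assoc_aux
  one_mul := one_mul_aux
  mul_one := mul_one_aux

instance : Algebra K (PathAlgebra K V) :=
  Algebra.ofModule
    (fun r f g => by ext1; funext a c; simp [coeff_mul, Finset.smul_sum])
    (fun r f g => by ext1; funext a c; simp [coeff_mul, Finset.smul_sum])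

variable (K V) in
/-- The homogeneous component of degree `k`: the span of the paths of length `k`. -/
def degreePart (k : ℕ) : Submodule K (PathAlgebra K V) where
  carrier := {f | ∀ (a b : V) (p : Quiver.Path a b), f.coeff a b p ≠ 0 → p.length = k}
  zero_mem' := by intro a b p h; simp at h
  add_mem' {f g} hf hg := by
    intro a b p h
    by_contra hk
    have h1 : f.coeff a b p = 0 := by_contra fun h' => hk (hf a b p h')
    have h2 : g.coeff a b p = 0 := by_contra fun h' => hk (hg a b p h')
    simp [h1, h2] at h
  smul_mem' r f hf := by
    intro a b p h
    refine hf a b p fun h' => h ?_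
    simp [h']

end PathAlgebra

section Algebra

variable {K : Type w} [Field K] {Λ : Type u} [Ring Λ] [Algebra K Λ]
variable {V : Type v₁} [Quiver.{v₂} V] [Fintype V]

/-- `π : KQ → Λ` exhibits the graded algebra `Λ = ⨁ 𝒜 i` as a graded factor of the path algebra of
the finite quiver `Q` (with set of vertices `V`) of `Λ`: it is a surjective homomorphism of graded
algebras which is bijective in degrees `0` and `1`. (It follows that `𝒜 i = 0` for `i < 0`, that
`𝒜 0` is a finite product of copies of `K`, and that `𝒜 0 ⊕ 𝒜 1` generates `Λ`.) -/
structure IsGradedFactor (𝒜 : ℤ → Submodule K Λ) (π : PathAlgebra K V →ₐ[K] Λ) : Prop where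
  surjective : Function.Surjective π
  map_mem : ∀ (k : ℕ), ∀ x ∈ PathAlgebra.degreePart K V k, π x ∈ 𝒜 k
  injOn_zero : ∀ x ∈ PathAlgebra.degreePart K V 0, π x = 0 → x = 0
  injOn_one : ∀ x ∈ PathAlgebra.degreePart K V 1, π x = 0 → x = 0

/-- `Λ = KQ/I`, `I = ker π`, has relations of degree `≥ n`: the ideal `I` is generated by its
homogeneous elements of degrees `k ≥ n`. -/
def HasRelationsOfDegreeGE (π : PathAlgebra K V →ₐ[K] Λ) (n : ℕ) : Prop :=
  TwoSidedIdeal.ker π =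
    TwoSidedIdeal.span {x | π x = 0 ∧ ∃ k, n ≤ k ∧ x ∈ PathAlgebra.degreePart K V k}

end Algebra

/-! ### Graded right modules -/

variable {K : Type w} [Field K] {Λ : Type u} [Ring Λ] [Algebra K Λ]
variable (𝒜 : ℤ → Submodule K Λ) [GradedAlgebra 𝒜]

/-- A `ℤ`-graded right module over the graded algebra `Λ = ⨁ 𝒜 i`, given by its homogeneous
components `M i` and the multiplication maps `M i × 𝒜 j → M (i + j)`. -/
structure GrMod where
  carrier : ℤ → Type u
  [addCommGroup : ∀ i, AddCommGroup (carrier i)]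
  act : ∀ {i j k : ℤ}, i + j = k → carrier i → 𝒜 j → carrier k
  add_act : ∀ {i j k : ℤ} (h : i + j = k) (x y : carrier i) (a : 𝒜 j),
    act h (x + y) a = act h x a + act h y a
  act_add : ∀ {i j k : ℤ} (h : i + j = k) (x : carrier i) (a b : 𝒜 j),
    act h x (a + b) = act h x a + act h x b
  act_one : ∀ {i : ℤ} (x : carrier i), act (add_zero i) x ⟨1, SetLike.GradedOne.one_mem⟩ = x
  act_act : ∀ {i j k l p q : ℤ} (h₁ : i + j = k) (h₂ : k + l = p) (h₃ : j + l = q) (h₄ : i + q = p)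
    (x : carrier i) (a : 𝒜 j) (b : 𝒜 l),
    act h₂ (act h₁ x a) b = act h₄ x ⟨a * b, h₃ ▸ SetLike.GradedMul.mul_mem a.2 b.2⟩

namespace GrMod

attribute [instance] GrMod.addCommGroup

variable {𝒜}

/-- Morphisms of graded modules: homomorphisms of modules which preserve degrees. -/
@[ext]
structure Hom (M N : GrMod 𝒜) where
  app : ∀ i, M.carrier i →+ N.carrier i
  app_act : ∀ {i j k : ℤ} (h : i + j = k) (x : M.carrier i) (a : 𝒜 j),
    app k (M.act h x a) = N.act h (app i x) a

/-- The category `Gr_Λ`. -/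
instance : Category (GrMod 𝒜) where
  Hom := Hom
  id M := ⟨fun i => AddMonoidHom.id _, fun _ _ _ => rfl⟩
  comp f g := ⟨fun i => (g.app i).comp (f.app i), fun h x a => by simp [f.app_act, g.app_act]⟩

@[ext]
theorem hom_ext {M N : GrMod 𝒜} {f g : M ⟶ N} (h : ∀ i x, f.app i x = g.app i x) : f = g :=
  Hom.ext (funext fun i => AddMonoidHom.ext (h i))

@[simp] theorem id_app (M : GrMod 𝒜) (i : ℤ) (x : M.carrier i) : Hom.app (𝟙 M) i x = x := rfl
@[simp] theorem comp_app {M N P : GrMod 𝒜} (f : M ⟶ N) (g : N ⟶ P) (i : ℤ) (x : M.carrier i) :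
    Hom.app (f ≫ g) i x = g.app i (f.app i x) := rfl

/-- Right multiplication by `a` as an additive map. -/
def actHom (M : GrMod 𝒜) {i j k : ℤ} (h : i + j = k) (a : 𝒜 j) : M.carrier i →+ M.carrier k :=
  AddMonoidHom.mk' (fun x => M.act h x a) fun x y => M.add_act h x y a

@[simp] theorem actHom_apply (M : GrMod 𝒜) {i j k : ℤ} (h : i + j = k) (a : 𝒜 j)
    (x : M.carrier i) : M.actHom h a x = M.act h x a := rfl

@[simp] theorem zero_act (M : GrMod 𝒜) {i j k : ℤ} (h : i + j = k) (a : 𝒜 j) :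
    M.act h 0 a = 0 := (M.actHom h a).map_zero
theorem neg_act (M : GrMod 𝒜) {i j k : ℤ} (h : i + j = k) (x : M.carrier i) (a : 𝒜 j) :
    M.act h (-x) a = -M.act h x a := (M.actHom h a).map_neg x
theorem sub_act (M : GrMod 𝒜) {i j k : ℤ} (h : i + j = k) (x y : M.carrier i) (a : 𝒜 j) :
    M.act h (x - y) a = M.act h x a - M.act h y a := (M.actHom h a).map_sub x y

variable {M N : GrMod 𝒜}

instance : Zero (M ⟶ N) := ⟨⟨fun _ => 0, fun _ _ _ => by simp⟩⟩
instance : Add (M ⟶ N) :=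
  ⟨fun f g => ⟨fun i => f.app i + g.app i, fun _ _ _ => by simp [f.app_act, g.app_act, add_act]⟩⟩
instance : Neg (M ⟶ N) :=
  ⟨fun f => ⟨fun i => -f.app i, fun _ _ _ => by simp [f.app_act, neg_act]⟩⟩
instance : Sub (M ⟶ N) :=
  ⟨fun f g => ⟨fun i => f.app i - g.app i, fun _ _ _ => by simp [f.app_act, g.app_act, sub_act]⟩⟩
instance : SMul ℕ (M ⟶ N) := ⟨nsmulRec⟩
instance : SMul ℤ (M ⟶ N) := ⟨zsmulRec⟩

@[simp] theorem zero_app (i : ℤ) (x : M.carrier i) : Hom.app (0 : M ⟶ N) i x = 0 := rfl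
@[simp] theorem add_app (f g : M ⟶ N) (i : ℤ) (x : M.carrier i) :
    Hom.app (f + g) i x = f.app i x + g.app i x := rfl
@[simp] theorem neg_app (f : M ⟶ N) (i : ℤ) (x : M.carrier i) :
    Hom.app (-f) i x = -f.app i x := rfl
@[simp] theorem sub_app (f g : M ⟶ N) (i : ℤ) (x : M.carrier i) :
    Hom.app (f - g) i x = f.app i x - g.app i x := rfl

instance : AddCommGroup (M ⟶ N) where
  add_assoc f g h := by ext; simp [add_assoc]
  zero_add f := by ext; simp
  add_zero f := by ext; simp
  add_comm f g := by ext; simp [add_comm]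
  neg_add_cancel f := by ext; simp
  sub_eq_add_neg f g := by ext; simp [sub_eq_add_neg]
  nsmul := nsmulRec
  zsmul := zsmulRec

instance : Preadditive (GrMod 𝒜) where
  add_comp _ _ _ f g h := by ext; simp
  comp_add _ _ _ f g h := by ext; simp

/-- The shift `M[k]`, with `M[k]_i = M_{i+k}`. -/
def shift (M : GrMod 𝒜) (k : ℤ) : GrMod 𝒜 where
  carrier i := M.carrier (i + k)
  act h x a := M.act (by omega) x a
  add_act h x y a := M.add_act _ x y a
  act_add h x a b := M.act_add _ x a b
  act_one {i} x := by
    have key : ∀ (p q : ℤ) (e : p + 0 = q) (hpq : p = q) (x : M.carrier p),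
        M.act e x ⟨1, SetLike.GradedOne.one_mem⟩ = hpq ▸ x := by
      rintro p q e rfl x
      exact M.act_one x
    exact key _ _ _ rfl x
  act_act h₁ h₂ h₃ h₄ x a b := M.act_act _ _ h₃ _ x a b

/-- The direct sum of a family of graded modules. -/
def directSum {ι : Type u} (F : ι → GrMod 𝒜) : GrMod 𝒜 where
  carrier i := DirectSum ι fun s => (F s).carrier i
  act h x a := DirectSum.map (fun s => (F s).actHom h a) x
  add_act h x y a := map_add _ x y
  act_add h x a b := by
    refine DFinsupp.ext fun s => ?_
    exact (F s).act_add h _ a b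
  act_one x := by
    refine DFinsupp.ext fun s => ?_
    exact (F s).act_one _
  act_act h₁ h₂ h₃ h₄ x a b := by
    refine DFinsupp.ext fun s => ?_
    exact (F s).act_act h₁ h₂ h₃ h₄ _ a b

variable (𝒜) in
/-- The component of degree `k` of `D(Λ) = 𝓗om_{Λ₀}(Λ, Λ₀)`: the `Λ₀`-linear maps
`Λ_{-k} → Λ₀`. -/
def dualPart (k : ℤ) : AddSubgroup (𝒜 (-k) →+ 𝒜 0) where
  carrier := {f | ∀ (x : 𝒜 (-k)) (e : 𝒜 0),
    (f ⟨x * e, by simpa using SetLike.GradedMul.mul_mem x.2 e.2⟩ : Λ) = f x * e}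
  zero_mem' := by intro x e; simp
  add_mem' {f g} hf hg := by intro x e; simp [hf x e, hg x e, add_mul]
  neg_mem' {f} hf := by intro x e; simp [hf x e]

variable (𝒜) in
/-- The graded right `Λ`-module `D(Λ) = 𝓗om_{Λ₀}(Λ, Λ₀)`, with `(f · a)(x) = f (a x)`. As `Λ₀` is a
finite product of copies of `K`, it is identified with the graded `K`-dual of the left module `Λ` by
the trace `Λ₀ → K`. -/
def dual : GrMod 𝒜 where
  carrier k := dualPart 𝒜 k
  act {i j k} h f a :=
    ⟨AddMonoidHom.mk'
      (fun x => f.1 ⟨a * x, by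
        have := SetLike.GradedMul.mul_mem a.2 x.2
        rwa [show j + -k = -i by omega] at this⟩)
      (fun x y => by
        rw [← map_add]; congr 1; ext1; simp [mul_add]),
     fun x e => by
      have h2 := f.2 ⟨a * x, by
        have := SetLike.GradedMul.mul_mem a.2 x.2
        rwa [show j + -k = -i by omega] at this⟩ e
      refine Eq.trans ?_ h2
      change ((f.1 _ : 𝒜 0) : Λ) = f.1 _
      congr 3
      simp [mul_assoc]⟩
  add_act h x y a := by
    ext; rfl
  act_add {i j k} h f a b := by
    ext x
    change ((f.1 _ : 𝒜 0) : Λ) = ((f.1 _ + f.1 _ : 𝒜 0) : Λ)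
    rw [← map_add]
    congr 3
    simp [add_mul]
  act_one f := by
    ext x
    change ((f.1 _ : 𝒜 0) : Λ) = f.1 _
    simp
  act_act h₁ h₂ h₃ h₄ f a b := by
    ext x
    change ((f.1 _ : 𝒜 0) : Λ) = f.1 _
    congr 3
    simp [mul_assoc]

/-- Almost injective graded modules: the direct summands of direct sums of shifts of `D(Λ)`, that
is, the objects of `Add(⨁ₖ D(Λ)[k])`. -/
def IsAlmostInjective (M : GrMod 𝒜) : Prop :=
  ∃ (ι : Type u) (k : ι → ℤ), Nonempty (Retract M (directSum fun s => (dual 𝒜).shift (k s)))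

/-- A family of subgroups of the homogeneous components is a graded submodule. -/
def IsGrSubmodule (M : GrMod 𝒜) (N : ∀ i, AddSubgroup (M.carrier i)) : Prop :=
  ∀ {i j k : ℤ} (h : i + j = k) (x : M.carrier i) (a : 𝒜 j), x ∈ N i → M.act h x a ∈ N k

/-- `M` is cogenerated in degree `d`: the support of every nonzero graded submodule contains `d`. -/
def IsCogeneratedInDegree (M : GrMod 𝒜) (d : ℤ) : Prop :=
  ∀ N : ∀ i, AddSubgroup (M.carrier i), M.IsGrSubmodule N → (∃ i, N i ≠ ⊥) → N d ≠ ⊥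

/-- The component of degree `i` of the graded socle `{x ∈ M | x J = 0}`, `J = ⨁_{j > 0} 𝒜 j`. -/
def socle (M : GrMod 𝒜) (i : ℤ) : AddSubgroup (M.carrier i) where
  carrier := {x | ∀ (j k : ℤ) (h : i + j = k) (a : 𝒜 j), 0 < j → M.act h x a = 0}
  zero_mem' := by intro j k h a _; simp
  add_mem' hx hy := by intro j k h a hj; rw [add_act, hx j k h a hj, hy j k h a hj, add_zero]
  neg_mem' hx := by intro j k h a hj; rw [neg_act, hx j k h a hj, neg_zero]

/-- The graded socle of the target of `f` is contained in the image of `f`. -/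
def SocleLERange (f : M ⟶ N) : Prop := ∀ i, N.socle i ≤ (f.app i).range

end GrMod

/-! ### Linear `n`-complexes of almost injective modules

A pair `(I, d)` consisting of a family `(I^j)` of graded modules and morphisms
`d^j : I^j ⟶ I^{j+1}` is the same thing as a functor from the ordered set `ℤ` to `Gr_Λ`: the map
`I^i ⟶ I^j` induced by `i ≤ j` is the composition `d^{j-1} ∘ ⋯ ∘ d^i`. The morphisms of pairs are
the natural transformations. -/

/-- The linear `n`-complexes of almost injective modules: the composition of any `n` consecutive
differentials is zero, and `I^k` is almost injective and cogenerated in degree `-k`. -/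
def isLinearNComplex (n : ℕ) : ObjectProperty (ℤ ⥤ GrMod 𝒜) := fun I =>
  (∀ k : ℤ, I.map (homOfLE (show k ≤ k + n by omega)) = 0) ∧
    ∀ k : ℤ, (I.obj k).IsAlmostInjective ∧ (I.obj k).IsCogeneratedInDegree (-k)

/-- The category `ₙLC*_Λ` of linear `n`-complexes of almost injective graded modules. -/
abbrev LinearNComplex (n : ℕ) := (isLinearNComplex 𝒜 n).FullSubcategory

/-- The set `𝒮 = (m + nℤ) ∪ (m + nℤ + 1)`. -/
def supportSet (n : ℕ) (m : ℤ) : Set ℤ := {j | ∃ k : ℤ, j = m + k * n ∨ j = m + k * n + 1}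

/-- The class `𝒯*` of the linear `n`-complexes `I` with `I^j = 0` for all `j ∈ 𝒮`. -/
def torsionClass (n : ℕ) (m : ℤ) : ObjectProperty (LinearNComplex 𝒜 n) := fun I =>
  ∀ j ∈ supportSet n m, Limits.IsZero (I.obj.obj j)

/-- The full subcategory `𝒢*(𝒮, 𝒰)`. It is everything for `n = 2`; for `n > 2` it is given by
the conditions that `Hom(D(Λ)[j], Ker d^j) = 0` for `j ∉ 𝒮` and `Soc(I^j) ⊆ Im d^{j-1}` for
`j ≢ m` modulo `n`. (A morphism to `Ker d^j` is a morphism `f` to `I^j` with `d^j ∘ f = 0`.) -/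
def isGStar (n : ℕ) (m : ℤ) : ObjectProperty (LinearNComplex 𝒜 n) := fun I =>
  2 < n →
    (∀ j : ℤ, j ∉ supportSet n m → ∀ f : (GrMod.dual 𝒜).shift j ⟶ I.obj.obj j,
      f ≫ I.obj.map (homOfLE (show j ≤ j + 1 by omega)) = 0 → f = 0) ∧
    (∀ j : ℤ, ¬ j ≡ m [ZMOD n] →
      GrMod.SocleLERange (I.obj.map (homOfLE (show j - 1 ≤ j by omega))))

/-! ### The contraction functor -/

/-- The strictly increasing enumeration `δ_m` of `𝒮`: `δ_m(2k) = m + kn`, `δ_m(2k+1) = m + kn + 1`. -/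
def contractionIndex (n : ℕ) (m j : ℤ) : ℤ := m + j / 2 * n + j % 2

theorem contractionIndex_even (n : ℕ) (m k : ℤ) : contractionIndex n m (2 * k) = m + k * n := by
  simp [contractionIndex]

theorem contractionIndex_odd (n : ℕ) (m k : ℤ) :
    contractionIndex n m (2 * k + 1) = m + k * n + 1 := by
  rw [contractionIndex, show (2 * k + 1) / 2 = k by omega, show (2 * k + 1) % 2 = 1 by omega]

theorem contractionIndex_le {n : ℕ} (hn : 2 ≤ n) (m : ℤ) {i j : ℤ} (h : i + 1 = j) :
    contractionIndex n m i ≤ contractionIndex n m j := by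
  subst h
  obtain ⟨k, rfl | rfl⟩ := Int.even_or_odd' i
  · rw [contractionIndex_even, contractionIndex_odd]; omega
  · rw [show 2 * k + 1 + 1 = 2 * (k + 1) by ring, contractionIndex_even, contractionIndex_odd,
      add_mul]
    omega

theorem contractionIndex_add_two (n : ℕ) (m : ℤ) {i j l : ℤ} (h : i + 1 = j) (h' : j + 1 = l) :
    contractionIndex n m l = contractionIndex n m i + n := by
  subst h h'
  rw [contractionIndex, contractionIndex, show (i + 1 + 1) / 2 = i / 2 + 1 by omega,
    show (i + 1 + 1) % 2 = i % 2 by omega]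
  ring

variable {𝒜}

/-- The contraction of an `n`-complex `I`: the complex with `Ĩ^k = I^{δ_m(k)}`, whose differential
`Ĩ^k ⟶ Ĩ^{k+1}` is the composition of the differentials of `I` from `I^{δ_m(k)}` to
`I^{δ_m(k+1)}`, i.e. `d^{m+jn}` for `k = 2j` and `d^{m+(j+1)n-1} ∘ ⋯ ∘ d^{m+jn+1}` for
`k = 2j + 1`. -/
def contractionObj {n : ℕ} (hn : 2 ≤ n) (m : ℤ) (I : LinearNComplex 𝒜 n) :
    CochainComplex (GrMod 𝒜) ℤ where
  X k := I.obj.obj (contractionIndex n m k)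
  d i j := if h : i + 1 = j then I.obj.map (homOfLE (contractionIndex_le hn m h)) else 0
  shape i j h := dif_neg h
  d_comp_d' i j l h h' := by
    rw [dif_pos (show i + 1 = j from h), dif_pos (show j + 1 = l from h'), ← I.obj.map_comp]
    have key : ∀ (q : ℤ) (f : contractionIndex n m i ⟶ q),
        q = contractionIndex n m i + n → I.obj.map f = 0 := by
      rintro q f rfl
      exact I.property.1 _
    exact key _ _ (contractionIndex_add_two n m h h')

variable (𝒜)

/-- The contraction functor `H = H_m : ₙLC*_Λ ⥤ C(Gr_Λ)`. -/
def contraction {n : ℕ} (hn : 2 ≤ n) (m : ℤ) :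
    LinearNComplex 𝒜 n ⥤ CochainComplex (GrMod 𝒜) ℤ where
  obj I := contractionObj hn m I
  map f :=
    { f := fun k => f.hom.app (contractionIndex n m k)
      comm' := fun i j h => by
        have h' : i + 1 = j := h
        simp [contractionObj, h'] }

/-! ### Abelian categories and quotient categories -/

/-- The preadditive category `C` is abelian. -/
structure IsAbelianCategory (C : Type*) [Category* C] [Preadditive C] : Prop where
  hasFiniteProducts : Limits.HasFiniteProducts C
  hasKernels : Limits.HasKernels C
  hasCokernels : Limits.HasCokernels C
  isNormalMonoCategory : IsNormalMonoCategory C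
  isNormalEpiCategory : IsNormalEpiCategory C

/-- The morphisms whose kernel and cokernel belong to `P`. For a Serre class `P` in an abelian
category `C`, the quotient category `C/P` is the localization of `C` at this class of morphisms. -/
def isoModulo {C : Type*} [Category* C] [Preadditive C] (P : ObjectProperty C) :
    MorphismProperty C := fun _ _ f =>
  (∃ c : Limits.KernelFork f, Nonempty (Limits.IsLimit c) ∧ P c.pt) ∧
    (∃ c : Limits.CokernelCofork f, Nonempty (Limits.IsColimit c) ∧ P c.pt)

end

/-! The ring Λ₀ is semisimple and each Λ_k is spanned by finitely many paths. Hence an almost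
injective module cogenerated in degree d is the same thing as a cofree one, M_i = Hom_{Λ₀}(Λ_{d-i},
M_d) (`IsGradedFactor.isCofree_iff`). A morphism into a cofree module is a Λ₀-linear map of the
degree d components, and cofreeness passes to kernels, cokernels and finite products. So the linear
n-complexes are closed under these operations in the functor category and form an abelian category
with termwise exactness. Contraction evaluates at the indices in 𝒮; it is therefore exact, and its
kernel is 𝒯*. Faithfulness on the quotient holds for any exact functor and its kernel
(`exact_functor_faithful`).

A linear complex I is encoded by the Λ₀-modules W_j = (I^j)_{-j} and one operator θ_s : W_j →
W_{j+1} for each arrow s: take the element dual to s, then apply the differential (`theta`,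
`dmap_eq_sum`). For n > 2, membership in 𝒢* means that W_j is generated by the images of the θ_s if
j ≢ m, and that no nonzero element of W_j is killed by all θ_s if j ∉ 𝒮. By the first condition a
morphism is determined by its components on 𝒮. For the essential image when n > 2, take any lift,
pass to the subcomplex generated by the terms in 𝒮 (`exists_generated_subobject`), and divide by the
largest subcomplex vanishing on 𝒮 (`exists_torsionFree_quotient`). Neither step changes the terms in
𝒮 up to isomorphism; condition (b) gives generation at the indices m + kn + 1.

For fullness, a morphism of contractions generates a θ-compatible relation between the W_j of the
two complexes (`Gam`), which has to be the graph of a map. If the relations of Λ have degree ≥ n,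
paths of length < n are independent in Λ and have dual elements; the composite differential sends
the dual of a path to the corresponding product of operators θ (`isDual_dmap`, `pathRel_of_isDual`).
Compatibility with the long differentials thus becomes compatibility with all products of n - 1
operators (`Gam.pathRel`), and the second condition on the target makes the relation single-valued
(`Gam.unique`). -/

noncomputable section

variable {K : Type w} [Field K] {Λ : Type u} [Ring Λ] [Algebra K Λ]
variable {𝒜 : ℤ → Submodule K Λ} [GradedAlgebra 𝒜]

/-! ### `Gr_Λ` is abelian -/

namespace GrMod

/-- A graded submodule, as a graded module. -/
def sub (M : GrMod 𝒜) (N : ∀ i, AddSubgroup (M.carrier i)) (hN : M.IsGrSubmodule N) : GrMod 𝒜 where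
  carrier i := N i
  act h x a := ⟨M.act h x.1 a, hN h x.1 a x.2⟩
  add_act h x y a := Subtype.ext (M.add_act h x.1 y.1 a)
  act_add h x a b := Subtype.ext (M.act_add h x.1 a b)
  act_one x := Subtype.ext (M.act_one x.1)
  act_act h₁ h₂ h₃ h₄ x a b := Subtype.ext (M.act_act h₁ h₂ h₃ h₄ x.1 a b)

/-- The inclusion of a graded submodule. -/
def subι (M : GrMod 𝒜) (N : ∀ i, AddSubgroup (M.carrier i)) (hN : M.IsGrSubmodule N) :
    M.sub N hN ⟶ M where
  app i := (N i).subtype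
  app_act _ _ _ := rfl

/-- The corestriction of a morphism to a graded submodule containing its image. -/
def subLift {M X : GrMod 𝒜} (N : ∀ i, AddSubgroup (M.carrier i)) (hN : M.IsGrSubmodule N)
    (f : X ⟶ M) (hf : ∀ i x, f.app i x ∈ N i) : X ⟶ M.sub N hN where
  app i := (f.app i).codRestrict (N i) (hf i)
  app_act h x a := Subtype.ext (f.app_act h x a)

/-- The quotient by a graded submodule. -/
def quot (M : GrMod 𝒜) (N : ∀ i, AddSubgroup (M.carrier i)) (hN : M.IsGrSubmodule N) :
    GrMod 𝒜 where
  carrier i := M.carrier i ⧸ N i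
  act {i j k} h x a :=
    QuotientAddGroup.map (N i) (N k) (M.actHom h a) (fun x hx => hN h x a hx) x
  add_act h x y a := map_add _ x y
  act_add h x a b := by
    induction x using QuotientAddGroup.induction_on with | _ x =>
    exact congrArg _ (M.act_add h x a b)
  act_one x := by
    induction x using QuotientAddGroup.induction_on with | _ x =>
    exact congrArg _ (M.act_one x)
  act_act h₁ h₂ h₃ h₄ x a b := by
    induction x using QuotientAddGroup.induction_on with | _ x =>
    exact congrArg _ (M.act_act h₁ h₂ h₃ h₄ x a b)

/-- The projection to the quotient by a graded submodule. -/
def quotπ (M : GrMod 𝒜) (N : ∀ i, AddSubgroup (M.carrier i)) (hN : M.IsGrSubmodule N) :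
    M ⟶ M.quot N hN where
  app i := QuotientAddGroup.mk' (N i)
  app_act _ _ _ := rfl

theorem quotπ_surjective (M : GrMod 𝒜) (N : ∀ i, AddSubgroup (M.carrier i))
    (hN : M.IsGrSubmodule N) (i : ℤ) : Function.Surjective ((M.quotπ N hN).app i) :=
  QuotientAddGroup.mk'_surjective _

theorem quotπ_eq_zero_iff (M : GrMod 𝒜) (N : ∀ i, AddSubgroup (M.carrier i))
    (hN : M.IsGrSubmodule N) {i : ℤ} (x : M.carrier i) : (M.quotπ N hN).app i x = 0 ↔ x ∈ N i :=
  QuotientAddGroup.eq_zero_iff x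

/-- The morphism from a quotient induced by a morphism vanishing on the submodule. -/
def quotDesc {M X : GrMod 𝒜} (N : ∀ i, AddSubgroup (M.carrier i)) (hN : M.IsGrSubmodule N)
    (f : M ⟶ X) (hf : ∀ i, ∀ x ∈ N i, f.app i x = 0) : M.quot N hN ⟶ X where
  app i := QuotientAddGroup.lift (N i) (f.app i) (hf i)
  app_act h x a := by
    induction x using QuotientAddGroup.induction_on with | _ x =>
    exact f.app_act h x a

variable {M N : GrMod 𝒜}

theorem isGrSubmodule_ker (f : M ⟶ N) : M.IsGrSubmodule fun i => (f.app i).ker :=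
  fun h x a hx => by
    rw [AddMonoidHom.mem_ker] at hx ⊢
    rw [f.app_act, hx, zero_act]

theorem isGrSubmodule_range (f : M ⟶ N) : N.IsGrSubmodule fun i => (f.app i).range := by
  rintro i j k h _ a ⟨y, rfl⟩
  exact ⟨M.act h y a, f.app_act h y a⟩

theorem subι_ker_comp (f : M ⟶ N) : subι _ _ (isGrSubmodule_ker f) ≫ f = 0 := by
  ext i x
  exact AddMonoidHom.mem_ker.1 x.2

theorem comp_quotπ_range (f : M ⟶ N) : f ≫ quotπ _ _ (isGrSubmodule_range f) = 0 := by
  ext i x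
  exact (QuotientAddGroup.eq_zero_iff (N := (f.app i).range) _).2 (AddMonoidHom.mem_range.2 ⟨x, rfl⟩)

theorem congr_app {f g : M ⟶ N} (h : f = g) (i : ℤ) (x : M.carrier i) : f.app i x = g.app i x := by
  rw [h]

theorem mono_of_injective (f : M ⟶ N) (hf : ∀ i, Function.Injective (f.app i)) : Mono f where
  right_cancellation g h e := by
    ext i x
    exact hf i (congr_app e i x)

theorem epi_of_surjective (f : M ⟶ N) (hf : ∀ i, Function.Surjective (f.app i)) : Epi f where
  left_cancellation g h e := by
    ext i x
    obtain ⟨x, rfl⟩ := hf i x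
    exact congr_app e i x

/-- A morphism is a kernel of `g` if it is injective with image the kernel of `g`. -/
def isLimitKernelFork {P : GrMod 𝒜} (f : M ⟶ N) (g : N ⟶ P) (w : f ≫ g = 0)
    (hf : ∀ i, Function.Injective (f.app i)) (hg : ∀ i x, g.app i x = 0 → ∃ y, f.app i y = x) :
    Limits.IsLimit (Limits.KernelFork.ofι f w) :=
  have := mono_of_injective f hf
  Limits.KernelFork.IsLimit.ofι' f w fun {A} k hk =>
    have hk' : ∀ i x, ∃ y, f.app i y = k.app i x := fun i x =>
      hg i _ (congr_app hk i x)
    ⟨{ app := fun i => AddMonoidHom.mk' (fun x => (hk' i x).choose) fun x y => hf i <|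
          (hk' i (x + y)).choose_spec.trans <| by
            rw [map_add, map_add, (hk' i x).choose_spec, (hk' i y).choose_spec]
       app_act := fun {i j l} h x a => hf l <| by
          rw [f.app_act]
          change f.app l (hk' l _).choose = N.act h (f.app i (hk' i _).choose) a
          rw [(hk' l _).choose_spec, (hk' i _).choose_spec, k.app_act] },
      by ext i x; exact (hk' i x).choose_spec⟩

/-- A morphism is a cokernel of `f` if it is surjective with kernel the image of `f`. -/
def isColimitCokernelCofork {P : GrMod 𝒜} (f : M ⟶ N) (g : N ⟶ P) (w : f ≫ g = 0)
    (hg : ∀ i, Function.Surjective (g.app i)) (hf : ∀ i x, g.app i x = 0 → ∃ y, f.app i y = x) :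
    Limits.IsColimit (Limits.CokernelCofork.ofπ g w) :=
  have := epi_of_surjective g hg
  Limits.CokernelCofork.IsColimit.ofπ' g w fun {A} k hk =>
    have hk' : ∀ i x, g.app i x = 0 → k.app i x = 0 := fun i x hx => by
      obtain ⟨y, rfl⟩ := hf i x hx
      exact congr_app hk i y
    have key : ∀ i x y, g.app i x = g.app i y → k.app i x = k.app i y := fun i x y h => by
      rw [← sub_eq_zero, ← map_sub]
      exact hk' i _ (by rw [map_sub, h, sub_self])
    have key' : ∀ i x, k.app i (hg i (g.app i x)).choose = k.app i x := fun i x =>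
      key i _ _ (hg i _).choose_spec
    ⟨{ app := fun i => AddMonoidHom.mk' (fun y => k.app i (hg i y).choose) fun x y => by
          obtain ⟨x, rfl⟩ := hg i x
          obtain ⟨y, rfl⟩ := hg i y
          rw [← map_add, key', key', key', map_add]
       app_act := fun {i j l} h y a => by
          obtain ⟨x, rfl⟩ := hg i y
          change k.app l (hg l (P.act h _ a)).choose = A.act h (k.app i (hg i _).choose) a
          rw [← g.app_act, key', key', k.app_act] },
      by ext i x; exact key' i x⟩

instance : Limits.HasKernels (GrMod 𝒜) where
  has_limit f := ⟨⟨_, isLimitKernelFork (subι _ _ (isGrSubmodule_ker f)) f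
    (subι_ker_comp f) (fun _ => Subtype.val_injective) fun _ x hx => ⟨⟨x, hx⟩, rfl⟩⟩⟩

instance : Limits.HasCokernels (GrMod 𝒜) where
  has_colimit f := ⟨⟨_, isColimitCokernelCofork f (quotπ _ _ (isGrSubmodule_range f))
    (comp_quotπ_range f) (fun _ => quotπ_surjective _ _ _ _)
    fun _ _ hx => (quotπ_eq_zero_iff _ _ _ _).1 hx⟩⟩

/-- A monomorphism cancels from the inclusion of its graded kernel, so this inclusion is zero. -/
theorem injective_of_mono (f : M ⟶ N) [Mono f] (i : ℤ) : Function.Injective (f.app i) := by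
  rw [injective_iff_map_eq_zero]
  intro x hx
  have : subι _ _ (isGrSubmodule_ker f) = 0 := by
    rw [← cancel_mono f, subι_ker_comp, Limits.zero_comp]
  exact congr_app this i ⟨x, hx⟩

theorem surjective_of_epi (f : M ⟶ N) [Epi f] (i : ℤ) : Function.Surjective (f.app i) := by
  intro x
  have : quotπ _ _ (isGrSubmodule_range f) = 0 := by
    rw [← cancel_epi f, comp_quotπ_range, Limits.comp_zero]
  exact (quotπ_eq_zero_iff _ _ (isGrSubmodule_range f) x).1
    (congr_app this i x)

instance : IsNormalMonoCategory (GrMod 𝒜) where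
  normalMonoOfMono f _ :=
    ⟨{  Z := _
        g := quotπ _ _ (isGrSubmodule_range f)
        w := comp_quotπ_range f
        isLimit := isLimitKernelFork _ _ _ (injective_of_mono f)
          fun _ _ hx => (quotπ_eq_zero_iff _ _ _ _).1 hx }⟩

instance : IsNormalEpiCategory (GrMod 𝒜) where
  normalEpiOfEpi f _ :=
    ⟨{  W := _
        g := subι _ _ (isGrSubmodule_ker f)
        w := subι_ker_comp f
        isColimit := isColimitCokernelCofork _ _ _ (surjective_of_epi f)
          fun _ x hx => ⟨⟨x, hx⟩, rfl⟩ }⟩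

/-- The product of two graded modules. -/
def prod (M N : GrMod 𝒜) : GrMod 𝒜 where
  carrier i := M.carrier i × N.carrier i
  act h x a := (M.act h x.1 a, N.act h x.2 a)
  add_act h x y a := Prod.ext (M.add_act h x.1 y.1 a) (N.add_act h x.2 y.2 a)
  act_add h x a b := Prod.ext (M.act_add h x.1 a b) (N.act_add h x.2 a b)
  act_one x := Prod.ext (M.act_one x.1) (N.act_one x.2)
  act_act h₁ h₂ h₃ h₄ x a b :=
    Prod.ext (M.act_act h₁ h₂ h₃ h₄ x.1 a b) (N.act_act h₁ h₂ h₃ h₄ x.2 a b)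

/-- The product of two graded modules as a biproduct. -/
def prodBicone (M N : GrMod 𝒜) : Limits.BinaryBicone M N where
  pt := prod M N
  fst := ⟨fun _ => AddMonoidHom.fst _ _, fun _ _ _ => rfl⟩
  snd := ⟨fun _ => AddMonoidHom.snd _ _, fun _ _ _ => rfl⟩
  inl := ⟨fun _ => AddMonoidHom.inl _ _, fun h _ a => Prod.ext rfl (zero_act N h a).symm⟩
  inr := ⟨fun _ => AddMonoidHom.inr _ _, fun h _ a => Prod.ext (zero_act M h a).symm rfl⟩
  inl_fst := rfl
  inl_snd := rfl
  inr_fst := rfl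
  inr_snd := rfl

instance : Limits.HasBinaryBiproducts (GrMod 𝒜) where
  has_binary_biproduct M N := Limits.HasBinaryBiproduct.mk
    ⟨prodBicone M N, Limits.isBinaryBilimitOfTotal _ <| by
      ext i x
      exact Prod.ext (add_zero x.1) (zero_add x.2)⟩

theorem isZero_iff (M : GrMod 𝒜) : Limits.IsZero M ↔ ∀ i (x : M.carrier i), x = 0 := by
  rw [Limits.IsZero.iff_id_eq_zero]
  exact ⟨fun h i x => congr_app h i x, fun h => by ext i x; exact h i x⟩

variable (𝒜) in
/-- The zero graded module. -/
def zero : GrMod 𝒜 where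
  carrier _ := PUnit
  act _ _ _ := 0
  add_act _ _ _ _ := rfl
  act_add _ _ _ _ := rfl
  act_one _ := rfl
  act_act _ _ _ _ _ _ _ := rfl

instance : Limits.HasZeroObject (GrMod 𝒜) :=
  ⟨⟨zero 𝒜, (isZero_iff _).2 fun _ _ => rfl⟩⟩

instance : Limits.HasFiniteProducts (GrMod 𝒜) :=
  hasFiniteProducts_of_has_binary_and_terminal

instance : Abelian (GrMod 𝒜) where

theorem isIso_iff_bijective (f : M ⟶ N) : IsIso f ↔ ∀ i, Function.Bijective (f.app i) := by
  refine ⟨fun _ i => ⟨injective_of_mono f i, surjective_of_epi f i⟩, fun h => ?_⟩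
  have := mono_of_injective f fun i => (h i).1
  have := epi_of_surjective f fun i => (h i).2
  exact isIso_of_mono_of_epi f

end GrMod

/-! ### Graded factors of path algebras -/

namespace PathAlgebra

variable {V : Type v₁} [Quiver.{v₂} V]

/-- The basis element of the path algebra given by a path. -/
def ofPath {a b : V} (p : Quiver.Path a b) : PathAlgebra K V :=
  open Classical in
  ⟨Pi.single a (Pi.single b (Finsupp.single p 1))⟩

theorem coeff_ofPath_self {a b : V} (p : Quiver.Path a b) :
    (ofPath p : PathAlgebra K V).coeff a b = Finsupp.single p 1 := by
  simp [ofPath]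

theorem coeff_ofPath_of_ne {a b c d : V} (p : Quiver.Path a b) (h : ¬ (c = a ∧ d = b)) :
    (ofPath p : PathAlgebra K V).coeff c d = 0 := by
  by_cases hc : c = a
  · subst hc
    have hd : d ≠ b := fun hd => h ⟨rfl, hd⟩
    simp [ofPath, hd]
  · simp [ofPath, hc]

variable [Fintype V]

theorem ofPath_mem {a b : V} (p : Quiver.Path a b) :
    (ofPath p : PathAlgebra K V) ∈ degreePart K V p.length := by
  intro c d q hq
  by_cases h : c = a ∧ d = b
  · obtain ⟨rfl, rfl⟩ := h
    rw [coeff_ofPath_self, Finsupp.single_apply_ne_zero] at hq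
    rw [hq.1]
  · rw [coeff_ofPath_of_ne p h] at hq
    exact absurd rfl hq

/-- The coefficient of a path. -/
def coeffₗ {a b : V} (p : Quiver.Path a b) : PathAlgebra K V →ₗ[K] K where
  toFun f := f.coeff a b p
  map_add' _ _ := by simp
  map_smul' _ _ := by simp

@[simp] theorem coeffₗ_apply {a b : V} (p : Quiver.Path a b) (f : PathAlgebra K V) :
    coeffₗ p f = f.coeff a b p := rfl

/-- The homogeneous part of degree `k` of an element. -/
def truncate (k : ℕ) (f : PathAlgebra K V) : PathAlgebra K V :=
  ⟨fun a b => (f.coeff a b).filter fun p => p.length = k⟩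

theorem truncate_mem (k : ℕ) (f : PathAlgebra K V) : truncate k f ∈ degreePart K V k := by
  intro a b p hp
  by_contra h
  exact hp (Finsupp.filter_apply_neg (fun p : Quiver.Path a b => p.length = k) _ h)

open Classical in
theorem eq_sum_ofPath (f : PathAlgebra K V) :
    f = ∑ a, ∑ b, (f.coeff a b).sum fun p c => c • (ofPath p : PathAlgebra K V) := by
  ext1
  funext a b
  ext p
  change coeffₗ p f = coeffₗ p _
  simp only [map_sum, Finsupp.sum, map_smul]
  rw [Finset.sum_eq_single a, Finset.sum_eq_single b]
  · simp [coeff_ofPath_self, Finsupp.single_apply]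
  · intro d _ hd
    refine Finset.sum_eq_zero fun q _ => ?_
    simp [coeff_ofPath_of_ne q (c := a) (d := b) fun h => hd h.2.symm]
  · simp
  · intro c _ hc
    refine Finset.sum_eq_zero fun d _ => Finset.sum_eq_zero fun q _ => ?_
    simp [coeff_ofPath_of_ne q (c := a) (d := b) fun h => hc h.1.symm]
  · simp

theorem eq_sum_truncate (f : PathAlgebra K V) :
    ∃ s : Finset ℕ, f = ∑ k ∈ s, truncate k f := by
  classical
  refine ⟨Finset.univ.biUnion fun a => Finset.univ.biUnion fun b =>
    (f.coeff a b).support.image Quiver.Path.length, ?_⟩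
  ext1
  funext a b
  ext p
  change coeffₗ p f = coeffₗ p _
  rw [map_sum]
  have h : ∀ k, coeffₗ p (truncate k f) = if p.length = k then f.coeff a b p else 0 := fun k => by
    simp [truncate, Finsupp.filter_apply]
  simp only [h, Finset.sum_ite_eq]
  split_ifs with h'
  · rfl
  · by_contra hp
    refine h' ?_
    simp only [Finset.mem_biUnion, Finset.mem_univ, true_and, Finset.mem_image]
    exact ⟨a, b, p, by simpa using hp, rfl⟩

theorem mem_span_ofPath {k : ℕ} {f : PathAlgebra K V} (hf : f ∈ degreePart K V k) :
    f ∈ Submodule.span K {g | ∃ (a b : V) (p : Quiver.Path a b), p.length = k ∧ g = ofPath p} := by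
  rw [eq_sum_ofPath f]
  refine sum_mem fun a _ => sum_mem fun b _ => sum_mem fun p hp => ?_
  exact Submodule.smul_mem _ _ (Submodule.subset_span
    ⟨a, b, p, hf a b p (Finsupp.mem_support_iff.1 hp), rfl⟩)

theorem ofPath_mul_ofPath {a b c : V} (p : Quiver.Path a b) (q : Quiver.Path b c) :
    (ofPath p * ofPath q : PathAlgebra K V) = ofPath (p.comp q) := by
  ext1
  funext x y
  rw [coeff_mul]
  by_cases hx : x = a
  · subst hx
    by_cases hy : y = c
    · subst hy
      rw [Finset.sum_eq_single b, coeff_ofPath_self, coeff_ofPath_self, coeff_ofPath_self,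
        concat_single, one_mul]
      · intro z _ hz
        rw [coeff_ofPath_of_ne p fun h => hz h.2, map_zero, LinearMap.zero_apply]
      · simp
    · rw [coeff_ofPath_of_ne _ fun h => hy h.2]
      refine Finset.sum_eq_zero fun z _ => ?_
      rw [coeff_ofPath_of_ne q fun h => hy h.2, map_zero]
  · rw [coeff_ofPath_of_ne _ fun h => hx h.1]
    refine Finset.sum_eq_zero fun z _ => ?_
    rw [coeff_ofPath_of_ne p fun h => hx h.1, map_zero, LinearMap.zero_apply]

theorem ofPath_mul_ofPath_of_ne {a b c d : V} (p : Quiver.Path a b) (q : Quiver.Path c d)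
    (h : b ≠ c) : (ofPath p * ofPath q : PathAlgebra K V) = 0 := by
  ext1
  funext x y
  rw [coeff_mul]
  refine Finset.sum_eq_zero fun z _ => ?_
  by_cases hz : z = b
  · rw [coeff_ofPath_of_ne q fun h' => h (hz.symm.trans h'.1), map_zero]
  · rw [coeff_ofPath_of_ne p fun h' => hz h'.2, map_zero, LinearMap.zero_apply]

theorem sum_ofPath_nil : ∑ a : V, (ofPath (Quiver.Path.nil : Quiver.Path a a)) =
    (1 : PathAlgebra K V) := by
  ext1
  funext x y
  ext p
  change coeffₗ p _ = _
  rw [map_sum, Finset.sum_eq_single x]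
  · by_cases h : x = y
    · subst h
      simp [coeff_ofPath_self, coeff_one_self]
    · simp [coeff_one_of_ne h, coeff_ofPath_of_ne (Quiver.Path.nil : Quiver.Path x x)
        (c := x) (d := y) fun h' => h h'.2.symm]
  · intro z _ hz
    simp [coeff_ofPath_of_ne (Quiver.Path.nil : Quiver.Path z z)
        (c := x) (d := y) fun h' => hz h'.1.symm]
  · simp

end PathAlgebra

namespace IsGradedFactor

variable {V : Type v₁} [Quiver.{v₂} V] [Fintype V] {π : PathAlgebra K V →ₐ[K] Λ}

open PathAlgebra

/-- Split a preimage of x by path length; projecting to degree k keeps only the length k part. -/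
theorem eq_sum_of_mem (hπ : IsGradedFactor 𝒜 π) {k : ℤ} {x : Λ} (hx : x ∈ 𝒜 k) :
    ∃ (s : Finset ℕ) (f : PathAlgebra K V),
      x = ∑ l ∈ s, if (l : ℤ) = k then π (truncate l f) else 0 := by
  obtain ⟨f, rfl⟩ := hπ.surjective x
  obtain ⟨s, hs⟩ := eq_sum_truncate f
  refine ⟨s, f, ?_⟩
  -- Rewriting by `hs` also expands f inside the truncations on the right; the final `← hs` folds it
  -- back there.
  rw [← DirectSum.decompose_of_mem_same 𝒜 hx, hs, map_sum, DirectSum.decompose_sum,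
    DFinsupp.finsetSum_apply, AddSubmonoidClass.coe_finsetSum, ← hs]
  refine Finset.sum_congr rfl fun l _ => ?_
  have hl := hπ.map_mem l _ (truncate_mem l f)
  split_ifs with h
  · subst h
    exact DirectSum.decompose_of_mem_same 𝒜 hl
  · exact DirectSum.decompose_of_mem_ne 𝒜 hl h

theorem eq_zero_of_neg (hπ : IsGradedFactor 𝒜 π) {k : ℤ} (hk : k < 0) (x : 𝒜 k) : x = 0 := by
  obtain ⟨s, f, hf⟩ := hπ.eq_sum_of_mem x.2
  ext
  rw [hf]
  exact Finset.sum_eq_zero fun l _ => if_neg (by omega)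

theorem exists_of_mem (hπ : IsGradedFactor 𝒜 π) {k : ℕ} {x : Λ} (hx : x ∈ 𝒜 k) :
    ∃ f ∈ degreePart K V k, π f = x := by
  obtain ⟨s, f, hf⟩ := hπ.eq_sum_of_mem hx
  refine ⟨∑ l ∈ s, if (l : ℤ) = k then truncate l f else 0, ?_, ?_⟩
  · refine sum_mem fun l _ => ?_
    split_ifs with h
    · rw [Nat.cast_inj] at h
      exact h ▸ truncate_mem l f
    · exact zero_mem _
  · rw [hf, map_sum]
    refine Finset.sum_congr rfl fun l _ => ?_
    split_ifs <;> simp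

/-- The element of `Λ` given by a path. -/
def path (hπ : IsGradedFactor 𝒜 π) {a b : V} (p : Quiver.Path a b) {k : ℤ}
    (h : (p.length : ℤ) = k) : 𝒜 k :=
  ⟨π (ofPath p), h ▸ hπ.map_mem _ _ (ofPath_mem p)⟩

/-- The idempotent of a vertex. -/
def vertex (hπ : IsGradedFactor 𝒜 π) (a : V) : 𝒜 0 :=
  hπ.path (Quiver.Path.nil : Quiver.Path a a) (by simp)

@[elab_as_elim]
-- Homogeneous elements of degree k are linear combinations of images of paths of length k, so
-- additive and K-linear identities need only be checked on paths.
theorem path_induction (hπ : IsGradedFactor 𝒜 π) {k : ℤ} {motive : 𝒜 k → Prop} (x : 𝒜 k)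
    (path : ∀ (a b : V) (p : Quiver.Path a b) (h : (p.length : ℤ) = k), motive (hπ.path p h))
    (zero : motive 0) (add : ∀ x y, motive x → motive y → motive (x + y))
    (smul : ∀ (c : K) x, motive x → motive (c • x)) : motive x := by
  rcases lt_or_ge k 0 with hk | hk
  · rwa [hπ.eq_zero_of_neg hk x]
  lift k to ℕ using hk
  obtain ⟨x, hx⟩ := x
  obtain ⟨f, hf, rfl⟩ := hπ.exists_of_mem hx
  have h := mem_span_ofPath hf
  have hx' : ∀ g ∈ degreePart K V k, π g ∈ 𝒜 k := hπ.map_mem k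
  have hle : Submodule.span K {g : PathAlgebra K V | ∃ (a b : V) (p : Quiver.Path a b),
      p.length = k ∧ g = ofPath p} ≤ degreePart K V k := by
    rw [Submodule.span_le]
    rintro _ ⟨a, b, p, rfl, rfl⟩
    exact ofPath_mem p
  suffices ∀ hx, motive ⟨π f, hx⟩ from this _
  clear hx hf
  induction h using Submodule.span_induction with
  | mem g hg =>
    obtain ⟨a, b, p, hp, rfl⟩ := hg
    exact fun _ => path a b p (by rw [hp])
  | zero =>
    intro hx
    convert zero
    simp
  | add g g' hg hg' h h' =>
    intro hx
    convert add _ _ (h (hx' _ (hle hg))) (h' (hx' _ (hle hg')))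
    simp
  | smul c g hg h =>
    intro hx
    convert smul c _ (h (hx' _ (hle hg)))
    simp

theorem sum_vertex (hπ : IsGradedFactor 𝒜 π) : ∑ a, hπ.vertex a = 1 := by
  ext
  rw [AddSubmonoidClass.coe_finsetSum]
  change ∑ a, π (ofPath (Quiver.Path.nil : Quiver.Path a a)) = 1
  rw [← map_sum, sum_ofPath_nil, map_one]

omit [GradedAlgebra 𝒜] in
theorem path_mul_path (hπ : IsGradedFactor 𝒜 π) {a b c : V} (p : Quiver.Path a b)
    (q : Quiver.Path b c) {k l m : ℤ} (hp : (p.length : ℤ) = k) (hq : (q.length : ℤ) = l)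
    (h : ((p.comp q).length : ℤ) = m) :
    (hπ.path p hp * hπ.path q hq : Λ) = hπ.path (p.comp q) h := by
  change π _ * π _ = π _
  rw [← map_mul, ofPath_mul_ofPath]

omit [GradedAlgebra 𝒜] in
theorem path_mul_path_of_ne (hπ : IsGradedFactor 𝒜 π) {a b c d : V} (p : Quiver.Path a b)
    (q : Quiver.Path c d) {k l : ℤ} (hp : (p.length : ℤ) = k) (hq : (q.length : ℤ) = l)
    (h : b ≠ c) : (hπ.path p hp * hπ.path q hq : Λ) = 0 := by
  change π _ * π _ = 0
  rw [← map_mul, ofPath_mul_ofPath_of_ne p q h, map_zero]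

theorem vertex_mul_vertex (hπ : IsGradedFactor 𝒜 π) (a : V) :
    hπ.vertex a * hπ.vertex a = hπ.vertex a :=
  Subtype.ext (hπ.path_mul_path _ _ _ _ (by simp))

theorem vertex_mul_vertex_of_ne (hπ : IsGradedFactor 𝒜 π) {a b : V} (h : a ≠ b) :
    hπ.vertex a * hπ.vertex b = 0 :=
  Subtype.ext (hπ.path_mul_path_of_ne _ _ _ _ h)

theorem smul_mul_smul_zero (c d : K) (x y : 𝒜 0) : c • x * d • y = (c * d) • (x * y) := by
  ext
  simp [mul_smul, smul_comm c d]

/-- The homomorphism `K^V → Λ₀`. -/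
def vertexHom (hπ : IsGradedFactor 𝒜 π) : (V → K) →+* 𝒜 0 where
  toFun c := ∑ a, c a • hπ.vertex a
  map_zero' := by simp
  map_add' c d := by simp [add_smul, Finset.sum_add_distrib]
  map_one' := by simp [sum_vertex]
  map_mul' c d := by
    rw [Finset.sum_mul_sum]
    refine Finset.sum_congr rfl fun a _ => ?_
    rw [Finset.sum_eq_single a]
    · rw [smul_mul_smul_zero, vertex_mul_vertex, Pi.mul_apply]
    · intro b _ hb
      rw [smul_mul_smul_zero, vertex_mul_vertex_of_ne hπ hb.symm, smul_zero]
    · simp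

theorem vertexHom_surjective (hπ : IsGradedFactor 𝒜 π) : Function.Surjective hπ.vertexHom := by
  classical
  intro x
  refine hπ.path_induction x ?_ ⟨0, map_zero _⟩ ?_ ?_
  · intro a b p hp
    obtain rfl : a = b := p.eq_of_length_zero (by exact_mod_cast hp)
    obtain rfl : p = Quiver.Path.nil := p.eq_nil_of_length_zero (by exact_mod_cast hp)
    refine ⟨Pi.single a 1, ?_⟩
    change ∑ b, Pi.single (M := fun _ => K) a 1 b • hπ.vertex b = _
    rw [Finset.sum_eq_single a]
    · rw [Pi.single_eq_same, one_smul]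
      rfl
    · intro b _ hb
      rw [Pi.single_eq_of_ne hb, zero_smul]
    · simp
  · rintro _ _ ⟨c, rfl⟩ ⟨d, rfl⟩
    exact ⟨c + d, map_add _ _ _⟩
  · rintro r _ ⟨c, rfl⟩
    refine ⟨r • c, ?_⟩
    change ∑ b, _ = r • ∑ b, _
    simp [Finset.smul_sum, mul_smul]

/-- Λ₀ is a quotient of K^V. The consequence used below is that all right Λ₀-modules are projective,
so Λ₀-linear maps lift along surjections. -/
theorem isSemisimpleRing (hπ : IsGradedFactor 𝒜 π) : IsSemisimpleRing (𝒜 0)ᵐᵒᵖ :=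
  have := RingHom.isSemisimpleRing_of_surjective _ hπ.vertexHom_surjective
  inferInstance

end IsGradedFactor

/-! ### Cofree modules -/

namespace GrMod

variable (𝒜) in
/-- The regular graded module. -/
def regular : GrMod 𝒜 where
  carrier i := 𝒜 i
  act h x a := ⟨x.1 * a.1, h ▸ SetLike.GradedMul.mul_mem x.2 a.2⟩
  add_act _ x y a := Subtype.ext (add_mul x.1 y.1 a.1)
  act_add _ x a b := Subtype.ext (mul_add x.1 a.1 b.1)
  act_one x := Subtype.ext (mul_one x.1)
  act_act _ _ _ _ x a b := Subtype.ext (mul_assoc x.1 a.1 b.1)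

instance (M : GrMod 𝒜) (i : ℤ) : Module (𝒜 0)ᵐᵒᵖ (M.carrier i) where
  smul r x := M.act (add_zero i) x r.unop
  one_smul x := M.act_one x
  mul_smul r s x := (M.act_act (add_zero i) (add_zero i) (add_zero 0) (add_zero i) x s.unop
    r.unop).symm
  smul_zero r := zero_act M (add_zero i) r.unop
  smul_add r x y := M.add_act (add_zero i) x y r.unop
  add_smul r s x := M.act_add (add_zero i) x r.unop s.unop
  zero_smul x := by
    have h := M.act_add (add_zero i) x 0 0
    rw [add_zero] at h
    exact left_eq_add.1 h

/-- Multiplication of a fixed element by elements of `Λ`, as an additive map. -/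
def actRight (M : GrMod 𝒜) {i j k : ℤ} (h : i + j = k) (x : M.carrier i) : 𝒜 j →+ M.carrier k :=
  AddMonoidHom.mk' (fun a => M.act h x a) fun a b => M.act_add h x a b

@[simp] theorem act_zero (M : GrMod 𝒜) {i j k : ℤ} (h : i + j = k) (x : M.carrier i) :
    M.act h x 0 = 0 := (M.actRight h x).map_zero

theorem act_smul_op (M : GrMod 𝒜) {i j k : ℤ} (h : i + j = k) (x : M.carrier i) (a : 𝒜 j)
    (e : 𝒜 0) : M.act h x (show 𝒜 j from MulOpposite.op e • (show (regular 𝒜).carrier j from a)) =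
      MulOpposite.op e • M.act h x a :=
  (M.act_act h (add_zero k) (add_zero j) h x a e).symm

theorem smul_op_act (M : GrMod 𝒜) {i j k : ℤ} (h : i + j = k) (x : M.carrier i) (a : 𝒜 j)
    (e : 𝒜 0) : M.act h (MulOpposite.op e • x) a =
      M.act h x ⟨e * a, by simpa using SetLike.GradedMul.mul_mem e.2 a.2⟩ :=
  M.act_act (add_zero i) h (zero_add j) h x e a

/-- Multiplication of a fixed element by elements of `Λ`, as a `Λ₀`-linear map. -/
def actLinear (M : GrMod 𝒜) {i j k : ℤ} (h : i + j = k) (x : M.carrier i) :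
    (regular 𝒜).carrier j →ₗ[(𝒜 0)ᵐᵒᵖ] M.carrier k where
  toFun a := M.act h x a
  map_add' a b := M.act_add h x a b
  map_smul' e a := M.act_smul_op h x a e.unop

/-- The action of a scalar. -/
theorem act_smul (M : GrMod 𝒜) {i j k : ℤ} (h : i + j = k) (x : M.carrier i) (c : K) (a : 𝒜 j) :
    M.act h x (c • a) = MulOpposite.op (algebraMap K (𝒜 0) c) • M.act h x a := by
  rw [← act_smul_op]
  congr 1
  ext
  change c • a.1 = a.1 * algebraMap K Λ c
  rw [← Algebra.commutes, Algebra.smul_def]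

/-- The components of a morphism are `Λ₀`-linear. -/
def Hom.appLinear {M N : GrMod 𝒜} (f : M ⟶ N) (i : ℤ) :
    M.carrier i →ₗ[(𝒜 0)ᵐᵒᵖ] N.carrier i where
  toFun := f.app i
  map_add' := map_add _
  map_smul' e x := f.app_act (add_zero i) x e.unop

theorem Hom.app_smul {M N : GrMod 𝒜} (f : M ⟶ N) (i : ℤ) (e : (𝒜 0)ᵐᵒᵖ) (x : M.carrier i) :
    f.app i (e • x) = e • f.app i x := f.app_act (add_zero i) x e.unop

/-- `M` is cofree on its component of degree `d`: the component of degree `i` is identified with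
the `Λ₀`-linear maps from the component of `Λ` of degree `d - i` to that of `M` of degree `d`. -/
structure IsCofree (M : GrMod 𝒜) (d : ℤ) : Prop where
  eq_zero : ∀ {i k : ℤ} (h : i + k = d) (x : M.carrier i), (∀ a, M.act h x a = 0) → x = 0
  exists_act : ∀ {i k : ℤ} (h : i + k = d)
    (f : (regular 𝒜).carrier k →ₗ[(𝒜 0)ᵐᵒᵖ] M.carrier d), ∃ x, ∀ a : 𝒜 k, M.act h x a = f a

namespace IsCofree

variable {M N : GrMod 𝒜} {d : ℤ}

theorem ext (hM : M.IsCofree d) {i k : ℤ} (h : i + k = d) {x y : M.carrier i}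
    (hxy : ∀ a, M.act h x a = M.act h y a) : x = y := by
  rw [← sub_eq_zero]
  refine hM.eq_zero h _ fun a => ?_
  rw [sub_act, hxy, sub_self]

/-- An element of a cofree module is determined by its multiples in degree d. -/
theorem hom_ext (hN : N.IsCofree d) {f g : M ⟶ N} (h : ∀ x, f.app d x = g.app d x) : f = g := by
  ext i x
  refine hN.ext (add_sub_cancel i d) fun a => ?_
  rw [← f.app_act, ← g.app_act, h]

/-- For x in M_i the map a ↦ φ(xa) is Λ₀-linear on Λ_{d-i}, so cofreeness represents it by an
element of N_i. This element is unique, which gives additivity and compatibility with the action. -/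
theorem exists_lift (hN : N.IsCofree d) (φ : M.carrier d →ₗ[(𝒜 0)ᵐᵒᵖ] N.carrier d) :
    ∃ f : M ⟶ N, ∀ x, f.app d x = φ x := by
  choose g hg using fun (i : ℤ) (x : M.carrier i) =>
    hN.exists_act (add_sub_cancel i d) (φ ∘ₗ M.actLinear (add_sub_cancel i d) x)
  have hg' : ∀ {i k : ℤ} (h : i + k = d) (x : M.carrier i) (a : 𝒜 k),
      N.act h (g i x) a = φ (M.act h x a) := by
    intro i k h x a
    obtain rfl : k = d - i := by omega
    exact hg i x a
  refine ⟨⟨fun i => AddMonoidHom.mk' (g i) fun x y => ?_, fun {i j k} h x a => ?_⟩, fun x => ?_⟩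
  · refine hN.ext (add_sub_cancel i d) fun a => ?_
    rw [add_act, hg', hg', hg', add_act, map_add]
  · refine hN.ext (add_sub_cancel k d) fun b => ?_
    change N.act _ (g k (M.act h x a)) b = N.act _ (N.act h (g i x) a) b
    rw [hg', N.act_act h _ (show j + (d - k) = d - i by omega) (by omega),
      M.act_act h _ (show j + (d - k) = d - i by omega) (by omega), hg']
  · change g d x = φ x
    refine hN.ext (add_zero d) fun a => ?_
    rw [hg']
    exact φ.map_smul (MulOpposite.op a) x

theorem of_bijective (hM : M.IsCofree d) (f : M ⟶ N) (hf : ∀ i, Function.Bijective (f.app i)) :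
    N.IsCofree d where
  eq_zero {i k} h y hy := by
    obtain ⟨x, rfl⟩ := (hf i).2 y
    rw [hM.eq_zero h x fun a => (hf d).1 (by rw [f.app_act, hy, map_zero]), map_zero]
  exists_act {i k} h g := by
    let e := LinearEquiv.ofBijective (Hom.appLinear f d) (hf d)
    obtain ⟨x, hx⟩ := hM.exists_act h (e.symm.toLinearMap ∘ₗ g)
    refine ⟨f.app i x, fun a => ?_⟩
    rw [← f.app_act, hx]
    exact e.apply_symm_apply _

theorem of_iso (hM : M.IsCofree d) (e : M ≅ N) : N.IsCofree d :=
  hM.of_bijective e.hom ((isIso_iff_bijective e.hom).1 inferInstance)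

theorem of_isZero (hM : Limits.IsZero M) : M.IsCofree d where
  eq_zero _ x _ := (isZero_iff M).1 hM _ x
  exists_act _ _ := ⟨0, fun _ => ((isZero_iff M).1 hM _ _).trans ((isZero_iff M).1 hM _ _).symm⟩

theorem prod (hM : M.IsCofree d) (hN : N.IsCofree d) : (prod M N).IsCofree d where
  eq_zero h x hx := Prod.ext (hM.eq_zero h x.1 fun a => congrArg Prod.fst (hx a))
    (hN.eq_zero h x.2 fun a => congrArg Prod.snd (hx a))
  exists_act {i k} h f := by
    obtain ⟨x, hx⟩ := hM.exists_act h
      (Hom.appLinear (prodBicone M N).fst d ∘ₗ f)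
    obtain ⟨y, hy⟩ := hN.exists_act h
      (Hom.appLinear (prodBicone M N).snd d ∘ₗ f)
    exact ⟨(x, y), fun a => Prod.ext (hx a) (hy a)⟩

/-- The largest graded submodule of `M` whose component of degree `d` is contained in `U`. -/
def _root_.GrMod.cogen (M : GrMod 𝒜) {d : ℤ} (U : Submodule (𝒜 0)ᵐᵒᵖ (M.carrier d)) (i : ℤ) :
    AddSubgroup (M.carrier i) where
  carrier := {x | ∀ (k : ℤ) (h : i + k = d) (a : 𝒜 k), M.act h x a ∈ U}
  zero_mem' k h a := by simp
  add_mem' hx hy k h a := by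
    rw [add_act]
    exact add_mem (hx k h a) (hy k h a)
  neg_mem' hx k h a := by
    rw [neg_act]
    exact neg_mem (hx k h a)

theorem _root_.GrMod.mem_cogen {M : GrMod 𝒜} {d : ℤ} {U : Submodule (𝒜 0)ᵐᵒᵖ (M.carrier d)}
    {i k : ℤ} (h : i + k = d) {x : M.carrier i} :
    x ∈ M.cogen U i ↔ ∀ a : 𝒜 k, M.act h x a ∈ U := by
  refine ⟨fun hx => hx k h, fun hx l hl => ?_⟩
  obtain rfl : k = l := by omega
  exact hx

theorem _root_.GrMod.mem_cogen_self {M : GrMod 𝒜} {d : ℤ} {U : Submodule (𝒜 0)ᵐᵒᵖ (M.carrier d)}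
    {x : M.carrier d} : x ∈ M.cogen U d ↔ x ∈ U := by
  rw [mem_cogen (add_zero d)]
  exact ⟨fun h => M.act_one x ▸ h 1, fun h a => U.smul_mem (MulOpposite.op a) h⟩

theorem _root_.GrMod.isGrSubmodule_cogen (M : GrMod 𝒜) {d : ℤ}
    (U : Submodule (𝒜 0)ᵐᵒᵖ (M.carrier d)) : M.IsGrSubmodule (M.cogen U) := by
  intro i j k h x a hx l hl b
  rw [M.act_act h hl rfl (by omega)]
  exact hx _ _ _

theorem sub_cogen (hM : M.IsCofree d) (U : Submodule (𝒜 0)ᵐᵒᵖ (M.carrier d)) :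
    (M.sub _ (M.isGrSubmodule_cogen U)).IsCofree d where
  eq_zero h x hx := Subtype.ext (hM.eq_zero h x.1 fun a => congrArg Subtype.val (hx a))
  exists_act {i k} h f := by
    obtain ⟨x, hx⟩ := hM.exists_act h (Hom.appLinear (subι _ _ (M.isGrSubmodule_cogen U)) d ∘ₗ f)
    refine ⟨⟨x, ?_⟩, fun a => Subtype.ext (hx a)⟩
    rw [mem_cogen h]
    intro a
    rw [hx]
    exact mem_cogen_self.1 (f a).2

/-- Since Λ_k is projective over Λ₀, a functional with values in N_d lifts to M_d, where it is
represented. The hypothesis `hf'` says that N inherits detection of elements in degree d. -/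
theorem quot_of_surjective (hM : M.IsCofree d) [IsSemisimpleRing (𝒜 0)ᵐᵒᵖ] (f : M ⟶ N)
    (hf : ∀ i, Function.Surjective (f.app i))
    (hf' : ∀ {i k : ℤ} (h : i + k = d) (x : M.carrier i), (∀ a : 𝒜 k, f.app d (M.act h x a) = 0) →
      f.app i x = 0) : N.IsCofree d where
  eq_zero {i k} h y hy := by
    obtain ⟨x, rfl⟩ := hf i y
    exact hf' h x fun a => by rw [f.app_act, hy]
  exists_act {i k} h g := by
    have := Module.projective_of_isSemisimpleRing (𝒜 0)ᵐᵒᵖ ((regular 𝒜).carrier k)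
    obtain ⟨g', hg'⟩ := Module.projective_lifting_property (Hom.appLinear f d) g (hf d)
    obtain ⟨x, hx⟩ := hM.exists_act h g'
    refine ⟨f.app i x, fun a => ?_⟩
    rw [← f.app_act, hx]
    exact LinearMap.congr_fun hg' a

/-- An element of M representing a functional with values in the kernel is itself in the kernel: all
multiples of its image in degree d vanish. -/
theorem ker (hM : M.IsCofree d) (hN : N.IsCofree d) (f : M ⟶ N) :
    (M.sub _ (isGrSubmodule_ker f)).IsCofree d where
  eq_zero h x hx := Subtype.ext (hM.eq_zero h x.1 fun a => congrArg Subtype.val (hx a))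
  exists_act {i k} h g := by
    obtain ⟨x, hx⟩ := hM.exists_act h (Hom.appLinear (subι _ _ (isGrSubmodule_ker f)) d ∘ₗ g)
    refine ⟨⟨x, AddMonoidHom.mem_ker.2 (hN.eq_zero h _ fun a => ?_)⟩, fun a => Subtype.ext (hx a)⟩
    rw [← f.app_act, hx]
    exact AddMonoidHom.mem_ker.1 (g a).2

/-- An element of `N` whose multiples in degree `d` lift to `M` lifts to `M`. -/
theorem exists_app_eq (hM : M.IsCofree d) (hN : N.IsCofree d) [IsSemisimpleRing (𝒜 0)ᵐᵒᵖ]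
    (f : M ⟶ N) {i k : ℤ} (h : i + k = d) (y : N.carrier i)
    (hy : ∀ a : 𝒜 k, ∃ x, f.app d x = N.act h y a) : ∃ x, f.app i x = y := by
  let F := Hom.appLinear f d
  have := Module.projective_of_isSemisimpleRing (𝒜 0)ᵐᵒᵖ ((regular 𝒜).carrier k)
  obtain ⟨g, hg⟩ := Module.projective_lifting_property F.rangeRestrict
    ((N.actLinear h y).codRestrict (LinearMap.range F) fun a => hy a) F.surjective_rangeRestrict
  obtain ⟨x, hx⟩ := hM.exists_act h g
  refine ⟨x, hN.ext h fun a => ?_⟩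
  rw [← f.app_act, hx]
  exact congrArg Subtype.val (LinearMap.congr_fun hg a)

/-- The image of f is saturated: it contains every y whose multiples in degree d all lie in it. This
is what makes the quotient detect elements in degree d. -/
theorem coker (hM : M.IsCofree d) (hN : N.IsCofree d) [IsSemisimpleRing (𝒜 0)ᵐᵒᵖ] (f : M ⟶ N) :
    (N.quot _ (isGrSubmodule_range f)).IsCofree d := by
  refine hN.quot_of_surjective (quotπ _ _ (isGrSubmodule_range f)) (quotπ_surjective _ _ _) ?_
  intro i k h y hy
  refine (quotπ_eq_zero_iff _ _ _ _).2 (hM.exists_app_eq hN f h y fun a => ?_)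
  exact (quotπ_eq_zero_iff _ _ (isGrSubmodule_range f) _).1 (hy a)

theorem quot_cogen (hM : M.IsCofree d) [IsSemisimpleRing (𝒜 0)ᵐᵒᵖ]
    (U : Submodule (𝒜 0)ᵐᵒᵖ (M.carrier d)) : (M.quot _ (M.isGrSubmodule_cogen U)).IsCofree d := by
  refine hM.quot_of_surjective (quotπ _ _ (M.isGrSubmodule_cogen U)) (quotπ_surjective _ _ _) ?_
  intro i k h x hx
  refine (quotπ_eq_zero_iff _ _ _ _).2 ((mem_cogen h).2 fun a => ?_)
  exact mem_cogen_self.1 ((quotπ_eq_zero_iff _ _ (M.isGrSubmodule_cogen U) _).1 (hx a))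

end IsCofree

end GrMod

/-! ### Almost injective modules cogenerated in one degree are cofree -/

namespace GrMod

theorem dual_act_apply {i j k : ℤ} (h : i + j = k) (f : (dual 𝒜).carrier i) (a : 𝒜 j)
    (x : 𝒜 (-k)) (hx : (a * x : Λ) ∈ 𝒜 (-i)) :
    ((dual 𝒜).act h f a).1 x = f.1 ⟨a * x, hx⟩ := rfl

/-- The identity f(a) = (f·a)(1) both recovers f from its multiples in degree 0 and defines f when
these multiples are prescribed. -/
theorem isCofree_dual : (dual 𝒜).IsCofree 0 where
  eq_zero {i k} h f hf := by
    obtain rfl : i = -k := by omega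
    apply Subtype.ext
    ext x
    have hx : (x : Λ) ∈ 𝒜 k := by simpa using x.2
    have h1 : (1 : Λ) ∈ 𝒜 (-0) := by simpa using SetLike.GradedOne.one_mem
    have := dual_act_apply h f ⟨x, hx⟩ ⟨1, h1⟩ (by simpa using hx)
    rw [hf] at this
    have hx1 : (⟨x * 1, by simpa using hx⟩ : 𝒜 (- -k)) = x := by ext; simp
    change ((f.1 x : 𝒜 0) : Λ) = 0
    rw [← hx1]
    exact congrArg Subtype.val this.symm
  exists_act {i k} h f := by
    obtain rfl : i = -k := by omega
    have h1 : (1 : Λ) ∈ 𝒜 (-0) := by simpa using SetLike.GradedOne.one_mem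
    have hk : ∀ x : 𝒜 (- -k), (x : Λ) ∈ 𝒜 k := fun x => by simpa using x.2
    -- Λ₀-linearity of the prescribed map, used twice: for the linearity of the new functional, and
    -- to compare its multiples away from 1.
    have key : ∀ (a : 𝒜 k) (e : 𝒜 0) (hae : (a * e : Λ) ∈ 𝒜 k),
        (f ⟨a * e, hae⟩).1 ⟨1, h1⟩ = (f a).1 ⟨e, by simp⟩ := by
      intro a e hae
      have : f ⟨a * e, hae⟩ = MulOpposite.op e • f a :=
        f.map_smul (MulOpposite.op e) a
      rw [this]
      change (f a).1 _ = _
      congr 2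
      exact mul_one _
    refine ⟨⟨AddMonoidHom.mk' (fun x => (f ⟨x, hk x⟩).1 ⟨1, h1⟩) fun x y => ?_, fun x e => ?_⟩,
      fun a => ?_⟩
    · have : f ⟨(x + y : 𝒜 (- -k)), hk _⟩ = f ⟨x, hk x⟩ + f ⟨y, hk y⟩ :=
        f.map_add ⟨x, hk x⟩ ⟨y, hk y⟩
      rw [this]
      rfl
    · change (((f ⟨x * e, _⟩).1 ⟨1, h1⟩ : 𝒜 0) : Λ) = (f ⟨x, hk x⟩).1 ⟨1, h1⟩ * e
      rw [key ⟨x, hk x⟩ e, ← (f ⟨x, hk x⟩).2 ⟨1, h1⟩ e]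
      congr 3
      exact (one_mul _).symm
    · apply Subtype.ext
      ext x
      have hx : (x : Λ) ∈ 𝒜 0 := by simp
      change (((f ⟨a * x, _⟩).1 ⟨1, h1⟩ : 𝒜 0) : Λ) = (f a).1 x
      rw [key a ⟨x, hx⟩]

theorem IsCofree.shift {M : GrMod 𝒜} {d k : ℤ} (hM : M.IsCofree (d + k)) :
    (M.shift k).IsCofree d where
  eq_zero {i j} h x hx := hM.eq_zero (show i + k + j = d + k by omega) x hx
  exists_act {i j} h f := hM.exists_act (show i + k + j = d + k by omega) f

theorem isCofree_dual_shift {d k : ℤ} (h : d + k = 0) : ((dual 𝒜).shift k).IsCofree d :=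
  IsCofree.shift (h ▸ isCofree_dual)

/-- A `Λ₀`-linear map from a component of `D(Λ)` to a module, given by an element. -/
theorem exists_dual_shift_hom {M : GrMod 𝒜} {d k : ℤ} (h : d + k = 0) (hM : M.IsCofree d)
    (x : M.carrier d) : ∃ (f : (dual 𝒜).shift k ⟶ M) (y : ((dual 𝒜).shift k).carrier d),
      f.app d y = x ∧ ∀ z, ∃ e : 𝒜 0, f.app d z = MulOpposite.op e • x := by
  have h1 : ∀ t : ℤ, t = 0 → (1 : Λ) ∈ 𝒜 (-t) := by
    rintro _ rfl
    simpa using SetLike.GradedOne.one_mem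
  let φ : ((dual 𝒜).shift k).carrier d →ₗ[(𝒜 0)ᵐᵒᵖ] M.carrier d :=
    { toFun := fun g => MulOpposite.op (g.1 ⟨1, h1 _ h⟩) • x
      map_add' := fun g g' => by
        change MulOpposite.op (g.1 _ + g'.1 _) • x = _
        rw [MulOpposite.op_add, add_smul]
      map_smul' := fun e g => by
        rw [RingHom.id_apply, smul_smul]
        congr 1
        apply MulOpposite.unop_injective
        ext
        change _ = ((g.1 _ : 𝒜 0) : Λ) * (e.unop : 𝒜 0)
        rw [← g.2 ⟨1, h1 _ h⟩ e.unop]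
        change ((g.1 _ : 𝒜 0) : Λ) = _
        congr 3
        exact (mul_one _).trans (one_mul _).symm }
  obtain ⟨f, hf⟩ := hM.exists_lift φ
  have hd : ∀ t : ℤ, t = 0 → ∀ x : 𝒜 (-t), (x : Λ) ∈ 𝒜 0 := by
    rintro _ rfl x
    simp
  -- y is the identity functional Λ₀ → Λ₀; since y(1) = 1, the map g ↦ x·g(1) takes y to x.
  let y : ((dual 𝒜).shift k).carrier d :=
    ⟨AddMonoidHom.mk' (fun x => ⟨x, hd _ h x⟩) fun _ _ => rfl, fun _ _ => rfl⟩
  refine ⟨f, y, ?_, fun z => ⟨_, hf z⟩⟩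
  rw [hf]
  exact M.act_one x

/-- The projection of a direct sum to a summand. -/
def directSumProj {ι : Type u} (F : ι → GrMod 𝒜) (s : ι) : directSum F ⟶ F s where
  app _ := DFinsupp.evalAddMonoidHom s
  app_act _ _ _ := rfl

theorem directSum_ext {ι : Type u} {F : ι → GrMod 𝒜} {i : ℤ} {x y : (directSum F).carrier i}
    (h : ∀ s, (directSumProj F s).app i x = (directSumProj F s).app i y) : x = y :=
  DFinsupp.ext h

/-- The inclusion of the components of a summand. -/
def directSumOf {ι : Type u} (F : ι → GrMod 𝒜) (i : ℤ) (s : ι) :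
    (F s).carrier i →+ (directSum F).carrier i :=
  open Classical in DirectSum.of (fun s => (F s).carrier i) s

theorem proj_of_self {ι : Type u} (F : ι → GrMod 𝒜) (i : ℤ) (s : ι) (x : (F s).carrier i) :
    (directSumProj F s).app i (directSumOf F i s x) = x := by
  classical
  exact DirectSum.of_eq_same (β := fun s => (F s).carrier i) s x

theorem proj_of_ne {ι : Type u} (F : ι → GrMod 𝒜) (i : ℤ) {s t : ι} (h : s ≠ t)
    (x : (F s).carrier i) : (directSumProj F t).app i (directSumOf F i s x) = 0 := by
  classical
  exact DirectSum.of_eq_of_ne (β := fun s => (F s).carrier i) s t x h.symm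

theorem finite_support {ι : Type u} {F : ι → GrMod 𝒜} {i : ℤ} (x : (directSum F).carrier i) :
    ∃ s : Finset ι, ∀ t ∉ s, (directSumProj F t).app i x = 0 := by
  classical
  exact ⟨DFinsupp.support x, fun t ht => DFinsupp.notMem_support_iff.1 ht⟩

open Classical in
/-- The morphism from a direct sum induced by a family of morphisms. -/
def directSumDesc {ι : Type u} {F : ι → GrMod 𝒜} {M : GrMod 𝒜} (f : ∀ s, F s ⟶ M) :
    directSum F ⟶ M where
  app i := DirectSum.toAddMonoid fun s => (f s).app i
  app_act {i j k} h x a := by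
    have : (DirectSum.toAddMonoid fun s => (f s).app k).comp
        (DirectSum.map fun s => (F s).actHom h a) =
        (M.actHom h a).comp (DirectSum.toAddMonoid fun s => (f s).app i) := by
      refine DirectSum.addHom_ext fun s x => ?_
      simp [DirectSum.map_of, (f s).app_act]
    exact DFunLike.congr_fun this x

theorem directSumDesc_of {ι : Type u} {F : ι → GrMod 𝒜} {M : GrMod 𝒜} (f : ∀ s, F s ⟶ M) (i : ℤ)
    (s : ι) (x : (F s).carrier i) :
    (directSumDesc f).app i (directSumOf F i s x) = (f s).app i x := by
  classical
  exact DirectSum.toAddMonoid_of _ _ _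

end GrMod

/-! ### Cofreeness of direct sums, using finiteness of the quiver -/

namespace IsGradedFactor

variable {V : Type v₁} [Quiver.{v₂} V] [Fintype V] {π : PathAlgebra K V →ₐ[K] Λ}

theorem finite_path {V : Type v₁} [Quiver.{v₂} V] [Finite V] [∀ a b : V, Finite (a ⟶ b)] (n : ℕ)
    (a b : V) : Finite {p : Quiver.Path a b // p.length = n} := by
  induction n generalizing b with
  | zero =>
    refine @Finite.of_subsingleton _ ⟨fun p q => Subtype.ext ?_⟩
    obtain ⟨p, hp⟩ := p
    obtain ⟨q, hq⟩ := q
    obtain rfl : a = b := p.eq_of_length_zero hp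
    exact (p.eq_nil_of_length_zero hp).trans (q.eq_nil_of_length_zero hq).symm
  | succ n ih =>
    refine Finite.of_surjective (α := Σ c, {p : Quiver.Path a c // p.length = n} × (c ⟶ b))
      (fun x => ⟨x.2.1.1.cons x.2.2, by simp [x.2.1.2]⟩) ?_
    rintro ⟨_ | ⟨p, α⟩, hp⟩
    · simp at hp
    · exact ⟨⟨_, ⟨p, by simpa using hp⟩, α⟩, rfl⟩

variable [∀ a b : V, Finite (a ⟶ b)]

open GrMod

/-- Only finitely many paths have length k, each is sent to an element of finite support, and these
paths span Λ_k. -/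
theorem exists_finset (hπ : IsGradedFactor 𝒜 π) {ι : Type u} {F : ι → GrMod 𝒜} {k d : ℤ}
    (g : (regular 𝒜).carrier k →ₗ[(𝒜 0)ᵐᵒᵖ] (directSum F).carrier d) :
    ∃ s : Finset ι, ∀ t ∉ s, ∀ a : 𝒜 k, (directSumProj F t).app d (g a) = 0 := by
  classical
  rcases lt_or_ge k 0 with hk | hk
  · refine ⟨∅, fun t _ a => ?_⟩
    rw [hπ.eq_zero_of_neg hk a, show g (0 : 𝒜 k) = 0 from map_zero g, map_zero]
  lift k to ℕ using hk
  have := fun a b => finite_path (V := V) k a b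
  have := Fintype.ofFinite (Σ (a : V) (b : V), {p : Quiver.Path a b // p.length = k})
  let P : (Σ (a : V) (b : V), {p : Quiver.Path a b // p.length = k}) → 𝒜 k :=
    fun p => hπ.path p.2.2.1 (by rw [p.2.2.2])
  choose s hs using fun p => finite_support (g (P p))
  refine ⟨Finset.univ.biUnion s, fun t ht a => ?_⟩
  let G := Hom.appLinear (directSumProj F t) d ∘ₗ g
  refine hπ.path_induction (motive := fun a => G a = 0) a ?_ (map_zero G) ?_ ?_
  · intro a b p hp
    exact hs ⟨a, b, p, by exact_mod_cast hp⟩ t fun h =>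
      ht (Finset.mem_biUnion.2 ⟨_, Finset.mem_univ _, h⟩)
  · intro x y hx hy
    exact (map_add G x y).trans ((congrArg₂ (· + ·) hx hy).trans (add_zero _))
  · intro c x hx
    have : c • x = (show 𝒜 k from MulOpposite.op (algebraMap K (𝒜 0) c) •
        (show (regular 𝒜).carrier k from x)) := by
      ext
      change c • x.1 = x.1 * algebraMap K Λ c
      rw [← Algebra.commutes, Algebra.smul_def]
    rw [this]
    exact (map_smul G _ _).trans ((congrArg _ hx).trans (smul_zero _))

theorem directSum_exists_act (hπ : IsGradedFactor 𝒜 π) {ι : Type u} {F : ι → GrMod 𝒜} {i k d : ℤ}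
    (h : i + k = d) (g : (regular 𝒜).carrier k →ₗ[(𝒜 0)ᵐᵒᵖ] (directSum F).carrier d)
    (hg : ∀ s, ∃ y : (F s).carrier i, ∀ a : 𝒜 k,
      (F s).act h y a = (directSumProj F s).app d (g a)) :
    ∃ y, ∀ a : 𝒜 k, (directSum F).act h y a = g a := by
  classical
  obtain ⟨s, hs⟩ := hπ.exists_finset g
  choose y hy using hg
  have hz : ∀ t, (directSumProj F t).app i (∑ t ∈ s, directSumOf F i t (y t)) =
      if t ∈ s then y t else 0 := by
    intro t
    rw [map_sum]
    split_ifs with ht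
    · rw [Finset.sum_eq_single t]
      · exact proj_of_self _ _ _ _
      · intro u _ hu
        exact proj_of_ne _ _ hu _
      · exact fun h => absurd ht h
    · refine Finset.sum_eq_zero fun u hu => proj_of_ne _ _ ?_ _
      rintro rfl
      exact ht hu
  refine ⟨∑ t ∈ s, directSumOf F i t (y t), fun a => directSum_ext fun t => ?_⟩
  rw [(directSumProj F t).app_act, hz]
  split_ifs with ht
  · exact hy t a
  · rw [zero_act]
    exact (hs t ht a).symm

theorem isCofree_directSum (hπ : IsGradedFactor 𝒜 π) {ι : Type u} {F : ι → GrMod 𝒜} {d : ℤ}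
    (hF : ∀ s, (F s).IsCofree d) : (directSum F).IsCofree d where
  eq_zero {i k} h x hx := directSum_ext fun s => by
    rw [map_zero]
    exact (hF s).eq_zero h _ fun a => by rw [← Hom.app_act, hx, map_zero]
  exists_act {i k} h g := hπ.directSum_exists_act h g fun s =>
    (hF s).exists_act h (Hom.appLinear (directSumProj F s) d ∘ₗ g)

/-- The direct sum of copies of D(Λ)[-d], one for each element of M_d, maps onto M in degree d.
Semisimplicity of Λ₀ splits this surjection in degree d, and cofreeness extends the splitting to a
retraction of graded modules. -/
theorem isAlmostInjective_of_isCofree (hπ : IsGradedFactor 𝒜 π) {M : GrMod 𝒜} {d : ℤ}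
    (hM : M.IsCofree d) : M.IsAlmostInjective := by
  classical
  have := hπ.isSemisimpleRing
  have hd : d + -d = 0 := add_neg_cancel d
  choose f y hfy _ using exists_dual_shift_hom hd hM
  let r := directSumDesc f
  have hr : Function.Surjective (Hom.appLinear r d) := fun x =>
    ⟨directSumOf _ d x (y x), (directSumDesc_of f d x (y x)).trans (hfy x)⟩
  have := Module.projective_of_isSemisimpleRing (𝒜 0)ᵐᵒᵖ (M.carrier d)
  obtain ⟨φ, hφ⟩ := Module.projective_lifting_property (Hom.appLinear r d) LinearMap.id hr
  obtain ⟨i, hi⟩ := (hπ.isCofree_directSum fun _ : M.carrier d =>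
    isCofree_dual_shift (𝒜 := 𝒜) hd).exists_lift φ
  refine ⟨M.carrier d, fun _ => -d, ⟨⟨i, r, hM.hom_ext fun x => ?_⟩⟩⟩
  rw [comp_app, hi]
  exact LinearMap.congr_fun hφ x

end IsGradedFactor

namespace GrMod

theorem IsCofree.isCogeneratedInDegree {M : GrMod 𝒜} {d : ℤ} (hM : M.IsCofree d) :
    M.IsCogeneratedInDegree d := by
  rintro N hN ⟨i, hi⟩ hd
  refine hi ((AddSubgroup.eq_bot_iff_forall _).2 fun x hx => ?_)
  refine hM.eq_zero (add_sub_cancel i d) x fun a => ?_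
  exact (AddSubgroup.eq_bot_iff_forall _).1 hd _ (hN _ x a hx)

/-- Cogeneration is applied to the graded submodule xΛ, which contains x = x·1 and whose degree d
part is xΛ_k. -/
theorem IsCogeneratedInDegree.eq_zero {M : GrMod 𝒜} {d : ℤ} (hM : M.IsCogeneratedInDegree d)
    {i k : ℤ} (h : i + k = d) (x : M.carrier i) (hx : ∀ a : 𝒜 k, M.act h x a = 0) : x = 0 := by
  by_contra hne
  refine hM (fun l => (M.actRight (add_sub_cancel i l) x).range) ?_ ⟨i, fun hi => hne ?_⟩ ?_
  · rintro j k l h _ a ⟨b, rfl⟩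
    refine ⟨⟨b * a, ?_⟩, (M.act_act _ h (show j - i + k = l - i by omega) _ x b a).symm⟩
    have := SetLike.GradedMul.mul_mem b.2 a.2
    rwa [show j - i + k = l - i by omega] at this
  · have h1 : (1 : Λ) ∈ 𝒜 (i - i) := by simpa using SetLike.GradedOne.one_mem
    have := (AddSubgroup.eq_bot_iff_forall _).1 hi _
      ⟨(⟨1, h1⟩ : 𝒜 (i - i)), rfl⟩
    have key : ∀ (j : ℤ) (hj : j = 0) (e : i + j = i) (h1 : (1 : Λ) ∈ 𝒜 j),
        M.act e x ⟨1, h1⟩ = x := by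
      rintro _ rfl e h1
      exact M.act_one x
    exact (key _ (sub_self i) _ h1).symm.trans this
  · rw [AddSubgroup.eq_bot_iff_forall]
    rintro _ ⟨a, rfl⟩
    obtain rfl : k = d - i := by omega
    exact hx a

/-- The socle of D(Λ) sits in degree 0: an element of negative degree is detected by multiples of
degree 0, and D(Λ) vanishes in positive degrees. -/
theorem dual_eq_zero {i : ℤ} (hi : i ≠ 0) (hneg : ∀ {k : ℤ}, k < 0 → ∀ x : 𝒜 k, x = 0)
    (f : (dual 𝒜).carrier i)
    (hf : ∀ (j k : ℤ) (h : i + j = k) (a : 𝒜 j), 0 < j → (dual 𝒜).act h f a = 0) : f = 0 := by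
  rcases lt_or_gt_of_ne hi with hi | hi
  · exact isCofree_dual.eq_zero (add_neg_cancel i) f fun a => hf _ _ _ a (by omega)
  · apply Subtype.ext
    ext x
    rw [hneg (show -i < 0 by omega) x, map_zero, map_zero]

end GrMod

namespace IsGradedFactor

variable {V : Type v₁} [Quiver.{v₂} V] [Fintype V] {π : PathAlgebra K V →ₐ[K] Λ}
variable [∀ a b : V, Finite (a ⟶ b)]

open GrMod

/-- M vanishes above degree d, so M_d consists of socle elements. In an ambient sum of modules
D(Λ)[t] they have components only in the summands with d + t = 0, and these are cofree in degree d.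
Represent the functional there and retract to M. -/
theorem isCofree_of_isAlmostInjective (hπ : IsGradedFactor 𝒜 π) {M : GrMod 𝒜} {d : ℤ}
    (hM : M.IsAlmostInjective) (hM' : M.IsCogeneratedInDegree d) : M.IsCofree d where
  eq_zero := hM'.eq_zero
  exists_act {i k} h f := by
    obtain ⟨ι, t, ⟨R⟩⟩ := hM
    have hgt : ∀ {l : ℤ}, d < l → ∀ x : M.carrier l, x = 0 := fun {l} hl x =>
      hM'.eq_zero (add_sub_cancel l d) x fun a => by
        rw [hπ.eq_zero_of_neg (by omega) a, act_zero]
    obtain ⟨y, hy⟩ := hπ.directSum_exists_act h (Hom.appLinear R.i d ∘ₗ f) fun s => by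
      by_cases hs : d + t s = 0
      · exact (isCofree_dual_shift hs).exists_act h
          (Hom.appLinear (directSumProj _ s) d ∘ₗ Hom.appLinear R.i d ∘ₗ f)
      -- In the summands with socle in another degree the functional has zero component, so 0
      -- represents it.
      · refine ⟨0, fun a => ?_⟩
        rw [zero_act]
        refine (dual_eq_zero hs hπ.eq_zero_of_neg _ fun j k hk b hj => ?_).symm
        obtain ⟨l, rfl⟩ : ∃ l, k = l + t s := ⟨k - t s, by omega⟩
        have hk' : d + j = l := by omega
        change ((dual 𝒜).shift (t s)).act hk' ((directSumProj _ s).app d (R.i.app d (f a))) b = 0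
        rw [← Hom.app_act, ← R.i.app_act, hgt (by omega) (M.act hk' (f a) b), map_zero, map_zero]
    refine ⟨R.r.app i y, fun a => ?_⟩
    rw [← R.r.app_act, hy]
    exact congr_app R.retract d (f a)

theorem isCofree_iff (hπ : IsGradedFactor 𝒜 π) {M : GrMod 𝒜} {d : ℤ} :
    M.IsAlmostInjective ∧ M.IsCogeneratedInDegree d ↔ M.IsCofree d :=
  ⟨fun h => hπ.isCofree_of_isAlmostInjective h.1 h.2, fun h =>
    ⟨hπ.isAlmostInjective_of_isCofree h, h.isCogeneratedInDegree⟩⟩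

end IsGradedFactor

/-! ### The category of linear `n`-complexes -/

namespace IsGradedFactor

variable {V : Type v₁} [Quiver.{v₂} V] [Fintype V] {π : PathAlgebra K V →ₐ[K] Λ}
variable [∀ a b : V, Finite (a ⟶ b)]

open Limits GrMod ZeroObject

theorem isLinearNComplex_iff (hπ : IsGradedFactor 𝒜 π) {n : ℕ} {I : ℤ ⥤ GrMod 𝒜} :
    isLinearNComplex 𝒜 n I ↔ (∀ k : ℤ, I.map (homOfLE (show k ≤ k + n by omega)) = 0) ∧
      ∀ k : ℤ, (I.obj k).IsCofree (-k) := by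
  simp only [isLinearNComplex, hπ.isCofree_iff]

theorem isClosedUnderIsomorphisms (hπ : IsGradedFactor 𝒜 π) (n : ℕ) :
    (isLinearNComplex 𝒜 n).IsClosedUnderIsomorphisms where
  of_iso {I J} e hI := by
    rw [hπ.isLinearNComplex_iff] at hI ⊢
    refine ⟨fun k => ?_, fun k => (hI.2 k).of_iso (e.app k)⟩
    rw [← cancel_epi (e.hom.app k), ← e.hom.naturality, hI.1, zero_comp, comp_zero]

theorem containsZero (hπ : IsGradedFactor 𝒜 π) (n : ℕ) :
    (isLinearNComplex 𝒜 n).ContainsZero where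
  exists_zero := by
    have h : IsZero (0 : ℤ ⥤ GrMod 𝒜) := isZero_zero _
    exact ⟨0, h, hπ.isLinearNComplex_iff.2
      ⟨fun k => (h.obj k).eq_of_src _ _, fun k => IsCofree.of_isZero (h.obj k)⟩⟩

theorem isClosedUnderKernels (hπ : IsGradedFactor 𝒜 π) (n : ℕ) :
    (isLinearNComplex 𝒜 n).IsClosedUnderKernels where
  kernels_le := by
    rintro _ ⟨f, k, hk, hf⟩
    rw [MorphismProperty.ofObjectProperty_iff, hπ.isLinearNComplex_iff,
      hπ.isLinearNComplex_iff] at hf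
    have hmono := Fork.IsLimit.mono hk
    rw [hπ.isLinearNComplex_iff]
    refine ⟨fun j => ?_, fun j => ?_⟩
    · have : Mono (k.ι.app (j + n)) := (NatTrans.mono_iff_mono_app k.ι).1 hmono _
      rw [← cancel_mono (k.ι.app (j + n)), zero_comp]
      exact (k.ι.naturality _).trans (by rw [hf.1.1, comp_zero])
    · have h := KernelFork.mapIsLimit k hk ((evaluation ℤ (GrMod 𝒜)).obj j)
      have h' := isLimitKernelFork (subι _ _ (isGrSubmodule_ker (f.app j))) (f.app j)
        (subι_ker_comp _) (fun _ => Subtype.val_injective) fun _ x hx => ⟨⟨x, hx⟩, rfl⟩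
      exact ((hf.1.2 j).ker (hf.2.2 j) (f.app j)).of_iso (h'.conePointUniqueUpToIso h)

theorem isClosedUnderCokernels (hπ : IsGradedFactor 𝒜 π) (n : ℕ) :
    (isLinearNComplex 𝒜 n).IsClosedUnderCokernels where
  cokernels_le := by
    rintro _ ⟨f, k, hk, hf⟩
    have := hπ.isSemisimpleRing
    rw [MorphismProperty.ofObjectProperty_iff, hπ.isLinearNComplex_iff,
      hπ.isLinearNComplex_iff] at hf
    have hepi := Cofork.IsColimit.epi hk
    rw [hπ.isLinearNComplex_iff]
    refine ⟨fun j => ?_, fun j => ?_⟩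
    · have : Epi (k.π.app j) := (NatTrans.epi_iff_epi_app k.π).1 hepi _
      rw [← cancel_epi (k.π.app j), comp_zero]
      exact (k.π.naturality _).symm.trans (by rw [hf.2.1, zero_comp])
    · have h := CokernelCofork.mapIsColimit k hk ((evaluation ℤ (GrMod 𝒜)).obj j)
      have h' := isColimitCokernelCofork (f.app j) (quotπ _ _ (isGrSubmodule_range (f.app j)))
        (comp_quotπ_range _) (quotπ_surjective _ _ _)
        fun _ _ hx => (quotπ_eq_zero_iff _ _ _ _).1 hx
      exact ((hf.1.2 j).coker (hf.2.2 j) (f.app j)).of_iso (h'.coconePointUniqueUpToIso h)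

theorem isClosedUnderFiniteProducts (hπ : IsGradedFactor 𝒜 π) (n : ℕ) :
    (isLinearNComplex 𝒜 n).IsClosedUnderFiniteProducts := by
  have := hπ.isClosedUnderIsomorphisms n
  have := hπ.containsZero n
  have : (isLinearNComplex 𝒜 n).IsClosedUnderBinaryProducts := ⟨by
    rintro X ⟨p, hp⟩
    simp only [hπ.isLinearNComplex_iff] at hp
    have h := fun j => isLimitOfPreserves ((evaluation ℤ (GrMod 𝒜)).obj j) p.isLimit
    rw [hπ.isLinearNComplex_iff]
    refine ⟨fun j => (h (j + n)).hom_ext fun s => ?_, fun j => ?_⟩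
    · rw [zero_comp]
      refine ((p.cone.π.app s).naturality _).trans ?_
      change _ ≫ (p.diag.obj s).map _ = 0
      rw [(hp s).1, comp_zero]
    · let A := (p.diag.obj ⟨WalkingPair.left⟩).obj j
      let B := (p.diag.obj ⟨WalkingPair.right⟩).obj j
      have h' : IsLimit (BinaryFan.mk (prodBicone A B).fst (prodBicone A B).snd) :=
        (isBinaryBilimitOfTotal (prodBicone A B) (by
          ext i x
          exact Prod.ext (add_zero x.1) (zero_add x.2))).isLimit
      exact ((hp _).2 j |>.prod ((hp _).2 j)).of_iso
        (h'.conePointsIsoOfNatIso (h j) (diagramIsoPair (p.diag ⋙ (evaluation _ _).obj j)).symm)⟩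
  exact ObjectProperty.IsClosedUnderFiniteProducts.mk'

/-- The abelian structure on the category of linear `n`-complexes. -/
@[reducible]
def abelian (hπ : IsGradedFactor 𝒜 π) (n : ℕ) : Abelian (LinearNComplex 𝒜 n) :=
  have := hπ.containsZero n
  have := hπ.isClosedUnderKernels n
  have := hπ.isClosedUnderCokernels n
  have := hπ.isClosedUnderFiniteProducts n
  inferInstance

theorem isAbelianCategory (hπ : IsGradedFactor 𝒜 π) (n : ℕ) :
    IsAbelianCategory (LinearNComplex 𝒜 n) :=
  let _ := hπ.abelian n
  ⟨inferInstance, inferInstance, inferInstance, inferInstance, inferInstance⟩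

instance {n : ℕ} (hn : 2 ≤ n) (m : ℤ) : (contraction 𝒜 hn m).Additive where
  map_add := by
    intros
    ext
    rfl

/-- In each degree contraction is the inclusion into functors ℤ ⥤ Gr_Λ followed by an evaluation.
The inclusion preserves kernels because the subcategory is closed under them. -/
theorem preservesFiniteLimits_contraction (hπ : IsGradedFactor 𝒜 π) {n : ℕ} (hn : 2 ≤ n) (m : ℤ) :
    PreservesFiniteLimits (contraction 𝒜 hn m) where
  preservesFiniteLimits J _ _ := by
    let _ := hπ.abelian n
    have := hπ.isClosedUnderKernels n
    have := (isLinearNComplex 𝒜 n).preservesKernels_ι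
    have : PreservesFiniteLimits (isLinearNComplex 𝒜 n).ι :=
      Functor.preservesFiniteLimits_of_preservesKernels _
    refine HomologicalComplex.preservesLimitsOfShape_of_eval _ fun k => ?_
    change PreservesLimitsOfShape J
      ((isLinearNComplex 𝒜 n).ι ⋙ (evaluation ℤ (GrMod 𝒜)).obj (contractionIndex n m k))
    infer_instance

theorem preservesFiniteColimits_contraction (hπ : IsGradedFactor 𝒜 π) {n : ℕ} (hn : 2 ≤ n)
    (m : ℤ) : PreservesFiniteColimits (contraction 𝒜 hn m) where
  preservesFiniteColimits J _ _ := by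
    let _ := hπ.abelian n
    have := hπ.isClosedUnderCokernels n
    have := (isLinearNComplex 𝒜 n).preservesCokernels_ι
    have : PreservesFiniteColimits (isLinearNComplex 𝒜 n).ι :=
      Functor.preservesFiniteColimits_of_preservesCokernels _
    refine HomologicalComplex.preservesColimitsOfShape_of_eval _ fun k => ?_
    change PreservesColimitsOfShape J
      ((isLinearNComplex 𝒜 n).ι ⋙ (evaluation ℤ (GrMod 𝒜)).obj (contractionIndex n m k))
    infer_instance

end IsGradedFactor

/-! ### The kernel of contraction and the quotient category -/

theorem contractionIndex_mem_supportSet (n : ℕ) (m k : ℤ) :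
    contractionIndex n m k ∈ supportSet n m := by
  obtain ⟨l, rfl | rfl⟩ := Int.even_or_odd' k
  · exact ⟨l, Or.inl (contractionIndex_even n m l)⟩
  · exact ⟨l, Or.inr (contractionIndex_odd n m l)⟩

theorem exists_contractionIndex {n : ℕ} {m j : ℤ} (hj : j ∈ supportSet n m) :
    ∃ k, contractionIndex n m k = j := by
  obtain ⟨l, rfl | rfl⟩ := hj
  · exact ⟨_, contractionIndex_even n m l⟩
  · exact ⟨_, contractionIndex_odd n m l⟩

theorem isZero_contraction_iff {n : ℕ} (hn : 2 ≤ n) (m : ℤ) (I : LinearNComplex 𝒜 n) :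
    Limits.IsZero ((contraction 𝒜 hn m).obj I) ↔ torsionClass 𝒜 n m I := by
  refine ⟨fun h j hj => ?_, fun h => ?_⟩
  · obtain ⟨k, rfl⟩ := exists_contractionIndex hj
    exact (HomologicalComplex.eval (GrMod 𝒜) _ k).map_isZero h
  · rw [Limits.IsZero.iff_id_eq_zero]
    ext k : 1
    exact (h _ (contractionIndex_mem_supportSet n m k)).eq_of_src _ _

namespace IsGradedFactor

variable {V : Type v₁} [Quiver.{v₂} V] [Fintype V] {π : PathAlgebra K V →ₐ[K] Λ}
variable [∀ a b : V, Finite (a ⟶ b)]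

open Limits ObjectProperty

theorem torsionClass_eq {n : ℕ} (hn : 2 ≤ n) (m : ℤ) :
    torsionClass 𝒜 n m = ObjectProperty.inverseImage (IsZero (C := CochainComplex (GrMod 𝒜) ℤ))
      (contraction 𝒜 hn m) :=
  funext fun I => propext (isZero_contraction_iff hn m I).symm

theorem isoModulo_eq {C : Type*} [Category* C] [Abelian C] (P : ObjectProperty C)
    [P.IsSerreClass] : isoModulo P = P.isoModSerre := by
  ext X Y f
  refine ⟨?_, fun h => ⟨⟨_, ⟨kernelIsKernel f⟩, h.1⟩, ⟨_, ⟨cokernelIsCokernel f⟩, h.2⟩⟩⟩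
  rintro ⟨⟨c, ⟨hc⟩, h⟩, ⟨c', ⟨hc'⟩, h'⟩⟩
  exact ⟨P.prop_of_iso (hc.conePointUniqueUpToIso (limit.isLimit _)) h,
    P.prop_of_iso (hc'.coconePointUniqueUpToIso (colimit.isColimit _)) h'⟩

/-- By calculus of fractions it suffices to compare two morphisms f, g of C with F f = F g. By
exactness F kills the image of f - g, so this image lies in P and f - g becomes zero in the
quotient. -/
theorem exact_functor_faithful {C D : Type*} [Category* C] [Abelian C] [Category* D] [Abelian D]
    (F : C ⥤ D) [PreservesFiniteLimits F] [PreservesFiniteColimits F] (P : ObjectProperty C)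
    (hP : P = ObjectProperty.inverseImage (IsZero (C := D)) F) :
    ∃ hF : (isoModulo P).IsInvertedBy F, (Localization.Construction.lift F hF).Faithful := by
  have hS : P.IsSerreClass := by
    rw [hP]
    infer_instance
  have hF : (isoModulo P).IsInvertedBy F := by
    rw [isoModulo_eq, isoModSerre_isInvertedBy_iff]
    intro X hX
    rw [hP] at hX
    exact hX
  refine ⟨hF, ?_⟩
  have : F.Additive := Functor.additive_of_preserves_binary_products F
  have := isoModulo_eq P
  -- The induced functor depends on the class of inverted morphisms through its type, so the two
  -- descriptions of this class are identified by substitution.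
  generalize isoModulo P = W at this hF
  subst this
  refine Functor.faithful_of_comp_of_hasLeftCalculusOfFractions P.isoModSerre.Q P.isoModSerre _
    fun X Y f g hfg => ?_
  have hfg' : F.map f = F.map g := by
    have h := Localization.Construction.fac F hF
    have hf := Functor.congr_hom h f
    have hg := Functor.congr_hom h g
    rw [Functor.comp_map] at hf hg
    rw [hf, hg] at hfg
    exact (cancel_mono _).1 ((cancel_epi _).1 hfg)
  rw [← sub_eq_zero, ← Functor.map_sub, SerreClassLocalization.map_eq_zero_iff _ P, hP]
  have h0 : F.map (f - g) = 0 := by rw [F.map_sub, hfg', sub_self]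
  have : F.map (Abelian.factorThruImage (f - g)) = 0 := by
    rw [← cancel_mono (F.map (Abelian.image.ι (f - g))), ← F.map_comp, zero_comp]
    simpa using h0
  exact IsZero.of_epi_eq_zero _ this

theorem faithful_quotient (hπ : IsGradedFactor 𝒜 π) {n : ℕ} (hn : 2 ≤ n) (m : ℤ) :
    ∃ hH : (isoModulo (torsionClass 𝒜 n m)).IsInvertedBy (contraction 𝒜 hn m),
      (Localization.Construction.lift (contraction 𝒜 hn m) hH).Faithful :=
  let _ := hπ.abelian n
  have := hπ.preservesFiniteLimits_contraction hn m
  have := hπ.preservesFiniteColimits_contraction hn m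
  exact_functor_faithful _ _ (torsionClass_eq hn m)

end IsGradedFactor

/-! ### Dual elements -/

namespace IsGradedFactor

variable {V : Type v₁} [Quiver.{v₂} V] [Fintype V] {π : PathAlgebra K V →ₐ[K] Λ}

open PathAlgebra GrMod

theorem vertexHom_mul_vertex (hπ : IsGradedFactor 𝒜 π) (c : V → K) (b : V) :
    hπ.vertexHom c * hπ.vertex b = c b • hπ.vertex b := by
  change (∑ a, c a • hπ.vertex a) * hπ.vertex b = _
  rw [Finset.sum_mul, Finset.sum_eq_single b]
  · ext
    simp only [SetLike.GradeZero.coe_mul, Submodule.coe_smul, smul_mul_assoc]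
    rw [← SetLike.GradeZero.coe_mul, vertex_mul_vertex]
  · intro a _ ha
    ext
    simp only [SetLike.GradeZero.coe_mul, Submodule.coe_smul, smul_mul_assoc]
    rw [← SetLike.GradeZero.coe_mul, vertex_mul_vertex_of_ne hπ ha]
    simp
  · simp

theorem vertex_mul_vertexHom (hπ : IsGradedFactor 𝒜 π) (c : V → K) (b : V) :
    hπ.vertex b * hπ.vertexHom c = c b • hπ.vertex b := by
  change hπ.vertex b * (∑ a, c a • hπ.vertex a) = _
  rw [Finset.mul_sum, Finset.sum_eq_single b]
  · ext
    simp only [SetLike.GradeZero.coe_mul, Submodule.coe_smul, mul_smul_comm]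
    rw [← SetLike.GradeZero.coe_mul, vertex_mul_vertex]
  · intro a _ ha
    ext
    simp only [SetLike.GradeZero.coe_mul, Submodule.coe_smul, mul_smul_comm]
    rw [← SetLike.GradeZero.coe_mul, vertex_mul_vertex_of_ne hπ ha.symm]
    simp
  · simp

theorem coe_vertexHom (hπ : IsGradedFactor 𝒜 π) (c : V → K) : (hπ.vertexHom c : Λ) =
    π (∑ v, c v • ofPath (Quiver.Path.nil : Quiver.Path v v)) := by
  change ((∑ a, c a • hπ.vertex a : 𝒜 0) : Λ) = _
  rw [AddSubmonoidClass.coe_finsetSum, map_sum]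
  refine Finset.sum_congr rfl fun a _ => ?_
  rw [map_smul]
  rfl

theorem coeff_mul_sum_nil (f : PathAlgebra K V) (c : V → K) {a b : V} (p : Quiver.Path a b) :
    (f * ∑ v, c v • ofPath (Quiver.Path.nil : Quiver.Path v v)).coeff a b p =
      c b * f.coeff a b p := by
  have key : ∀ v, (f * ofPath (Quiver.Path.nil : Quiver.Path v v)).coeff a b =
      open Classical in if v = b then f.coeff a b else 0 := by
    intro v
    rw [coeff_mul, Finset.sum_eq_single v]
    · split_ifs with h
      · subst h
        rw [coeff_ofPath_self, concat_nil]
      · rw [coeff_ofPath_of_ne _ fun h' => h h'.2.symm, map_zero]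
    · intro z _ hz
      rw [coeff_ofPath_of_ne _ fun h => hz h.1, map_zero]
    · simp
  change coeffₗ p _ = _
  rw [Finset.mul_sum, map_sum, Finset.sum_eq_single b]
  · rw [mul_smul_comm, map_smul, coeffₗ_apply, key, if_pos rfl, smul_eq_mul]
  · intro v _ hv
    rw [mul_smul_comm, map_smul, coeffₗ_apply, key, if_neg hv]
    simp
  · simp

/-- The element `x` is dual to the path `p`, with value the component of `w` at the target of `p`:
its product with `p` is this component, its products with the other paths of the same length
vanish. -/
def IsDual (hπ : IsGradedFactor 𝒜 π) {M : GrMod 𝒜} {i k d : ℤ} (h : i + k = d) {a b : V}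
    (p : Quiver.Path a b) (w : M.carrier d) (x : M.carrier i) : Prop :=
  open Classical in ∀ {c e : V} (q : Quiver.Path c e) (hq : (q.length : ℤ) = k),
    M.act h x (hπ.path q hq) =
      if (⟨c, e, q⟩ : Σ c e : V, Quiver.Path c e) = ⟨a, b, p⟩ then
        MulOpposite.op (hπ.vertex b) • w else 0

/-- Injectivity of π in the degree of p makes the coefficient of p a well-defined function on Λ_k.
Multiplied by the component of w at the target of p, it is Λ₀-linear, and cofreeness represents it.
-/
theorem exists_isDual (hπ : IsGradedFactor 𝒜 π) {M : GrMod 𝒜} {i k d : ℤ} (hM : M.IsCofree d)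
    (h : i + k = d) {a b : V} (p : Quiver.Path a b) (hk : (p.length : ℤ) = k)
    (hinj : ∀ x ∈ degreePart K V p.length, π x = 0 → x = 0) (w : M.carrier d) :
    ∃ x, hπ.IsDual h p w x := by
  subst hk
  -- g chooses homogeneous preimages under π; by `key` they are unique, hence compatible with sums
  -- and with Λ₀.
  choose g hg hg' using fun z : 𝒜 p.length => hπ.exists_of_mem z.2
  have key : ∀ (f : PathAlgebra K V) (_ : f ∈ degreePart K V p.length) (z : 𝒜 p.length),
      π f = z → g z = f := fun f hf z hz => by
    rw [← sub_eq_zero]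
    exact hinj _ (sub_mem (hg z) hf) (by rw [map_sub, hg', hz, sub_self])
  obtain ⟨x, hx⟩ := hM.exists_act h
    { toFun := fun z : 𝒜 p.length =>
        MulOpposite.op ((g z).coeff a b p • hπ.vertex b) • w
      map_add' := fun y z => by
        have : g (show 𝒜 p.length from y + z) = g y + g z :=
          key _ (add_mem (hg _) (hg _)) _
            ((map_add π _ _).trans (congrArg₂ (· + ·) (hg' y) (hg' z)))
        rw [this, coeff_add, Finsupp.add_apply, add_smul, MulOpposite.op_add, add_smul]
      map_smul' := fun e z => by
        obtain ⟨c, hc⟩ := hπ.vertexHom_surjective e.unop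
        have hfc : ∀ {a b} (q : Quiver.Path a b), (g z * ∑ v, c v •
            ofPath (Quiver.Path.nil : Quiver.Path v v)).coeff a b q = c b * (g z).coeff a b q :=
          fun q => coeff_mul_sum_nil _ _ _
        have : g (show 𝒜 p.length from e • z) =
            g z * ∑ v, c v • ofPath (Quiver.Path.nil : Quiver.Path v v) := by
          refine key _ (fun a b q hq => hg z a b q fun h0 => hq ?_) _ ?_
          · rw [hfc, h0, mul_zero]
          · refine (map_mul π _ _).trans (congrArg₂ (· * ·) (hg' z) ?_)
            rw [← hc, coe_vertexHom]
        rw [this, hfc, RingHom.id_apply, smul_smul, ← MulOpposite.op_unop e,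
          ← MulOpposite.op_mul, ← hc]
        congr 2
        ext
        simp only [SetLike.GradeZero.coe_mul, Submodule.coe_smul, smul_mul_assoc]
        rw [← SetLike.GradeZero.coe_mul, vertex_mul_vertexHom, mul_comm, mul_smul]
        rfl }
  refine ⟨x, fun {c e} q hq => (hx _).trans ?_⟩
  have hgq : g (hπ.path q hq) = ofPath q := by
    refine key _ ?_ _ rfl
    have := ofPath_mem (K := K) q
    rwa [show q.length = p.length by exact_mod_cast hq] at this
  change MulOpposite.op ((g (hπ.path q hq)).coeff a b p • hπ.vertex b) • w = _
  rw [hgq]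
  split_ifs with heq
  · cases heq
    rw [coeff_ofPath_self, Finsupp.single_eq_same, one_smul]
  · have : (ofPath q : PathAlgebra K V).coeff a b p = 0 := by
      by_cases hce : a = c ∧ b = e
      · obtain ⟨rfl, rfl⟩ := hce
        rw [coeff_ofPath_self]
        refine Finsupp.single_eq_of_ne fun hpq => heq ?_
        rw [hpq]
      · rw [coeff_ofPath_of_ne q hce, Finsupp.zero_apply]
    rw [this, zero_smul, MulOpposite.op_zero]
    exact zero_smul (𝒜 0)ᵐᵒᵖ w

theorem ext_path (hπ : IsGradedFactor 𝒜 π) {M : GrMod 𝒜} {i k d : ℤ} (hM : M.IsCofree d)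
    (h : i + k = d) {x y : M.carrier i}
    (hxy : ∀ {a b : V} (p : Quiver.Path a b) (hp : (p.length : ℤ) = k),
      M.act h x (hπ.path p hp) = M.act h y (hπ.path p hp)) : x = y := by
  refine hM.ext h fun z => ?_
  refine hπ.path_induction z (fun a b p hp => hxy p hp) ?_ ?_ ?_
  · rw [act_zero, act_zero]
  · intro a b ha hb
    rw [act_add, act_add, ha, hb]
  · intro c a ha
    rw [act_smul, act_smul, ha]

variable (V) in
/-- The arrows of the quiver. -/
abbrev Arrows := Σ a b : V, (a ⟶ b)

/-- The element of degree one given by an arrow. -/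
def arrowElt (hπ : IsGradedFactor 𝒜 π) (s : Arrows V) : 𝒜 1 :=
  hπ.path s.2.2.toPath (by simp)

theorem ext_arrow (hπ : IsGradedFactor 𝒜 π) {M : GrMod 𝒜} {i d : ℤ} (hM : M.IsCofree d)
    (h : i + 1 = d) {x y : M.carrier i}
    (hxy : ∀ s : Arrows V, M.act h x (hπ.arrowElt s) = M.act h y (hπ.arrowElt s)) : x = y := by
  refine hπ.ext_path hM h fun {a b} p hp => ?_
  rcases p with _ | ⟨p, α⟩
  · simp at hp
  · obtain rfl := p.eq_of_length_zero (by simpa using hp)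
    obtain rfl := p.eq_nil_of_length_zero (by simpa using hp)
    exact hxy ⟨_, _, α⟩

omit [Fintype V] in
theorem toPath_eq_iff (s t : Arrows V) :
    (⟨t.1, t.2.1, t.2.2.toPath⟩ : Σ c e : V, Quiver.Path c e) = ⟨s.1, s.2.1, s.2.2.toPath⟩ ↔
      t = s := by
  refine ⟨fun h => ?_, fun h => h ▸ rfl⟩
  obtain ⟨a, b, α⟩ := s
  obtain ⟨c, e, β⟩ := t
  simp only [Quiver.Hom.toPath, Sigma.mk.injEq] at h
  obtain ⟨rfl, h⟩ := h
  obtain ⟨rfl, h⟩ := Sigma.mk.inj_iff.1 (eq_of_heq h)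
  have := Quiver.Path.hom_heq_of_cons_eq_cons (eq_of_heq h)
  rw [eq_of_heq this]

theorem exists_dualElt (hπ : IsGradedFactor 𝒜 π) {M : GrMod 𝒜} {i d : ℤ} (hM : M.IsCofree d)
    (h : i + 1 = d) (s : Arrows V) (w : M.carrier d) :
    ∃ x : M.carrier i, ∀ t : Arrows V, M.act h x (hπ.arrowElt t) =
      open Classical in if t = s then MulOpposite.op (hπ.vertex s.2.1) • w else 0 := by
  obtain ⟨x, hx⟩ := hπ.exists_isDual hM h s.2.2.toPath (by simp) (by simpa using hπ.injOn_one) w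
  refine ⟨x, fun t => ?_⟩
  rw [arrowElt, hx]
  by_cases hts : t = s
  · rw [if_pos hts, if_pos ((toPath_eq_iff s t).2 hts)]
  · rw [if_neg hts, if_neg fun h => hts ((toPath_eq_iff s t).1 h)]

open Classical in
/-- The element dual to an arrow, with value a component of `w`. -/
def dualElt (hπ : IsGradedFactor 𝒜 π) {M : GrMod 𝒜} {i d : ℤ} (hM : M.IsCofree d)
    (h : i + 1 = d) (s : Arrows V) : M.carrier d →+ M.carrier i :=
  AddMonoidHom.mk' (fun w => (hπ.exists_dualElt hM h s w).choose) fun w w' =>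
    hπ.ext_arrow hM h fun t => by
      rw [add_act, (hπ.exists_dualElt hM h s (w + w')).choose_spec,
        (hπ.exists_dualElt hM h s w).choose_spec, (hπ.exists_dualElt hM h s w').choose_spec]
      split_ifs
      · rw [smul_add]
      · rw [add_zero]

open Classical in
theorem dualElt_act (hπ : IsGradedFactor 𝒜 π) {M : GrMod 𝒜} {i d : ℤ} (hM : M.IsCofree d)
    (h : i + 1 = d) (s t : Arrows V) (w : M.carrier d) :
    M.act h (hπ.dualElt hM h s w) (hπ.arrowElt t) =
      if t = s then MulOpposite.op (hπ.vertex s.2.1) • w else 0 :=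
  (hπ.exists_dualElt hM h s w).choose_spec t

theorem app_dualElt (hπ : IsGradedFactor 𝒜 π) {M N : GrMod 𝒜} {i d : ℤ} (hM : M.IsCofree d)
    (hN : N.IsCofree d) (h : i + 1 = d) (s : Arrows V) (f : M ⟶ N) (w : M.carrier d) :
    f.app i (hπ.dualElt hM h s w) = hπ.dualElt hN h s (f.app d w) := by
  refine hπ.ext_arrow hN h fun t => ?_
  rw [← f.app_act, dualElt_act, dualElt_act]
  split_ifs
  · rw [Hom.app_smul]
  · rw [map_zero]

theorem zero_mul_mem {k : ℤ} (e : 𝒜 0) (a : 𝒜 k) : (e * a : Λ) ∈ 𝒜 k := by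
  simpa using SetLike.GradedMul.mul_mem e.2 a.2

/-- Only the component of the value at the target of s matters, and there e acts by a scalar, which
is central. The element e' depends only on s and e; this uniformity lets one e' serve two complexes
at once. -/
theorem dualElt_op_smul (hπ : IsGradedFactor 𝒜 π) (s : Arrows V) (e : 𝒜 0) :
    ∃ e' : 𝒜 0, ∀ {M : GrMod 𝒜} {i d : ℤ} (hM : M.IsCofree d) (h : i + 1 = d) (w : M.carrier d),
      hπ.dualElt hM h s (MulOpposite.op e • w) = MulOpposite.op e' • hπ.dualElt hM h s w := by
  obtain ⟨c, rfl⟩ := hπ.vertexHom_surjective e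
  refine ⟨algebraMap K (𝒜 0) (c s.2.1), fun {M i d} hM h w => hπ.ext_arrow hM h fun t => ?_⟩
  have : (⟨algebraMap K (𝒜 0) (c s.2.1) * hπ.arrowElt t,
      zero_mul_mem _ _⟩ : 𝒜 1) = c s.2.1 • hπ.arrowElt t := by
    ext
    exact (Algebra.smul_def _ _).symm
  rw [smul_op_act, this, act_smul, dualElt_act, dualElt_act]
  split_ifs
  · rw [smul_smul, smul_smul, ← MulOpposite.op_mul, ← MulOpposite.op_mul, vertexHom_mul_vertex]
    congr 2
    ext
    change c s.2.1 • (hπ.vertex _ : Λ) = (hπ.vertex _ : Λ) * algebraMap K Λ _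
    rw [← Algebra.commutes, Algebra.smul_def]
  · rw [smul_zero]

theorem dualElt_vertex_smul (hπ : IsGradedFactor 𝒜 π) {M : GrMod 𝒜} {i d : ℤ} (hM : M.IsCofree d)
    (h : i + 1 = d) (s : Arrows V) (w : M.carrier d) :
    hπ.dualElt hM h s (MulOpposite.op (hπ.vertex s.2.1) • w) = hπ.dualElt hM h s w := by
  refine hπ.ext_arrow hM h fun t => ?_
  rw [dualElt_act, dualElt_act, smul_smul, ← MulOpposite.op_mul, vertex_mul_vertex]

omit [GradedAlgebra 𝒜] in
theorem vertex_mul_path (hπ : IsGradedFactor 𝒜 π) {a b : V} (p : Quiver.Path a b) {k : ℤ}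
    (hp : (p.length : ℤ) = k) : (hπ.vertex a * hπ.path p hp : Λ) = hπ.path p hp := by
  rw [vertex, path_mul_path hπ _ _ _ _ (by simpa using hp)]
  simp [path]

omit [GradedAlgebra 𝒜] in
theorem path_mul_vertex (hπ : IsGradedFactor 𝒜 π) {a b : V} (p : Quiver.Path a b) {k : ℤ}
    (hp : (p.length : ℤ) = k) : (hπ.path p hp * hπ.vertex b : Λ) = hπ.path p hp := by
  rw [vertex, path_mul_path hπ _ _ _ _ (by simpa using hp)]
  simp [path]

theorem vertex_smul_dualElt (hπ : IsGradedFactor 𝒜 π) {M : GrMod 𝒜} {i d : ℤ} (hM : M.IsCofree d)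
    (h : i + 1 = d) (s : Arrows V) (w : M.carrier d) :
    MulOpposite.op (hπ.vertex s.1) • hπ.dualElt hM h s w = hπ.dualElt hM h s w := by
  refine hπ.ext_arrow hM h fun t => ?_
  rw [smul_op_act]
  by_cases hs : s.1 = t.1
  · congr 1
    ext
    rw [hs]
    exact hπ.vertex_mul_path _ _
  · have : (⟨hπ.vertex s.1 * hπ.arrowElt t, zero_mul_mem _ _⟩ : 𝒜 1) = 0 :=
      Subtype.ext (hπ.path_mul_path_of_ne _ _ _ _ hs)
    rw [this, act_zero, dualElt_act, if_neg]
    rintro rfl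
    exact hs rfl

/-- The dual basis expansion: both sides have the same product with every arrow, and arrows detect
elements in degree d - 1. -/
theorem eq_sum_dualElt (hπ : IsGradedFactor 𝒜 π) {M : GrMod 𝒜} {i d : ℤ} (hM : M.IsCofree d)
    (h : i + 1 = d) [Fintype (Arrows V)] (x : M.carrier i) :
    x = ∑ s, hπ.dualElt hM h s (M.act h x (hπ.arrowElt s)) := by
  classical
  refine hπ.ext_arrow hM h fun t => ?_
  rw [← actHom_apply, ← actHom_apply, map_sum, Finset.sum_eq_single t]
  · rw [actHom_apply, actHom_apply, dualElt_act, if_pos rfl, ← act_smul_op]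
    congr 1
    ext
    exact (hπ.path_mul_vertex _ _).symm
  · intro s _ hs
    rw [actHom_apply, dualElt_act, if_neg hs.symm]
  · simp

end IsGradedFactor

/-! ### The action of the dual arrows on the cogenerators of a complex -/

namespace IsGradedFactor

variable {V : Type v₁} [Quiver.{v₂} V] [Fintype V] {π : PathAlgebra K V →ₐ[K] Λ}

open PathAlgebra GrMod

/-- The composition of the differentials from `I^i` to `I^j`. -/
def dmap (I : ℤ ⥤ GrMod 𝒜) {i j : ℤ} (h : i ≤ j) : I.obj i ⟶ I.obj j := I.map (homOfLE h)

theorem dmap_dmap (I : ℤ ⥤ GrMod 𝒜) {i j k : ℤ} (h : i ≤ j) (h' : j ≤ k) {l : ℤ}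
    (x : (I.obj i).carrier l) :
    (dmap I h').app l ((dmap I h).app l x) = (dmap I (h.trans h')).app l x :=
  (congr_app (I.map_comp (homOfLE h) (homOfLE h')) l x).symm

theorem dmap_self (I : ℤ ⥤ GrMod 𝒜) {i l : ℤ} (x : (I.obj i).carrier l) :
    (dmap I le_rfl).app l x = x :=
  congr_app (I.map_id i) l x

theorem app_dmap {I J : ℤ ⥤ GrMod 𝒜} (f : I ⟶ J) {i j : ℤ} (h : i ≤ j) {l : ℤ}
    (x : (I.obj i).carrier l) :
    (f.app j).app l ((dmap I h).app l x) = (dmap J h).app l ((f.app i).app l x) :=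
  congr_app (f.naturality (homOfLE h)) l x

/-- The action of the dual of an arrow on the components of degree `-j` of `I^j`. -/
def theta (hπ : IsGradedFactor 𝒜 π) {I : ℤ ⥤ GrMod 𝒜} (hI : ∀ k, (I.obj k).IsCofree (-k))
    {i j : ℤ} (h : i + 1 = j) (s : Arrows V) :
    (I.obj i).carrier (-i) →+ (I.obj j).carrier (-j) :=
  ((dmap I (show i ≤ j by omega)).app (-j)).comp
    (hπ.dualElt (hI i) (show -j + 1 = -i by omega) s)

theorem theta_apply (hπ : IsGradedFactor 𝒜 π) {I : ℤ ⥤ GrMod 𝒜}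
    (hI : ∀ k, (I.obj k).IsCofree (-k)) {i j : ℤ} (h : i + 1 = j) (s : Arrows V)
    (w : (I.obj i).carrier (-i)) : hπ.theta hI h s w = (dmap I (show i ≤ j by omega)).app (-j)
      (hπ.dualElt (hI i) (show -j + 1 = -i by omega) s w) := rfl

section

variable (hπ : IsGradedFactor 𝒜 π) {I J : ℤ ⥤ GrMod 𝒜} (hI : ∀ k, (I.obj k).IsCofree (-k))
  (hJ : ∀ k, (J.obj k).IsCofree (-k))

theorem app_theta (f : I ⟶ J) {i j : ℤ} (h : i + 1 = j) (s : Arrows V)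
    (w : (I.obj i).carrier (-i)) : (f.app j).app (-j) (hπ.theta hI h s w) =
      hπ.theta hJ h s ((f.app i).app (-i) w) := by
  rw [theta_apply, theta_apply, app_dmap, hπ.app_dualElt (hI i) (hJ i)]

theorem theta_op_smul (s : Arrows V) (e : 𝒜 0) :
    ∃ e' : 𝒜 0, ∀ {I : ℤ ⥤ GrMod 𝒜} (hI : ∀ k, (I.obj k).IsCofree (-k)) {i j : ℤ} (h : i + 1 = j)
      (w : (I.obj i).carrier (-i)), hπ.theta hI h s (MulOpposite.op e • w) =
        MulOpposite.op e' • hπ.theta hI h s w := by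
  obtain ⟨e', he'⟩ := hπ.dualElt_op_smul s e
  refine ⟨e', fun {I} hI {i j} h w => ?_⟩
  rw [theta_apply, theta_apply, he', Hom.app_smul]

theorem theta_vertex_smul {i j : ℤ} (h : i + 1 = j) (s : Arrows V) (w : (I.obj i).carrier (-i)) :
    hπ.theta hI h s (MulOpposite.op (hπ.vertex s.2.1) • w) = hπ.theta hI h s w := by
  rw [theta_apply, theta_apply, dualElt_vertex_smul]

theorem vertex_smul_theta {i j : ℤ} (h : i + 1 = j) (s : Arrows V) (w : (I.obj i).carrier (-i)) :
    MulOpposite.op (hπ.vertex s.1) • hπ.theta hI h s w = hπ.theta hI h s w := by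
  rw [theta_apply, ← Hom.app_smul, vertex_smul_dualElt]

theorem vertex_smul_theta_of_ne {i j : ℤ} (h : i + 1 = j) (s : Arrows V)
    (w : (I.obj i).carrier (-i)) {b : V} (hb : s.1 ≠ b) :
    MulOpposite.op (hπ.vertex b) • hπ.theta hI h s w = 0 := by
  rw [← vertex_smul_theta, smul_smul, ← MulOpposite.op_mul, vertex_mul_vertex_of_ne hπ hb,
    MulOpposite.op_zero]
  exact zero_smul (𝒜 0)ᵐᵒᵖ (hπ.theta hI h s w)

theorem eq_sum_vertex_smul {M : GrMod 𝒜} {i : ℤ} (w : M.carrier i) :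
    w = ∑ b, MulOpposite.op (hπ.vertex b) • w := by
  conv_lhs => rw [← one_smul (𝒜 0)ᵐᵒᵖ w, ← MulOpposite.op_one, ← hπ.sum_vertex]
  exact map_sum (M.actRight (add_zero i) w) _ _

/-- The differential applied to the dual basis expansion of x. It shows that the operators θ
determine the differential in its cogenerating degree, hence everywhere. -/
theorem dmap_eq_sum [Fintype (Arrows V)] {i j : ℤ} (h : i + 1 = j) (x : (I.obj i).carrier (-j)) :
    (dmap I (show i ≤ j by omega)).app (-j) x = ∑ s, hπ.theta hI h s
      ((I.obj i).act (show -j + 1 = -i by omega) x (hπ.arrowElt s)) := by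
  conv_lhs => rw [hπ.eq_sum_dualElt (hI i) (show -j + 1 = -i by omega) x]
  rw [map_sum]
  rfl

end

theorem eq_zero_of_lt (hπ : IsGradedFactor 𝒜 π) {M : GrMod 𝒜} {d i : ℤ} (hM : M.IsCofree d)
    (h : d < i) (x : M.carrier i) : x = 0 :=
  hM.eq_zero (add_sub_cancel i d) x fun a => by
    rw [hπ.eq_zero_of_neg (by omega) a, act_zero]

/-- The graded socle of a module cofree in degree d is its degree d component: the module vanishes
above d, and below d nonzero elements have nonzero multiples in degree d. -/
theorem socleLERange_iff (hπ : IsGradedFactor 𝒜 π) {M N : GrMod 𝒜} {d : ℤ} (hN : N.IsCofree d)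
    (f : M ⟶ N) : SocleLERange f ↔ Function.Surjective (f.app d) := by
  refine ⟨fun h w => h d fun j k hk a hj => hπ.eq_zero_of_lt hN (by omega) _, fun h i x hx => ?_⟩
  rcases lt_trichotomy i d with hi | rfl | hi
  · rw [hN.eq_zero (add_sub_cancel i d) x fun a => hx _ _ _ a (by omega)]
    exact zero_mem _
  · exact h x
  · rw [hπ.eq_zero_of_lt hN hi x]
    exact zero_mem _

/-- Morphisms from D(Λ)[j] realize every element of (I^j)_{-j}, with image in degree -j generated by
it over Λ₀. Such a morphism is killed by the differential exactly when its values in degree -j are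
killed by all θ_s. -/
theorem hom_dual_eq_zero_iff (hπ : IsGradedFactor 𝒜 π) [∀ a b : V, Finite (a ⟶ b)]
    {I : ℤ ⥤ GrMod 𝒜} (hI : ∀ k, (I.obj k).IsCofree (-k)) (j : ℤ) :
    (∀ f : (dual 𝒜).shift j ⟶ I.obj j, f ≫ I.map (homOfLE (show j ≤ j + 1 by omega)) = 0 → f = 0) ↔
      ∀ w : (I.obj j).carrier (-j), (∀ s, hπ.theta hI rfl s w = 0) → w = 0 := by
  have := Fintype.ofFinite (Arrows V)
  have hD : ((dual 𝒜).shift j).IsCofree (-j) := isCofree_dual_shift (neg_add_cancel j)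
  refine ⟨fun h w hw => ?_, fun h f hf => (hI j).hom_ext fun y => h _ fun s => ?_⟩
  · obtain ⟨f, y, hfy, hf⟩ := exists_dual_shift_hom (neg_add_cancel j) (hI j) w
    rw [← hfy]
    refine congr_app (h f ((hI (j + 1)).hom_ext fun z => ?_)) _ y
    refine (hπ.dmap_eq_sum hI rfl _).trans (Finset.sum_eq_zero fun s _ => ?_)
    rw [← f.app_act]
    obtain ⟨e, he⟩ := hf (((dual 𝒜).shift j).act (show -(j + 1) + 1 = -j by omega) z
      (hπ.arrowElt s))
    obtain ⟨e', he'⟩ := hπ.theta_op_smul s e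
    rw [he, he', hw, smul_zero]
  · rw [theta_apply, ← hπ.app_dualElt hD]
    exact congr_app hf _ _

end IsGradedFactor

/-! ### The restriction of the contraction functor is faithful -/

theorem mem_supportSet_of_dvd {n : ℕ} {m j : ℤ} (h : (n : ℤ) ∣ j - m) : j ∈ supportSet n m := by
  obtain ⟨k, hk⟩ := h
  exact ⟨k, Or.inl (by rw [mul_comm]; omega)⟩

theorem mem_supportSet_iff {n : ℕ} {m j : ℤ} :
    j ∈ supportSet n m ↔ (n : ℤ) ∣ j - m ∨ (n : ℤ) ∣ j - 1 - m := by
  refine ⟨?_, fun h => h.elim mem_supportSet_of_dvd ?_⟩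
  · rintro ⟨k, rfl | rfl⟩
    · exact Or.inl ⟨k, by ring⟩
    · exact Or.inr ⟨k, by ring⟩
  · rintro ⟨k, hk⟩
    exact ⟨k, Or.inr (by rw [mul_comm]; omega)⟩

theorem modEq_iff_dvd_sub {n : ℕ} {m j : ℤ} : j ≡ m [ZMOD n] ↔ (n : ℤ) ∣ j - m :=
  Int.modEq_comm.trans Int.modEq_iff_dvd

/-- Induction along the residue classes modulo `n`, starting from the class of `m`. -/
theorem supportSet_induction {n : ℕ} (hn : 2 ≤ n) (m : ℤ) {motive : ℤ → Prop}
    (mem : ∀ j ∈ supportSet n m, motive j)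
    (succ : ∀ j, j + 1 ∉ supportSet n m → motive j → motive (j + 1)) (j : ℤ) : motive j := by
  have hn0 : (n : ℤ) ≠ 0 := by omega
  -- r is the distance from j back to m + nℤ; the induction stops as soon as j lies in 𝒮.
  suffices ∀ (r : ℕ) (j : ℤ), (n : ℤ) ∣ j - m - r → motive j by
    refine this ((j - m) % n).toNat j ?_
    rw [Int.toNat_of_nonneg (Int.emod_nonneg _ hn0)]
    exact Int.dvd_self_sub_emod
  intro r
  induction r with
  | zero => exact fun j hj => mem j (mem_supportSet_of_dvd (by simpa using hj))
  | succ r ih =>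
    intro j hj
    by_cases hS : j ∈ supportSet n m
    · exact mem j hS
    · have := succ (j - 1) (by rwa [sub_add_cancel]) (ih _ (by
        rwa [show j - 1 - m - (r : ℤ) = j - m - (r + 1 : ℕ) by push_cast; ring]))
      rwa [sub_add_cancel] at this

namespace IsGradedFactor

variable {V : Type v₁} [Quiver.{v₂} V] [Fintype V] {π : PathAlgebra K V →ₐ[K] Λ}
variable [∀ a b : V, Finite (a ⟶ b)]

open PathAlgebra GrMod

theorem isCofree_obj (hπ : IsGradedFactor 𝒜 π) {n : ℕ} (I : LinearNComplex 𝒜 n) (k : ℤ) :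
    (I.obj.obj k).IsCofree (-k) :=
  (hπ.isLinearNComplex_iff.1 I.property).2 k

theorem surjective_of_isGStar (hπ : IsGradedFactor 𝒜 π) {n : ℕ} {m : ℤ} (hn : 2 < n)
    {I : LinearNComplex 𝒜 n} (hI : isGStar 𝒜 n m I) {i j : ℤ} (h : i + 1 = j)
    (hj : ¬ (n : ℤ) ∣ j - m) :
    Function.Surjective ((dmap I.obj (show i ≤ j by omega)).app (-j)) := by
  obtain rfl : i = j - 1 := by omega
  exact (hπ.socleLERange_iff (hπ.isCofree_obj I j) _).1
    ((hI hn).2 j fun h => hj (modEq_iff_dvd_sub.1 h))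

theorem not_dvd_of_not_mem {n : ℕ} {m j : ℤ} (hj : j ∉ supportSet n m) : ¬ (n : ℤ) ∣ j - m :=
  fun h => hj (mem_supportSet_of_dvd h)

/-- For n = 2 the set 𝒮 is all of ℤ. An index outside 𝒮 therefore supplies the inequality under
which the conditions of 𝒢* are imposed. -/
theorem two_lt_of_not_mem {n : ℕ} (hn : 2 ≤ n) {m j : ℤ} (hj : j ∉ supportSet n m) : 2 < n := by
  rcases hn.lt_or_eq with h | rfl
  · exact h
  · refine absurd (mem_supportSet_iff.2 ?_) hj
    push_cast
    omega

/-- Outside 𝒮 the cogenerating component of I^{j+1} is covered by the differential, so the component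
of a morphism at j determines the one at j + 1. -/
theorem eq_of_isGStar (hπ : IsGradedFactor 𝒜 π) {n : ℕ} (hn : 2 ≤ n) {m : ℤ}
    {I J : LinearNComplex 𝒜 n} (hI : isGStar 𝒜 n m I) {f g : I ⟶ J}
    (hfg : ∀ j ∈ supportSet n m, f.hom.app j = g.hom.app j) : f = g := by
  refine ObjectProperty.hom_ext _ (NatTrans.ext (funext fun j => ?_))
  refine supportSet_induction hn m (motive := fun j => f.hom.app j = g.hom.app j) hfg ?_ j
  intro j hj ih
  refine (hπ.isCofree_obj J (j + 1)).hom_ext fun w => ?_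
  obtain ⟨x, rfl⟩ := hπ.surjective_of_isGStar (two_lt_of_not_mem hn hj) hI rfl
    (not_dvd_of_not_mem hj) w
  rw [app_dmap, app_dmap, ih]

theorem faithful_restriction (hπ : IsGradedFactor 𝒜 π) {n : ℕ} (hn : 2 ≤ n) (m : ℤ) :
    ((isGStar 𝒜 n m).ι ⋙ contraction 𝒜 hn m).Faithful where
  map_injective {I J} f g hfg := by
    refine ObjectProperty.hom_ext _ (hπ.eq_of_isGStar hn I.property fun j hj => ?_)
    obtain ⟨k, rfl⟩ := exists_contractionIndex hj
    exact congrArg (fun φ => HomologicalComplex.Hom.f φ k) hfg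

end IsGradedFactor

/-! ### Subcomplexes and quotient complexes -/

namespace IsGradedFactor

variable {V : Type v₁} [Quiver.{v₂} V] [Fintype V] {π : PathAlgebra K V →ₐ[K] Λ}

open PathAlgebra GrMod

/-- A morphism of complexes given by morphisms which commute with the differentials. -/
def natTransOfSucc {I J : ℤ ⥤ GrMod 𝒜} (f : ∀ j, I.obj j ⟶ J.obj j)
    (hf : ∀ j, f j ≫ dmap J (show j ≤ j + 1 by omega) = dmap I (show j ≤ j + 1 by omega) ≫ f (j + 1)) :
    I ⟶ J where
  app := f
  naturality i j h := by
    have key : ∀ j (h : i ≤ j), dmap I h ≫ f j = f i ≫ dmap J h := by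
      intro j h
      induction j, h using Int.leInduction with
      | base =>
        ext l x
        exact (congrArg _ (dmap_self I x)).trans (dmap_self J _).symm
      | succ j h ih =>
        ext l x
        have h1 := congr_app ih l x
        have h2 := congr_app (hf j) l ((dmap I h).app l x)
        rw [comp_app, comp_app] at h1 h2 ⊢
        rw [← dmap_dmap I h (show j ≤ j + 1 by omega), ← h2, h1, dmap_dmap]
    exact key j h.le

/-- The subcomplex of a complex given by graded submodules of its terms. -/
def subcomplex (I : ℤ ⥤ GrMod 𝒜) (N : ∀ j i, AddSubgroup ((I.obj j).carrier i))
    (hN : ∀ j, (I.obj j).IsGrSubmodule (N j))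
    (h : ∀ {j k : ℤ} (f : j ⟶ k), ∀ i, ∀ x ∈ N j i, (I.map f).app i x ∈ N k i) :
    ℤ ⥤ GrMod 𝒜 where
  obj j := (I.obj j).sub (N j) (hN j)
  map f := subLift _ _ (subι _ _ (hN _) ≫ I.map f) fun i x => h f i x.1 x.2
  map_id j := by
    ext i x
    exact Subtype.ext (congr_app (I.map_id j) i x.1)
  map_comp f g := by
    ext i x
    exact Subtype.ext (congr_app (I.map_comp f g) i x.1)

/-- The inclusion of a subcomplex. -/
def subcomplexι (I : ℤ ⥤ GrMod 𝒜) (N : ∀ j i, AddSubgroup ((I.obj j).carrier i))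
    (hN : ∀ j, (I.obj j).IsGrSubmodule (N j))
    (h : ∀ {j k : ℤ} (f : j ⟶ k), ∀ i, ∀ x ∈ N j i, (I.map f).app i x ∈ N k i) :
    subcomplex I N hN h ⟶ I where
  app j := subι _ _ (hN j)

/-- The quotient of a complex by a subcomplex. -/
def quotcomplex (I : ℤ ⥤ GrMod 𝒜) (N : ∀ j i, AddSubgroup ((I.obj j).carrier i))
    (hN : ∀ j, (I.obj j).IsGrSubmodule (N j))
    (h : ∀ {j k : ℤ} (f : j ⟶ k), ∀ i, ∀ x ∈ N j i, (I.map f).app i x ∈ N k i) :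
    ℤ ⥤ GrMod 𝒜 where
  obj j := (I.obj j).quot (N j) (hN j)
  map f := quotDesc _ _ (I.map f ≫ quotπ _ _ (hN _)) fun i x hx =>
    (quotπ_eq_zero_iff _ _ _ _).2 (h f i x hx)
  map_id j := by
    ext i x
    obtain ⟨x, rfl⟩ := quotπ_surjective _ _ (hN j) i x
    exact congrArg ((quotπ _ _ (hN j)).app i) (congr_app (I.map_id j) i x)
  map_comp {j k l} f g := by
    ext i x
    obtain ⟨x, rfl⟩ := quotπ_surjective _ _ (hN j) i x
    exact congrArg ((quotπ _ _ (hN l)).app i) (congr_app (I.map_comp f g) i x)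

/-- The projection to a quotient complex. -/
def quotcomplexπ (I : ℤ ⥤ GrMod 𝒜) (N : ∀ j i, AddSubgroup ((I.obj j).carrier i))
    (hN : ∀ j, (I.obj j).IsGrSubmodule (N j))
    (h : ∀ {j k : ℤ} (f : j ⟶ k), ∀ i, ∀ x ∈ N j i, (I.map f).app i x ∈ N k i) :
    I ⟶ quotcomplex I N hN h where
  app j := quotπ _ _ (hN j)

theorem mem_cogen_arrow (hπ : IsGradedFactor 𝒜 π) {M : GrMod 𝒜} {i d : ℤ} (h : i + 1 = d)
    {U : Submodule (𝒜 0)ᵐᵒᵖ (M.carrier d)} {x : M.carrier i}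
    (hx : ∀ s : Arrows V, M.act h x (hπ.arrowElt s) ∈ U) : x ∈ M.cogen U i := by
  refine (mem_cogen h).2 fun a => hπ.path_induction a ?_ ?_ ?_ ?_
  · rintro a b (_ | ⟨p, α⟩) hp
    · simp at hp
    · obtain rfl := p.eq_of_length_zero (by simpa using hp)
      obtain rfl := p.eq_nil_of_length_zero (by simpa using hp)
      exact hx ⟨_, _, α⟩
  · rw [act_zero]
    exact zero_mem _
  · intro a b ha hb
    rw [act_add]
    exact add_mem ha hb
  · intro c a ha
    rw [act_smul]
    exact U.smul_mem _ ha

theorem dualElt_mem_cogen (hπ : IsGradedFactor 𝒜 π) {M : GrMod 𝒜} {i d : ℤ} (hM : M.IsCofree d)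
    (h : i + 1 = d) {U : Submodule (𝒜 0)ᵐᵒᵖ (M.carrier d)} (s : Arrows V) {w : M.carrier d}
    (hw : w ∈ U) : hπ.dualElt hM h s w ∈ M.cogen U i := by
  refine hπ.mem_cogen_arrow h fun t => ?_
  rw [dualElt_act]
  split_ifs
  · exact U.smul_mem _ hw
  · exact zero_mem _

/-! ### The subcomplex generated by the terms in 𝒮 -/

section

variable (hπ : IsGradedFactor 𝒜 π) {I : ℤ ⥤ GrMod 𝒜} (hI : ∀ k, (I.obj k).IsCofree (-k))
  {n : ℕ} (m : ℤ)

/-- The subcomplex generated by the terms with index in `𝒮`, on cogenerators. -/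
inductive Gen : ∀ j : ℤ, (I.obj j).carrier (-j) → Prop
  | base (j : ℤ) (hj : j ∈ supportSet n m) (w : (I.obj j).carrier (-j)) : Gen j w
  | zero (j : ℤ) : Gen j 0
  | add (j : ℤ) (w w' : (I.obj j).carrier (-j)) : Gen j w → Gen j w' → Gen j (w + w')
  | smul (j : ℤ) (e : (𝒜 0)ᵐᵒᵖ) (w : (I.obj j).carrier (-j)) : Gen j w → Gen j (e • w)
  | theta {i j : ℤ} (h : i + 1 = j) (s : Arrows V) (w : (I.obj i).carrier (-i)) :
      Gen i w → Gen j (hπ.theta hI h s w)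

/-- `Gen`, as a family of `Λ₀`-submodules. -/
def genSubmodule (n : ℕ) (m j : ℤ) : Submodule (𝒜 0)ᵐᵒᵖ ((I.obj j).carrier (-j)) where
  carrier := {w | Gen (n := n) hπ hI m j w}
  zero_mem' := .zero j
  add_mem' := .add j _ _
  smul_mem' e _ := .smul j e _

/-- Induction on how w was generated. The surjectivity hypothesis is needed only at j ≡ m + 1; its
lift is admissible because the previous index belongs to 𝒮, where the subcomplex is everything. -/
theorem gen_lift (hb : ∀ {i j : ℤ} (h : i + 1 = j), (n : ℤ) ∣ i - m →
      Function.Surjective ((dmap I (show i ≤ j by omega)).app (-j))) {i j : ℤ} (h : i + 1 = j)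
    (hj : ¬ (n : ℤ) ∣ j - m) (w : (I.obj j).carrier (-j)) (hw : w ∈ genSubmodule hπ hI n m j) :
    ∃ x ∈ (I.obj i).cogen (genSubmodule hπ hI n m i) (-j),
      (dmap I (show i ≤ j by omega)).app (-j) x = w := by
  induction hw with
  | base j hjS w =>
    have hi : (n : ℤ) ∣ i - m := by
      obtain rfl : i = j - 1 := by omega
      exact (mem_supportSet_iff.1 hjS).resolve_left hj
    obtain ⟨x, rfl⟩ := hb h hi w
    refine ⟨x, fun k hk a => ?_, rfl⟩
    exact Gen.base i (mem_supportSet_of_dvd hi) _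
  | zero j => exact ⟨0, zero_mem _, map_zero _⟩
  | add j w w' _ _ ih ih' =>
    obtain ⟨x, hx, rfl⟩ := ih h hj
    obtain ⟨x', hx', rfl⟩ := ih' h hj
    exact ⟨x + x', add_mem hx hx', map_add _ _ _⟩
  | smul j e w _ ih =>
    obtain ⟨x, hx, rfl⟩ := ih h hj
    exact ⟨e • x, (I.obj i).isGrSubmodule_cogen _ _ _ _ hx, Hom.app_smul _ _ _ _⟩
  -- θ is by definition the differential of a dual element, which lies in the subcomplex together
  -- with its value w.
  | @theta i' j h' s w hw _ =>
    obtain rfl : i = i' := by omega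
    exact ⟨_, hπ.dualElt_mem_cogen (hI _) _ s hw, rfl⟩

variable [∀ a b : V, Finite (a ⟶ b)]

/-- A family of Λ₀-submodules stable under the θ_s cuts out a subcomplex, because the differential
in the cogenerating degree is a sum of values of the θ_s. -/
theorem dmap_mem_cogen {U : ∀ j, Submodule (𝒜 0)ᵐᵒᵖ ((I.obj j).carrier (-j))}
    (hU : ∀ {i j : ℤ} (h : i + 1 = j) (s : Arrows V), ∀ w ∈ U i, hπ.theta hI h s w ∈ U j)
    {j k : ℤ} (f : j ⟶ k) (i : ℤ) (x : (I.obj j).carrier i) (hx : x ∈ (I.obj j).cogen (U j) i) :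
    (I.map f).app i x ∈ (I.obj k).cogen (U k) i := by
  have := Fintype.ofFinite (Arrows V)
  suffices ∀ k (h : j ≤ k), (dmap I h).app i x ∈ (I.obj k).cogen (U k) i from this k f.le
  intro k h
  induction k, h using Int.leInduction with
  | base => rwa [dmap_self]
  | succ k h ih =>
    rw [← dmap_dmap I h (show k ≤ k + 1 by omega)]
    intro l hl a
    rw [← Hom.app_act, hπ.dmap_eq_sum hI rfl]
    refine sum_mem fun s _ => hU rfl s _ ?_
    rw [(I.obj k).act_act _ _ rfl (by omega)]
    exact ih _ _ _

theorem isLinearNComplex_of_injective (hπ : IsGradedFactor 𝒜 π) {n : ℕ} {I J : ℤ ⥤ GrMod 𝒜} (hJ : isLinearNComplex 𝒜 n J)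
    (hI : ∀ k, (I.obj k).IsCofree (-k)) (f : I ⟶ J)
    (hf : ∀ j i, Function.Injective ((f.app j).app i)) : isLinearNComplex 𝒜 n I := by
  refine hπ.isLinearNComplex_iff.2 ⟨fun k => ?_, hI⟩
  ext i x
  apply hf
  refine (app_dmap f (show k ≤ k + n by omega) x).trans ?_
  rw [zero_app, map_zero]
  exact congr_app (hJ.1 k) _ _

theorem isLinearNComplex_of_surjective (hπ : IsGradedFactor 𝒜 π) {n : ℕ} {I J : ℤ ⥤ GrMod 𝒜} (hI : isLinearNComplex 𝒜 n I)
    (hJ : ∀ k, (J.obj k).IsCofree (-k)) (f : I ⟶ J)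
    (hf : ∀ j i, Function.Surjective ((f.app j).app i)) : isLinearNComplex 𝒜 n J := by
  refine hπ.isLinearNComplex_iff.2 ⟨fun k => ?_, hJ⟩
  ext i x
  obtain ⟨x, rfl⟩ := hf k i x
  refine (app_dmap f (show k ≤ k + n by omega) x).symm.trans ?_
  rw [zero_app, show (dmap I (show k ≤ k + n by omega)).app i x = 0 from congr_app (hI.1 k) _ _,
    map_zero]

end

end IsGradedFactor

/-! ### The essential image of the restriction of the contraction functor -/

/-- The least number of steps leading from `j` to an element of `m + nℤ`. -/
def stepsTo (n : ℕ) (m j : ℤ) : ℕ := ((m - j) % n).toNat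

theorem stepsTo_eq_zero {n : ℕ} {m j : ℤ} (h : (n : ℤ) ∣ j - m) : stepsTo n m j = 0 := by
  rw [stepsTo, Int.emod_eq_zero_of_dvd (by rwa [dvd_sub_comm])]
  rfl

theorem stepsTo_eq_succ {n : ℕ} (hn : 2 ≤ n) {m i j : ℤ} (h : i + 1 = j) (hi : ¬ (n : ℤ) ∣ i - m) :
    stepsTo n m i = stepsTo n m j + 1 := by
  have hn0 : (n : ℤ) ≠ 0 := by omega
  have h1 := Int.emod_nonneg (m - i) hn0
  have h2 := Int.emod_lt_of_pos (m - i) (show (0 : ℤ) < n by omega)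
  have h3 : (m - i) % n ≠ 0 := fun h => hi (by rw [dvd_sub_comm]; exact Int.dvd_of_emod_eq_zero h)
  have h4 : (m - j) % n = (m - i) % n - 1 := by
    conv_lhs => rw [show m - j = (m - i) % n - 1 + n * ((m - i) / n) by
      linarith [Int.emod_add_mul_ediv (m - i) n]]
    rw [Int.add_mul_emod_self_left, Int.emod_eq_of_lt (by omega) (by omega)]
  rw [stepsTo, stepsTo, h4]
  omega

namespace IsGradedFactor

variable {V : Type v₁} [Quiver.{v₂} V] [Fintype V] {π : PathAlgebra K V →ₐ[K] Λ}

open PathAlgebra GrMod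

/-- The elements annihilated by all products of `l` duals of arrows. -/
def Kill (hπ : IsGradedFactor 𝒜 π) {I : ℤ ⥤ GrMod 𝒜} (hI : ∀ k, (I.obj k).IsCofree (-k)) :
    ℕ → ∀ j : ℤ, (I.obj j).carrier (-j) → Prop
  | 0, _, w => w = 0
  | l + 1, j, w => ∀ s, Kill hπ hI l (j + 1) (hπ.theta hI rfl s w)

section

variable (hπ : IsGradedFactor 𝒜 π) {I : ℤ ⥤ GrMod 𝒜} (hI : ∀ k, (I.obj k).IsCofree (-k))

theorem kill_zero (l : ℕ) (j : ℤ) : Kill hπ hI l j 0 := by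
  induction l generalizing j with
  | zero => exact rfl
  | succ l ih =>
    intro s
    rw [map_zero]
    exact ih _

theorem Kill.add {l : ℕ} {j : ℤ} {w w' : (I.obj j).carrier (-j)} (h : Kill hπ hI l j w)
    (h' : Kill hπ hI l j w') : Kill hπ hI l j (w + w') := by
  induction l generalizing j with
  | zero => exact (congrArg₂ _ h h').trans (add_zero 0)
  | succ l ih =>
    intro s
    rw [map_add]
    exact ih (h s) (h' s)

theorem Kill.smul {l : ℕ} {j : ℤ} {w : (I.obj j).carrier (-j)} (e : 𝒜 0) (h : Kill hπ hI l j w) :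
    Kill hπ hI l j (MulOpposite.op e • w) := by
  induction l generalizing j e with
  | zero => exact (congrArg _ h).trans (smul_zero (A := (I.obj j).carrier (-j)) (MulOpposite.op e))
  | succ l ih =>
    intro s
    obtain ⟨e', he'⟩ := hπ.theta_op_smul s e
    rw [he']
    exact ih e' (h s)

/-- The largest subcomplex vanishing on `𝒮`, on cogenerators. -/
def torsionSubmodule (n : ℕ) (m j : ℤ) : Submodule (𝒜 0)ᵐᵒᵖ ((I.obj j).carrier (-j)) where
  carrier := {w | (j ∈ supportSet n m → w = 0) ∧ Kill hπ hI (stepsTo n m j) j w}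
  zero_mem' := ⟨fun _ => rfl, kill_zero hπ hI _ _⟩
  add_mem' h h' := ⟨fun hj => by rw [h.1 hj, h'.1 hj, add_zero], h.2.add hπ hI h'.2⟩
  smul_mem' e _ h := ⟨fun hj => by rw [h.1 hj, smul_zero], h.2.smul hπ hI e.unop⟩

variable {n : ℕ} {m : ℤ}

/-- If i ∉ 𝒮 and i + 1 ∈ 𝒮, then i + 1 ≡ m. No steps remain there, so the annihilation condition
itself says that θ_s w = 0. -/
theorem theta_mem_torsionSubmodule (hn : 2 ≤ n) {i j : ℤ} (h : i + 1 = j) (s : Arrows V)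
    (w : (I.obj i).carrier (-i)) (hw : w ∈ torsionSubmodule hπ hI n m i) :
    hπ.theta hI h s w ∈ torsionSubmodule hπ hI n m j := by
  subst h
  by_cases hi : i ∈ supportSet n m
  · rw [hw.1 hi, map_zero]
    exact zero_mem _
  · have hk := hw.2
    have hi' : ¬ (n : ℤ) ∣ i - m := fun h => hi (mem_supportSet_of_dvd h)
    rw [stepsTo_eq_succ hn rfl hi'] at hk
    refine ⟨fun hj => ?_, hk s⟩
    have hk' := hk s
    rwa [stepsTo_eq_zero ((mem_supportSet_iff.1 hj).resolve_right (by rwa [add_sub_cancel_right]))]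
      at hk'

end

variable [∀ a b : V, Finite (a ⟶ b)]

/-- At an index in 𝒮 every cogenerator belongs to the generated part, so the subcomplex contains the
whole term. -/
theorem exists_generated_subobject (hπ : IsGradedFactor 𝒜 π) {n : ℕ} {m : ℤ}
    (I : LinearNComplex 𝒜 n) (hI : ∀ {i j : ℤ} (h : i + 1 = j), (n : ℤ) ∣ i - m →
      Function.Surjective ((dmap I.obj (show i ≤ j by omega)).app (-j))) :
    ∃ (J : LinearNComplex 𝒜 n) (f : J ⟶ I), (∀ j ∈ supportSet n m, IsIso (f.hom.app j)) ∧
      ∀ {i j : ℤ} (h : i + 1 = j), ¬ (n : ℤ) ∣ j - m →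
        Function.Surjective ((dmap J.obj (show i ≤ j by omega)).app (-j)) := by
  have hI' := hπ.isCofree_obj I
  let N (j : ℤ) := (I.obj.obj j).cogen (genSubmodule hπ hI' n m j)
  have hN (j : ℤ) : (I.obj.obj j).IsGrSubmodule (N j) := (I.obj.obj j).isGrSubmodule_cogen _
  have hN' : ∀ {j k : ℤ} (f : j ⟶ k), ∀ i, ∀ x ∈ N j i, (I.obj.map f).app i x ∈ N k i :=
    hπ.dmap_mem_cogen hI' (fun h s w hw => Gen.theta h s w hw)
  let J : LinearNComplex 𝒜 n := ⟨subcomplex I.obj N hN hN', hπ.isLinearNComplex_of_injective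
    I.property (fun k => (hI' k).sub_cogen _) (subcomplexι I.obj N hN hN')
    fun _ _ => Subtype.val_injective⟩
  refine ⟨J, ObjectProperty.homMk (subcomplexι I.obj N hN hN'), fun j hj => ?_,
    fun {i j} h hj w => ?_⟩
  · refine (GrMod.isIso_iff_bijective _).2 fun i => ⟨Subtype.val_injective, fun x => ⟨⟨x, ?_⟩, rfl⟩⟩
    exact fun k hk a => Gen.base j hj _
  · obtain ⟨x, hx, hxw⟩ := gen_lift hπ hI' m hI h hj w.1 (mem_cogen_self.1 w.2)
    exact ⟨⟨x, hx⟩, Subtype.ext hxw⟩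

/-- If j ∉ 𝒮 and all θ_s w are torsion, then w is torsion, as j is one step further from m + nℤ than
j + 1. Surjectivity descends to quotients. -/
theorem exists_torsionFree_quotient (hπ : IsGradedFactor 𝒜 π) {n : ℕ} (hn : 2 ≤ n) {m : ℤ}
    (I : LinearNComplex 𝒜 n) (hI : ∀ {i j : ℤ} (h : i + 1 = j), ¬ (n : ℤ) ∣ j - m →
      Function.Surjective ((dmap I.obj (show i ≤ j by omega)).app (-j))) :
    ∃ (J : LinearNComplex 𝒜 n) (f : I ⟶ J), (∀ j ∈ supportSet n m, IsIso (f.hom.app j)) ∧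
      isGStar 𝒜 n m J := by
  have hI' := hπ.isCofree_obj I
  have := hπ.isSemisimpleRing
  let N (j : ℤ) := (I.obj.obj j).cogen (torsionSubmodule hπ hI' n m j)
  have hN (j : ℤ) : (I.obj.obj j).IsGrSubmodule (N j) := (I.obj.obj j).isGrSubmodule_cogen _
  have hN' : ∀ {j k : ℤ} (f : j ⟶ k), ∀ i, ∀ x ∈ N j i, (I.obj.map f).app i x ∈ N k i :=
    hπ.dmap_mem_cogen hI' (hπ.theta_mem_torsionSubmodule hI' hn)
  let g := quotcomplexπ I.obj N hN hN'
  have hg (j i : ℤ) : Function.Surjective ((g.app j).app i) := quotπ_surjective _ _ (hN j) i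
  have hg0 (j : ℤ) {i : ℤ} (x : (I.obj.obj j).carrier i) : (g.app j).app i x = 0 ↔ x ∈ N j i :=
    quotπ_eq_zero_iff _ _ (hN j) x
  have hJ (j : ℤ) : ((quotcomplex I.obj N hN hN').obj j).IsCofree (-j) := (hI' j).quot_cogen _
  refine ⟨⟨_, hπ.isLinearNComplex_of_surjective I.property hJ g hg⟩, ObjectProperty.homMk g,
    fun j hj => ?_, fun _ => ⟨fun j hj => ?_, fun j hj => ?_⟩⟩
  · refine (GrMod.isIso_iff_bijective _).2 fun i => ⟨?_, hg j i⟩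
    refine (injective_iff_map_eq_zero _).2 fun x hx => ?_
    exact (hI' j).eq_zero (add_sub_cancel i (-j)) x fun a => (((hg0 j x).1 hx) _ _ a).1 hj
  · rw [hπ.hom_dual_eq_zero_iff hJ]
    intro w hw
    obtain ⟨w, rfl⟩ := hg j _ w
    refine (hg0 j w).2 (mem_cogen_self.2 ⟨fun h => absurd h hj, ?_⟩)
    rw [stepsTo_eq_succ hn rfl (not_dvd_of_not_mem hj)]
    intro s
    have hs := hw s
    rw [← hπ.app_theta hI' hJ g] at hs
    exact (mem_cogen_self.1 ((hg0 _ _).1 hs)).2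
  · refine (hπ.socleLERange_iff (hJ j) _).2 fun w => ?_
    obtain ⟨w, rfl⟩ := hg j _ w
    obtain ⟨x, rfl⟩ := hI (sub_add_cancel j 1) (fun h => hj (modEq_iff_dvd_sub.2 h)) w
    exact ⟨(g.app (j - 1)).app (-j) x, (app_dmap g _ x).symm⟩

end IsGradedFactor

/-! ### Determination of the essential image -/

theorem nonempty_contraction_iso {n : ℕ} (hn : 2 ≤ n) {m : ℤ} {I J : LinearNComplex 𝒜 n}
    (f : I ⟶ J) (hf : ∀ j ∈ supportSet n m, IsIso (f.hom.app j)) :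
    Nonempty ((contraction 𝒜 hn m).obj I ≅ (contraction 𝒜 hn m).obj J) := by
  have : ∀ k, IsIso (((contraction 𝒜 hn m).map f).f k) := fun k =>
    hf _ (contractionIndex_mem_supportSet n m k)
  have := HomologicalComplex.Hom.isIso_of_components ((contraction 𝒜 hn m).map f)
  exact ⟨asIso ((contraction 𝒜 hn m).map f)⟩

theorem contraction_d {n : ℕ} (hn : 2 ≤ n) (m : ℤ) (I : LinearNComplex 𝒜 n) {i j : ℤ}
    (h : i + 1 = j) : ((contraction 𝒜 hn m).obj I).d i j =
      IsGradedFactor.dmap I.obj (contractionIndex_le hn m h) := dif_pos h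

namespace IsGradedFactor

variable {V : Type v₁} [Quiver.{v₂} V] [Fintype V] {π : PathAlgebra K V →ₐ[K] Λ}
variable [∀ a b : V, Finite (a ⟶ b)]

open PathAlgebra GrMod

/-- The even differential of the contraction is the single differential leaving I^{m+kn};
surjectivity in the cogenerating degree is carried along the isomorphism. -/
theorem socleLERange_contraction_iff (hπ : IsGradedFactor 𝒜 π) {n : ℕ} (hn : 2 ≤ n) (m : ℤ)
    {C : CochainComplex (GrMod 𝒜) ℤ} {I : LinearNComplex 𝒜 n}
    (e : (contraction 𝒜 hn m).obj I ≅ C) (k : ℤ) {i j : ℤ} (hi : m + k * n = i) (h : i + 1 = j) :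
    SocleLERange (C.d (2 * k) (2 * k + 1)) ↔
      Function.Surjective ((dmap I.obj (show i ≤ j by omega)).app (-j)) := by
  have h1 := contractionIndex_even n m k
  have h2 := contractionIndex_odd n m k
  have key : Function.Surjective ((dmap I.obj (show i ≤ j by omega)).app (-j)) ↔
      Function.Surjective ((((contraction 𝒜 hn m).obj I).d (2 * k) (2 * k + 1)).app
        (-contractionIndex n m (2 * k + 1))) := by
    rw [contraction_d hn m I rfl]
    obtain rfl : contractionIndex n m (2 * k) = i := h1.trans hi
    obtain rfl : contractionIndex n m (2 * k + 1) = j := by omega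
    rfl
  have hC : (C.X (2 * k + 1)).IsCofree (-contractionIndex n m (2 * k + 1)) :=
    (hπ.isCofree_obj I _).of_iso ((HomologicalComplex.eval (GrMod 𝒜) _ (2 * k + 1)).mapIso e)
  have hb (l d : ℤ) : Function.Bijective ((e.hom.f l).app d) :=
    (GrMod.isIso_iff_bijective (e.hom.f l)).1 inferInstance d
  have hc (d : ℤ) := congr_app (e.hom.comm (2 * k) (2 * k + 1)) d
  rw [hπ.socleLERange_iff hC, key]
  refine ⟨fun h' y => ?_, fun h' y => ?_⟩
  · obtain ⟨x, hx⟩ := h' ((e.hom.f _).app _ y)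
    obtain ⟨x, rfl⟩ := (hb _ _).2 x
    exact ⟨x, (hb _ _).1 ((hc _ x).symm.trans hx)⟩
  · obtain ⟨y, rfl⟩ := (hb _ _).2 y
    obtain ⟨x, rfl⟩ := h' y
    exact ⟨(e.hom.f _).app _ x, hc _ x⟩

theorem essImage_iff (hπ : IsGradedFactor 𝒜 π) {n : ℕ} (hn : 2 ≤ n) (m : ℤ)
    (C : CochainComplex (GrMod 𝒜) ℤ) :
    ((isGStar 𝒜 n m).ι ⋙ contraction 𝒜 hn m).essImage C ↔
      (contraction 𝒜 hn m).essImage C ∧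
      (∀ j : ℤ, (C.X j).IsAlmostInjective ∧
        (C.X j).IsCogeneratedInDegree (-contractionIndex n m j)) ∧
      (2 < n → ∀ j : ℤ, GrMod.SocleLERange (C.d (2 * j) (2 * j + 1))) := by
  constructor
  · rintro ⟨I, ⟨e⟩⟩
    refine ⟨⟨I.obj, ⟨e⟩⟩, fun j => ?_, fun h k => ?_⟩
    · exact hπ.isCofree_iff.2 ((hπ.isCofree_obj I.obj _).of_iso
        ((HomologicalComplex.eval (GrMod 𝒜) _ j).mapIso e))
    · refine (hπ.socleLERange_contraction_iff hn m e k rfl rfl).2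
        (hπ.surjective_of_isGStar h I.property rfl ?_)
      rw [show m + k * n + 1 - m = 1 + n * k by ring, Int.dvd_add_left (dvd_mul_right _ _)]
      exact fun h' => absurd (Int.le_of_dvd one_pos h') (by omega)
  · rintro ⟨⟨I, ⟨e⟩⟩, -, h⟩
    -- For n = 2 the lift already belongs to 𝒢*; for n > 2 it is replaced by a quotient of a
    -- subcomplex with the same contraction up to isomorphism.
    rcases hn.eq_or_lt with rfl | hn'
    · exact ⟨⟨I, fun h => absurd h (lt_irrefl 2)⟩, ⟨e⟩⟩
    obtain ⟨J, f, hf, hJ⟩ := hπ.exists_generated_subobject (m := m) I fun {i j} hij ⟨k, hk⟩ =>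
      (hπ.socleLERange_contraction_iff hn m e k (by rw [mul_comm]; omega) hij).1 (h hn' k)
    obtain ⟨L, g, hg, hL⟩ := hπ.exists_torsionFree_quotient hn J hJ
    obtain ⟨e₁⟩ := nonempty_contraction_iso hn f hf
    obtain ⟨e₂⟩ := nonempty_contraction_iso hn g hg
    exact ⟨⟨L, hL⟩, ⟨e₂.symm ≪≫ e₁ ≪≫ e⟩⟩

end IsGradedFactor

/-! ### Relations of high degree -/

namespace PathAlgebra

variable {V : Type v₁} [Quiver.{v₂} V]

theorem concat_eq_sum {a b c : V} (f : Quiver.Path a b →₀ K) (g : Quiver.Path b c →₀ K) :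
    concat f g = f.sum fun p r => g.sum fun q s => Finsupp.single (p.comp q) (r * s) := by
  conv_lhs => rw [← f.sum_single, ← g.sum_single]
  simp only [Finsupp.sum, map_sum, LinearMap.sum_apply, concat_single]
  exact Finset.sum_comm

theorem concat_apply_eq_zero {a b c : V} {f : Quiver.Path a b →₀ K} {g : Quiver.Path b c →₀ K}
    {r : Quiver.Path a c} (h : ∀ p q, p.comp q = r → f p = 0 ∨ g q = 0) : concat f g r = 0 := by
  rw [concat_eq_sum, Finsupp.sum_apply]
  refine Finset.sum_eq_zero fun p hp => ?_
  change (g.sum fun q s => Finsupp.single (p.comp q) (f p * s)) r = 0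
  rw [Finsupp.sum_apply]
  refine Finset.sum_eq_zero fun q hq => Finsupp.single_eq_of_ne fun hpq => ?_
  rcases h p q hpq.symm with h | h
  · exact Finsupp.mem_support_iff.1 hp h
  · exact Finsupp.mem_support_iff.1 hq h

variable [Fintype V]

/-- Elements without coefficients on paths of length < n form an ideal, since a factor of a short
path is short; this ideal contains the generators. -/
theorem coeff_eq_zero_of_hasRelationsOfDegreeGE {π : PathAlgebra K V →ₐ[K] Λ} {n : ℕ}
    (hn : HasRelationsOfDegreeGE π n) {x : PathAlgebra K V} (hx : π x = 0) {a b : V}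
    (p : Quiver.Path a b) (hp : p.length < n) : x.coeff a b p = 0 := by
  rw [← TwoSidedIdeal.mem_ker, hn] at hx
  induction hx using TwoSidedIdeal.span_induction generalizing a b p with
  | mem x hx =>
    obtain ⟨-, k, hk, hxk⟩ := hx
    by_contra h
    have := hxk a b p h
    omega
  | zero => rfl
  | add x y _ _ hx hy =>
    rw [coeff_add, Finsupp.add_apply, hx p hp, hy p hp, add_zero]
  | neg x _ hx => exact neg_eq_zero.2 (hx p hp)
  | left_absorb y x _ hx =>
    rw [coeff_mul, Finsupp.finsetSum_apply]
    refine Finset.sum_eq_zero fun c _ => concat_apply_eq_zero fun q r hqr => Or.inr (hx r ?_)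
    rw [← hqr, Quiver.Path.length_comp] at hp
    omega
  | right_absorb y x _ hx =>
    rw [coeff_mul, Finsupp.finsetSum_apply]
    refine Finset.sum_eq_zero fun c _ => concat_apply_eq_zero fun q r hqr => Or.inl (hx q ?_)
    rw [← hqr, Quiver.Path.length_comp] at hp
    omega

theorem eq_zero_of_hasRelationsOfDegreeGE {π : PathAlgebra K V →ₐ[K] Λ} {n : ℕ}
    (hn : HasRelationsOfDegreeGE π n) {k : ℕ} (hk : k < n) {x : PathAlgebra K V}
    (hx : x ∈ degreePart K V k) (h : π x = 0) : x = 0 := by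
  ext1
  funext a b
  ext p
  by_contra hp
  exact hp (coeff_eq_zero_of_hasRelationsOfDegreeGE hn h p ((hx a b p hp).trans_lt hk))

end PathAlgebra

/-! ### The restriction of the contraction functor is full -/

namespace IsGradedFactor

variable {V : Type v₁} [Quiver.{v₂} V] [Fintype V] {π : PathAlgebra K V →ₐ[K] Λ}

open PathAlgebra GrMod

theorem isDual_app (hπ : IsGradedFactor 𝒜 π) {M N : GrMod 𝒜} (f : M ⟶ N) {i k d : ℤ}
    (h : i + k = d) {a b : V} {p : Quiver.Path a b} {w : M.carrier d} {x : M.carrier i}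
    (hx : hπ.IsDual h p w x) : hπ.IsDual h p (f.app d w) (f.app i x) := by
  intro c e q hq
  rw [← f.app_act, hx q hq]
  split_ifs
  · rw [Hom.app_smul]
  · rw [map_zero]

theorem eq_vertex_smul_of_isDual (hπ : IsGradedFactor 𝒜 π) {M : GrMod 𝒜} {i : ℤ} {b : V}
    {w x : M.carrier i} (h : hπ.IsDual (add_zero i) (Quiver.Path.nil : Quiver.Path b b) w x) :
    x = MulOpposite.op (hπ.vertex b) • w := by
  rw [hπ.eq_sum_vertex_smul x, Finset.sum_eq_single b]
  · exact (h Quiver.Path.nil (by simp)).trans (if_pos rfl)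
  · intro c _ hc
    refine (h Quiver.Path.nil (by simp)).trans (if_neg fun h => hc ?_)
    exact congrArg Sigma.fst h
  · simp

theorem mul_vertex (hπ : IsGradedFactor 𝒜 π) (e : 𝒜 0) (b : V) :
    e * hπ.vertex b = hπ.vertex b * e := by
  obtain ⟨c, rfl⟩ := hπ.vertexHom_surjective e
  rw [vertexHom_mul_vertex, vertex_mul_vertexHom]

theorem vertex_smul_smul (hπ : IsGradedFactor 𝒜 π) {M : GrMod 𝒜} {i : ℤ} (e : 𝒜 0) (b : V)
    (w : M.carrier i) : MulOpposite.op (hπ.vertex b) • MulOpposite.op e • w =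
      MulOpposite.op e • MulOpposite.op (hπ.vertex b) • w := by
  rw [smul_smul, smul_smul, ← MulOpposite.op_mul, ← MulOpposite.op_mul, mul_vertex]

/-- One differential strips the last arrow α off the path and applies θ_α to the value. Iterated,
this turns composite differentials into products of operators θ along paths. -/
theorem isDual_dmap (hπ : IsGradedFactor 𝒜 π) [∀ a b : V, Finite (a ⟶ b)] {I : ℤ ⥤ GrMod 𝒜}
    (hI : ∀ k, (I.obj k).IsCofree (-k)) {i j l k : ℤ} (h : i + 1 = j) (hl : l + k = -j)
    (hl' : l + (k + 1) = -i) {a b c : V} {p : Quiver.Path a b} {α : b ⟶ c}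
    {w : (I.obj i).carrier (-i)} {x : (I.obj i).carrier l} (hx : hπ.IsDual hl' (p.cons α) w x) :
    hπ.IsDual hl p (hπ.theta hI h ⟨b, c, α⟩ w) ((dmap I (show i ≤ j by omega)).app l x) := by
  classical
  have := Fintype.ofFinite (Arrows V)
  intro d e q hq
  -- Multiplying x by a path q and then by an arrow s gives a nonzero value only if q followed by s
  -- is the path p followed by α.
  have key (s : Arrows V) : (I.obj i).act (show -j + 1 = -i by omega)
      ((I.obj i).act hl x (hπ.path q hq)) (hπ.arrowElt s) =
      if (⟨d, e, q⟩ : Σ c e : V, Quiver.Path c e) = ⟨a, b, p⟩ ∧ s = ⟨b, c, α⟩ then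
        MulOpposite.op (hπ.vertex c) • w else 0 := by
    obtain ⟨e', f, β⟩ := s
    rw [(I.obj i).act_act hl _ rfl hl']
    by_cases he : e = e'
    · subst he
      have hqβ : ((q.cons β).length : ℤ) = k + 1 := by simp [hq]
      have : (⟨hπ.path q hq * hπ.arrowElt ⟨e, f, β⟩, SetLike.GradedMul.mul_mem
          (hπ.path q hq).2 (hπ.arrowElt ⟨e, f, β⟩).2⟩ : 𝒜 (k + 1)) = hπ.path (q.cons β) hqβ :=
        Subtype.ext (hπ.path_mul_path q β.toPath hq _ hqβ)
      rw [this, hx]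
      congr 1
      refine propext ⟨fun h => ?_, ?_⟩
      · simp only [Sigma.mk.injEq] at h
        obtain ⟨rfl, h⟩ := h
        obtain ⟨rfl, h⟩ := Sigma.mk.inj_iff.1 (eq_of_heq h)
        have h := eq_of_heq h
        obtain rfl := Quiver.Path.obj_eq_of_cons_eq_cons h
        have h1 := eq_of_heq (Quiver.Path.heq_of_cons_eq_cons h)
        have h2 := eq_of_heq (Quiver.Path.hom_heq_of_cons_eq_cons h)
        rw [h1, h2]
        exact ⟨rfl, rfl⟩
      · rintro ⟨h1, h2⟩
        cases h1
        cases h2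
        rfl
    · have : (⟨hπ.path q hq * hπ.arrowElt ⟨e', f, β⟩, SetLike.GradedMul.mul_mem
          (hπ.path q hq).2 (hπ.arrowElt ⟨e', f, β⟩).2⟩ : 𝒜 (k + 1)) = 0 :=
        Subtype.ext (hπ.path_mul_path_of_ne q β.toPath hq _ he)
      rw [this, act_zero, if_neg]
      rintro ⟨h1, h2⟩
      cases h1
      cases h2
      exact he rfl
  rw [← Hom.app_act, hπ.dmap_eq_sum hI h, hπ.vertex_smul_theta hI h ⟨b, c, α⟩]
  simp only [key]
  by_cases hq' : (⟨d, e, q⟩ : Σ c e : V, Quiver.Path c e) = ⟨a, b, p⟩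
  · rw [if_pos hq', Finset.sum_eq_single ⟨b, c, α⟩, if_pos ⟨hq', rfl⟩]
    · exact theta_vertex_smul hπ hI h ⟨b, c, α⟩ w
    · intro s _ hs
      rw [if_neg fun h => hs h.2, map_zero]
    · simp
  · rw [if_neg hq']
    refine Finset.sum_eq_zero fun s _ => ?_
    rw [if_neg fun h => hq' h.1, map_zero]

section

variable (hπ : IsGradedFactor 𝒜 π) {I J : ℤ ⥤ GrMod 𝒜} (hI : ∀ k, (I.obj k).IsCofree (-k))
  (hJ : ∀ k, (J.obj k).IsCofree (-k)) {n : ℕ} {m : ℤ}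
  (φ : ∀ j ∈ supportSet n m, I.obj j ⟶ J.obj j)

/-- The morphisms `φ` relate the images of `w` and `w'` under the product of the duals of the arrows
of a path. -/
def PathRel {a : V} : ∀ {b : V} (_ : Quiver.Path a b) (i : ℤ) (_ : (I.obj i).carrier (-i))
    (_ : (J.obj i).carrier (-i)), Prop
  | _, .nil, i, w, w' => ∀ hi : i ∈ supportSet n m,
    (φ i hi).app (-i) (MulOpposite.op (hπ.vertex a) • w) = MulOpposite.op (hπ.vertex a) • w'
  | _, .cons p α, i, w, w' =>
    PathRel p (i + 1) (hπ.theta hI rfl ⟨_, _, α⟩ w) (hπ.theta hJ rfl ⟨_, _, α⟩ w')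

/-- The relation generated by the morphisms `φ`, compatible with the duals of the arrows. -/
inductive Gam : ∀ j : ℤ, (I.obj j).carrier (-j) → (J.obj j).carrier (-j) → Prop
  | base (j : ℤ) (hj : j ∈ supportSet n m) (w : (I.obj j).carrier (-j)) :
      Gam j w ((φ j hj).app (-j) w)
  | zero (j : ℤ) : Gam j 0 0
  | add (j : ℤ) (w v : (I.obj j).carrier (-j)) (w' v' : (J.obj j).carrier (-j)) :
      Gam j w w' → Gam j v v' → Gam j (w + v) (w' + v')
  | smul (j : ℤ) (e : 𝒜 0) (w : (I.obj j).carrier (-j)) (w' : (J.obj j).carrier (-j)) :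
      Gam j w w' → Gam j (MulOpposite.op e • w) (MulOpposite.op e • w')
  | theta {i j : ℤ} (h : i + 1 = j) (hj : j ∉ supportSet n m) (s : Arrows V)
      (w : (I.obj i).carrier (-i)) (w' : (J.obj i).carrier (-i)) :
      Gam i w w' → Gam j (hπ.theta hI h s w) (hπ.theta hJ h s w')

theorem pathRel_zero {a b : V} (p : Quiver.Path a b) (i : ℤ) : PathRel hπ hI hJ φ p i 0 0 := by
  induction p generalizing i with
  | nil =>
    intro hi
    rw [smul_zero, smul_zero, map_zero]
  | cons p α ih =>
    rw [PathRel, map_zero, map_zero]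
    exact ih _

variable {φ}

theorem PathRel.add {a b : V} {p : Quiver.Path a b} {i : ℤ} {w v : (I.obj i).carrier (-i)}
    {w' v' : (J.obj i).carrier (-i)} (h : PathRel hπ hI hJ φ p i w w')
    (h' : PathRel hπ hI hJ φ p i v v') : PathRel hπ hI hJ φ p i (w + v) (w' + v') := by
  induction p generalizing i with
  | nil =>
    intro hi
    rw [smul_add, smul_add, map_add, h hi, h' hi]
  | cons p α ih =>
    rw [PathRel, map_add, map_add]
    exact ih h h'

theorem PathRel.smul {a b : V} {p : Quiver.Path a b} {i : ℤ} {w : (I.obj i).carrier (-i)}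
    {w' : (J.obj i).carrier (-i)} (e : 𝒜 0) (h : PathRel hπ hI hJ φ p i w w') :
    PathRel hπ hI hJ φ p i (MulOpposite.op e • w) (MulOpposite.op e • w') := by
  induction p generalizing i e with
  | nil =>
    intro hi
    rw [vertex_smul_smul, vertex_smul_smul, Hom.app_smul, h hi]
  | @cons b c p α ih =>
    obtain ⟨e', he'⟩ := hπ.theta_op_smul ⟨b, c, α⟩ e
    rw [PathRel, he', he']
    exact ih e' h

/-- The product of operators along a path sees only the components at the target of the path. -/
theorem PathRel.congr {a b : V} {p : Quiver.Path a b} {i : ℤ} {w v : (I.obj i).carrier (-i)}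
    {w' v' : (J.obj i).carrier (-i)} (h : PathRel hπ hI hJ φ p i w w')
    (hw : MulOpposite.op (hπ.vertex b) • w = MulOpposite.op (hπ.vertex b) • v)
    (hw' : MulOpposite.op (hπ.vertex b) • w' = MulOpposite.op (hπ.vertex b) • v') :
    PathRel hπ hI hJ φ p i v v' := by
  cases p with
  | nil =>
    intro hi
    rw [← hw, ← hw', h hi]
  | @cons b c p α =>
    rw [PathRel, ← theta_vertex_smul, ← hw, ← hπ.theta_vertex_smul hJ, ← hw', theta_vertex_smul,
      theta_vertex_smul]
    exact h

/-- If s starts where p ends, this is the relation along p followed by s. Otherwise θ_s w and θ_s w'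
have zero component at the end of p and the relation is trivial. -/
theorem PathRel.theta {a b : V} {p : Quiver.Path a b} {i : ℤ} {w : (I.obj i).carrier (-i)}
    {w' : (J.obj i).carrier (-i)} (s : Arrows V)
    (h : ∀ q : Quiver.Path a s.2.1, q.length = p.length + 1 → PathRel hπ hI hJ φ q i w w') :
    PathRel hπ hI hJ φ p (i + 1) (hπ.theta hI rfl s w) (hπ.theta hJ rfl s w') := by
  obtain ⟨b', c, α⟩ := s
  by_cases hb : b' = b
  · subst hb
    exact h (p.cons α) rfl
  · refine (pathRel_zero hπ hI hJ φ p (i + 1)).congr hπ hI hJ ?_ ?_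
    · rw [smul_zero, hπ.vertex_smul_theta_of_ne hI rfl ⟨b', c, α⟩ w hb]
    · rw [smul_zero, hπ.vertex_smul_theta_of_ne hJ rfl ⟨b', c, α⟩ w' hb]

/-- Stripping all arrows of p by differentials leaves the image of the dual element under the
composite differential. Compatibility of φ with that composite on dual elements is thus
compatibility along p. -/
theorem pathRel_of_isDual [∀ a b : V, Finite (a ⟶ b)] {a b : V} {p : Quiver.Path a b} {i j k : ℤ}
    (hk : (p.length : ℤ) = k) (hij : i + k = j) {w : (I.obj i).carrier (-i)}
    {w' : (J.obj i).carrier (-i)} {x : (I.obj i).carrier (-j)} {x' : (J.obj i).carrier (-j)}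
    (hx : hπ.IsDual (show -j + k = -i by omega) p w x)
    (hx' : hπ.IsDual (show -j + k = -i by omega) p w' x')
    (h : ∀ hj : j ∈ supportSet n m, (φ j hj).app (-j) ((dmap I (show i ≤ j by omega)).app (-j) x) =
      (dmap J (show i ≤ j by omega)).app (-j) x') : PathRel hπ hI hJ φ p i w w' := by
  induction p generalizing i k with
  | nil =>
    obtain rfl : k = 0 := by simpa using hk.symm
    obtain rfl : i = j := by omega
    intro hi
    have := h hi
    rw [dmap_self, dmap_self, hπ.eq_vertex_smul_of_isDual hx, hπ.eq_vertex_smul_of_isDual hx']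
      at this
    exact this
  | cons p α ih =>
    obtain rfl : (p.length : ℤ) + 1 = k := by simpa using hk
    refine ih rfl (by omega) (hπ.isDual_dmap hI rfl _ (by omega) hx)
      (hπ.isDual_dmap hJ rfl _ (by omega) hx') fun hj => ?_
    rw [dmap_dmap, dmap_dmap]
    exact h hj

end

end IsGradedFactor

/-! ### Extending a morphism of contractions to the missing terms -/

theorem stepsTo_eq_sub_one {n : ℕ} (hn : 2 ≤ n) {m j : ℤ} (h : (n : ℤ) ∣ j - 1 - m) :
    stepsTo n m j = n - 1 := by
  obtain ⟨k, hk⟩ := h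
  rw [stepsTo, show m - j = n - 1 + n * (-k - 1) by linarith, Int.add_mul_emod_self_left,
    Int.emod_eq_of_lt (by omega) (by omega)]
  omega

theorem strictMono_contractionIndex {n : ℕ} (hn : 2 ≤ n) (m : ℤ) :
    StrictMono (contractionIndex n m) := by
  refine strictMono_int_of_lt_succ fun k => ?_
  obtain ⟨l, rfl | rfl⟩ := Int.even_or_odd' k
  · rw [contractionIndex_even, contractionIndex_odd]
    omega
  · rw [show 2 * l + 1 + 1 = 2 * (l + 1) by ring, contractionIndex_even, contractionIndex_odd,
      add_mul]
    omega

namespace IsGradedFactor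

variable {V : Type v₁} [Quiver.{v₂} V] [Fintype V] {π : PathAlgebra K V →ₐ[K] Λ}

open PathAlgebra GrMod

section

variable (hπ : IsGradedFactor 𝒜 π) {I J : ℤ ⥤ GrMod 𝒜} (hI : ∀ k, (I.obj k).IsCofree (-k))
  (hJ : ∀ k, (J.obj k).IsCofree (-k)) {n : ℕ} {m : ℤ}
  {φ : ∀ j ∈ supportSet n m, I.obj j ⟶ J.obj j}

theorem Gam.sub {j : ℤ} {w v : (I.obj j).carrier (-j)} {w' v' : (J.obj j).carrier (-j)}
    (h : Gam hπ hI hJ φ j w w') (h' : Gam hπ hI hJ φ j v v') :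
    Gam hπ hI hJ φ j (w - v) (w' - v') := by
  have := h.add _ _ _ _ _ (h'.smul _ (-1) _ _)
  rw [MulOpposite.op_neg, MulOpposite.op_one] at this
  rwa [neg_smul (1 : (𝒜 0)ᵐᵒᵖ) v, neg_smul (1 : (𝒜 0)ᵐᵒᵖ) v', one_smul, one_smul,
    ← sub_eq_add_neg, ← sub_eq_add_neg] at this

/-- The generating rule for θ never ends at an index in 𝒮, so there the relation is just the graph
of φ. -/
theorem Gam.eq_app {j : ℤ} {w : (I.obj j).carrier (-j)} {w' : (J.obj j).carrier (-j)}
    (h : Gam hπ hI hJ φ j w w') (hj : j ∈ supportSet n m) : w' = (φ j hj).app (-j) w := by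
  induction h with
  | base j _ w => rfl
  | zero j => rw [map_zero]
  | add j w v w' v' _ _ h h' => rw [map_add, h hj, h' hj]
  | smul j e w w' _ h => rw [Hom.app_smul, h hj]
  | theta _ hj' => exact absurd hj hj'

/-- Outside 𝒮 every element is a sum of values of the θ_s at elements of the preceding term, which
have partners by induction. -/
theorem exists_gam [∀ a b : V, Finite (a ⟶ b)] (hn : 2 ≤ n)
    (hIs : ∀ {i j : ℤ} (h : i + 1 = j), j ∉ supportSet n m →
      Function.Surjective ((dmap I (show i ≤ j by omega)).app (-j)))
    (j : ℤ) (w : (I.obj j).carrier (-j)) : ∃ w', Gam hπ hI hJ φ j w w' := by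
  have := Fintype.ofFinite (Arrows V)
  induction j using supportSet_induction hn m with
  | mem j hj => exact ⟨_, .base j hj w⟩
  | succ j hj ih =>
    obtain ⟨x, rfl⟩ := hIs rfl hj w
    rw [hπ.dmap_eq_sum hI rfl]
    refine Finset.sum_induction _ (fun v => ∃ v', Gam hπ hI hJ φ (j + 1) v v') ?_ ⟨0, .zero _⟩ ?_
    · rintro v w ⟨v', hv⟩ ⟨w', hw⟩
      exact ⟨_, hv.add _ _ _ _ _ hw⟩
    · intro s _
      obtain ⟨w', hw⟩ := ih ((I.obj j).act (by omega) x (hπ.arrowElt s))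
      exact ⟨_, hw.theta rfl hj s _ _⟩

/-- On a generator at m + kn + 1 the paths have length n - 1 < n, so they have dual elements, and φ
commutes with the long differential starting there. Every later step trades one arrow of the path
for one operator θ. -/
theorem Gam.pathRel [∀ a b : V, Finite (a ⟶ b)] (hn : 2 ≤ n)
    (hinj : ∀ k < n, ∀ x ∈ degreePart K V k, π x = 0 → x = 0)
    (hφ : ∀ {i j : ℤ} (h : i ≤ j) (hi : i ∈ supportSet n m) (hj : j ∈ supportSet n m),
      (∃ k, contractionIndex n m k = i ∧ contractionIndex n m (k + 1) = j) →
      ∀ l x, (φ j hj).app l ((dmap I h).app l x) = (dmap J h).app l ((φ i hi).app l x))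
    {j : ℤ} {w : (I.obj j).carrier (-j)} {w' : (J.obj j).carrier (-j)}
    (h : Gam hπ hI hJ φ j w w') (hj : ¬ (n : ℤ) ∣ j - m) {a b : V} (p : Quiver.Path a b)
    (hp : p.length = stepsTo n m j) : PathRel hπ hI hJ φ p j w w' := by
  induction h generalizing b with
  | base j hjS w =>
    have hj' := (mem_supportSet_iff.1 hjS).resolve_left hj
    rw [stepsTo_eq_sub_one hn hj'] at hp
    obtain ⟨x, hx⟩ := hπ.exists_isDual (hI j)
      (show -(j + (p.length : ℤ)) + (p.length : ℤ) = -j by omega) p rfl (hinj _ (by omega)) w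
    refine hπ.pathRel_of_isDual hI hJ rfl rfl hx (hπ.isDual_app (φ j hjS) _ hx)
      fun hk => hφ _ hjS hk ?_ _ _
    obtain ⟨k, hk⟩ := hj'
    rw [mul_comm] at hk
    -- The long differentials are the odd ones of the contraction: they go from m + kn + 1 to m + (k
    -- + 1)n.
    refine ⟨2 * k + 1, by rw [contractionIndex_odd]; omega, ?_⟩
    rw [show 2 * k + 1 + 1 = 2 * (k + 1) by ring, contractionIndex_even, add_mul]
    omega
  | zero j => exact hπ.pathRel_zero hI hJ φ p j
  | add j w v w' v' _ _ h h' => exact (h hj p hp).add hπ hI hJ (h' hj p hp)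
  | smul j e w w' _ h => exact (h hj p hp).smul hπ hI hJ e
  | @theta i j h hjS s w w' _ ih =>
    subst h
    have hi : ¬ (n : ℤ) ∣ i - m := fun h =>
      hjS (mem_supportSet_iff.2 (Or.inr (by rwa [add_sub_cancel_right])))
    refine PathRel.theta hπ hI hJ s fun q hq => ih hi q ?_
    rw [hq, hp, stepsTo_eq_succ hn rfl hi]

/-- All products of operators θ leading from w' to the next index in m + nℤ vanish. Peeling them off
one at a time, the condition on J gives w' = 0; excluding j ≡ m + 1 keeps all intermediate indices
outside 𝒮. -/
theorem eq_zero_of_pathRel (hn : 2 ≤ n)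
    (hJt : ∀ j ∉ supportSet n m, ∀ w : (J.obj j).carrier (-j),
      (∀ s, hπ.theta hJ rfl s w = 0) → w = 0) {j : ℤ} {w' : (J.obj j).carrier (-j)}
    (hj : ¬ (n : ℤ) ∣ j - 1 - m)
    (h : ∀ {a b : V} (p : Quiver.Path a b), p.length = stepsTo n m j →
      PathRel hπ hI hJ φ p j 0 w') : w' = 0 := by
  generalize hl : stepsTo n m j = l at h
  induction l generalizing j with
  | zero =>
    have hjm : j ∈ supportSet n m := mem_supportSet_of_dvd (by
      by_contra hjm
      rw [stepsTo_eq_succ hn rfl hjm] at hl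
      omega)
    rw [hπ.eq_sum_vertex_smul w']
    refine Finset.sum_eq_zero fun b _ => ?_
    have := h (Quiver.Path.nil : Quiver.Path b b) rfl hjm
    rw [smul_zero, map_zero] at this
    exact this.symm
  | succ l ih =>
    have hjm : ¬ (n : ℤ) ∣ j - m := fun hjm => by
      rw [stepsTo_eq_zero hjm] at hl
      omega
    refine hJt j (fun hjS => (mem_supportSet_iff.1 hjS).elim hjm hj) w' fun s => ?_
    refine ih (by rwa [add_sub_cancel_right]) ?_ fun {a b} p hp => ?_
    · rw [stepsTo_eq_succ hn rfl hjm] at hl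
      omega
    · have := PathRel.theta hπ hI hJ (p := p) s fun q hq => h q (hq.trans (by rw [hp]))
      rwa [map_zero] at this

variable [∀ a b : V, Finite (a ⟶ b)] (hn : 2 ≤ n)
  (hinj : ∀ k < n, ∀ x ∈ degreePart K V k, π x = 0 → x = 0)
  (hIs : ∀ {i j : ℤ} (h : i + 1 = j), j ∉ supportSet n m →
    Function.Surjective ((dmap I (show i ≤ j by omega)).app (-j)))
  (hJt : ∀ j ∉ supportSet n m, ∀ w : (J.obj j).carrier (-j),
    (∀ s, hπ.theta hJ rfl s w = 0) → w = 0)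
  (hφ : ∀ {i j : ℤ} (h : i ≤ j) (hi : i ∈ supportSet n m) (hj : j ∈ supportSet n m),
    (∃ k, contractionIndex n m k = i ∧ contractionIndex n m (k + 1) = j) →
    ∀ l x, (φ j hj).app l ((dmap I h).app l x) = (dmap J h).app l ((φ i hi).app l x))

include hn hinj hJt hφ in
-- The difference of two partners of w is related to 0, hence is zero by the path criterion.
theorem Gam.unique {j : ℤ} {w : (I.obj j).carrier (-j)} {w' v' : (J.obj j).carrier (-j)}
    (h : Gam hπ hI hJ φ j w w') (h' : Gam hπ hI hJ φ j w v') : w' = v' := by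
  by_cases hj : j ∈ supportSet n m
  · rw [h.eq_app hπ hI hJ hj, h'.eq_app hπ hI hJ hj]
  · have h0 := h.sub hπ hI hJ h'
    rw [sub_self] at h0
    refine sub_eq_zero.1 (hπ.eq_zero_of_pathRel hI hJ (φ := φ) hn hJt ?_ fun p hp => ?_)
    · exact fun h => hj (mem_supportSet_iff.2 (Or.inr h))
    · exact h0.pathRel hπ hI hJ hn hinj hφ (not_dvd_of_not_mem hj) p hp

include hn hinj hIs hJt hφ in
theorem exists_hom_of_gam (j : ℤ) : ∃ g : I.obj j ⟶ J.obj j,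
    ∀ w, Gam hπ hI hJ φ j w (g.app (-j) w) := by
  choose ψ hψ using hπ.exists_gam hI hJ (φ := φ) hn hIs j
  obtain ⟨g, hg⟩ := (hJ j).exists_lift (M := I.obj j)
    { toFun := ψ
      map_add' := fun v w => Gam.unique hπ hI hJ hn hinj hJt hφ (hψ _)
        ((hψ v).add _ _ _ _ _ (hψ w))
      map_smul' := fun e w => Gam.unique hπ hI hJ hn hinj hJt hφ (hψ _)
        ((hψ w).smul _ e.unop _ _) }
  refine ⟨g, fun w => ?_⟩
  rw [hg]
  exact hψ w

include hn hinj hφ in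
-- The rule for θ stops before 𝒮, so entering 𝒮 needs an argument. From j ≡ m it is the commutation
-- of φ with a short differential; into j + 1 ≡ m it is the path relation for the single arrow s.
theorem Gam.theta_of_gam {j : ℤ} {w : (I.obj j).carrier (-j)} {w' : (J.obj j).carrier (-j)}
    (h : Gam hπ hI hJ φ j w w') (s : Arrows V) :
    Gam hπ hI hJ φ (j + 1) (hπ.theta hI rfl s w) (hπ.theta hJ rfl s w') := by
  by_cases hj : j + 1 ∈ supportSet n m
  · suffices (φ _ hj).app _ (hπ.theta hI rfl s w) = hπ.theta hJ rfl s w' by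
      rw [← this]
      exact .base _ hj _
    by_cases hjm : (n : ℤ) ∣ j - m
    · have hjS := mem_supportSet_of_dvd hjm
      obtain ⟨k, hk⟩ := hjm
      rw [mul_comm] at hk
      rw [h.eq_app hπ hI hJ hjS, theta_apply, theta_apply, ← hπ.app_dualElt (hI j) (hJ j)]
      refine hφ _ hjS hj ⟨2 * k, ?_, ?_⟩ _ _
      · rw [contractionIndex_even]
        omega
      · rw [contractionIndex_odd]
        omega
    · have hl : stepsTo n m j = 1 := by
        rw [stepsTo_eq_succ hn rfl hjm, stepsTo_eq_zero]
        exact (mem_supportSet_iff.1 hj).resolve_right (by rwa [add_sub_cancel_right])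
      have := h.pathRel hπ hI hJ hn hinj hφ hjm s.2.2.toPath hl.symm hj
      rwa [vertex_smul_theta hπ hI rfl s, vertex_smul_theta hπ hJ rfl s] at this
  · exact h.theta rfl hj s _ _

include hI hn hinj hIs hJt hφ in
-- The relation is the graph of Λ₀-linear maps on cogenerators, which extend to the modules by
-- cofreeness. They commute with the differentials because these are sums of operators θ, with which
-- the relation is compatible.
theorem exists_natTrans_extending :
    ∃ g : I ⟶ J, ∀ j (hj : j ∈ supportSet n m), g.app j = φ j hj := by
  have := Fintype.ofFinite (Arrows V)
  choose g hg using hπ.exists_hom_of_gam hI hJ hn hinj hIs hJt hφ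
  refine ⟨natTransOfSucc g fun j => (hJ (j + 1)).hom_ext fun x => ?_, fun j hj =>
    (hJ j).hom_ext fun w => (hg j w).eq_app hπ hI hJ hj⟩
  rw [comp_app, comp_app, hπ.dmap_eq_sum hI rfl, hπ.dmap_eq_sum hJ rfl, map_sum]
  refine Finset.sum_congr rfl fun s _ => ?_
  rw [← Hom.app_act]
  exact Gam.unique hπ hI hJ hn hinj hJt hφ
    ((hg j _).theta_of_gam hπ hI hJ hn hinj hφ s) (hg (j + 1) _)

end

variable [∀ a b : V, Finite (a ⟶ b)]

theorem full_restriction (hπ : IsGradedFactor 𝒜 π) {n : ℕ} (hn : 2 ≤ n) (m : ℤ)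
    (hrel : HasRelationsOfDegreeGE π n) : ((isGStar 𝒜 n m).ι ⋙ contraction 𝒜 hn m).Full where
  map_surjective {I J} f := by
    have hI := hπ.isCofree_obj I.obj
    have hJ := hπ.isCofree_obj J.obj
    let f' (k : ℤ) : I.obj.obj.obj (contractionIndex n m k) ⟶
      J.obj.obj.obj (contractionIndex n m k) := f.f k
    obtain ⟨φ, hφ⟩ : ∃ φ : ∀ j ∈ supportSet n m, I.obj.obj.obj j ⟶ J.obj.obj.obj j,
        ∀ k, φ _ (contractionIndex_mem_supportSet n m k) = f' k := by
      -- The morphism is reindexed from ℤ to 𝒮; injectivity of the enumeration makes the transport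
      -- along a chosen preimage harmless.
      choose c hc using fun (j : ℤ) (hj : j ∈ supportSet n m) => exists_contractionIndex hj
      refine ⟨fun j hj => hc j hj ▸ f' (c j hj), fun k => ?_⟩
      have key (l : ℤ) (h : contractionIndex n m l = contractionIndex n m k) :
          (h ▸ f' l : I.obj.obj.obj (contractionIndex n m k) ⟶ _) = f' k := by
        obtain rfl := (strictMono_contractionIndex hn m).injective h
        rfl
      exact key _ _
    obtain ⟨g, hg⟩ := hπ.exists_natTrans_extending hI hJ (φ := φ) hn
      (fun k hk x hx => eq_zero_of_hasRelationsOfDegreeGE hrel hk hx)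
      (fun h hj => hπ.surjective_of_isGStar (two_lt_of_not_mem hn hj) I.property h
        (not_dvd_of_not_mem hj))
      (fun j hj => (hπ.hom_dual_eq_zero_iff hJ j).1
        ((J.property (two_lt_of_not_mem hn hj)).1 j hj)) (by
        rintro _ _ h hi hj ⟨k, rfl, rfl⟩ l x
        rw [hφ, hφ]
        have := f.comm k (k + 1)
        change f' k ≫ ((contraction 𝒜 hn m).obj J.obj).d k (k + 1) =
          ((contraction 𝒜 hn m).obj I.obj).d k (k + 1) ≫ f' (k + 1) at this
        rw [contraction_d hn m _ rfl, contraction_d hn m _ rfl] at this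
        exact (congr_app this l x).symm)
    refine ⟨ObjectProperty.homMk (ObjectProperty.homMk g), ?_⟩
    ext k : 1
    exact (hg _ (contractionIndex_mem_supportSet n m k)).trans (hφ k)

end IsGradedFactor

end

theorem mainTheorem4 {K : Type w} [Field K] {Λ : Type u} [Ring Λ] [Algebra K Λ]
    (𝒜 : ℤ → Submodule K Λ) [GradedAlgebra 𝒜]
    {V : Type v₁} [Quiver.{v₂} V] [Fintype V] [∀ a b : V, Finite (a ⟶ b)]
    (π : PathAlgebra K V →ₐ[K] Λ) (hπ : IsGradedFactor 𝒜 π)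
    (n : ℕ) (hn : 2 ≤ n) (m : ℤ) :
    -- `H` is an exact (additive) functor on the abelian category of linear `n`-complexes
    (IsAbelianCategory (LinearNComplex 𝒜 n) ∧
      (contraction 𝒜 hn m).Additive ∧
      Limits.PreservesFiniteLimits (contraction 𝒜 hn m) ∧
      Limits.PreservesFiniteColimits (contraction 𝒜 hn m)) ∧
    -- `Ker H = 𝒯*`, and the functor induced by `H` on the quotient category is faithful
    ((∀ I : LinearNComplex 𝒜 n,
        Limits.IsZero ((contraction 𝒜 hn m).obj I) ↔ torsionClass 𝒜 n m I) ∧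
      ∃ hH : (isoModulo (torsionClass 𝒜 n m)).IsInvertedBy (contraction 𝒜 hn m),
        (Localization.Construction.lift (contraction 𝒜 hn m) hH).Faithful) ∧
    -- the restriction of `H` to `𝒢*(𝒮, 𝒰)` is faithful, with the following essential image
    (((isGStar 𝒜 n m).ι ⋙ contraction 𝒜 hn m).Faithful ∧
      ∀ C : CochainComplex (GrMod 𝒜) ℤ,
        ((isGStar 𝒜 n m).ι ⋙ contraction 𝒜 hn m).essImage C ↔
          (contraction 𝒜 hn m).essImage C ∧
          (∀ j : ℤ, (C.X j).IsAlmostInjective ∧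
            (C.X j).IsCogeneratedInDegree (-contractionIndex n m j)) ∧
          (2 < n → ∀ j : ℤ, GrMod.SocleLERange (C.d (2 * j) (2 * j + 1)))) ∧
    -- if `Λ` has relations of degree `≥ n`, this restriction is also full
    (HasRelationsOfDegreeGE π n →
      ((isGStar 𝒜 n m).ι ⋙ contraction 𝒜 hn m).Full) := by
  exact
    ⟨⟨hπ.isAbelianCategory n, inferInstance, hπ.preservesFiniteLimits_contraction hn m,
        hπ.preservesFiniteColimits_contraction hn m⟩,
      ⟨isZero_contraction_iff hn m, hπ.faithful_quotient hn m⟩,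
      ⟨hπ.faithful_restriction hn m, hπ.essImage_iff hn m⟩, hπ.full_restriction hn m⟩
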